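/- **Lemma (general virial identity).** Let $N\ge 1$ be an integer, $s\in[\tfrac12,1)$, $\sigma>0$ and $0<T\le\infty$. Let $$u\in C\big([0,T);\,H^{2s}(\mathbb{R}^N)\cap L^{2\sigma+2}(\mathbb{R}^N)\big)$$ be a complex-valued solution, not necessarily radial, of $$ i\,\partial_t u=(-\Delta)^s u-|u|^{2\sigma}u ,$$ in the sense that for every $\psi\in C_c^\infty(\mathbb{R}^N)$ the function $t\mapsto\int\psi\,u(t)\,dx$ is differentiable on $[0,T)$ (one-sidedly at $t=0$) with $i\frac{d}{dt}\int\psi\, u(t)\,dx=\int\psi\,(-\Delta)^su(t)\,dx-\int\psi\,|u(t)|^{2\sigma}u(t)\,dx$. Let $\varphi:\mathbb{R}^N\to\mathbb{R}$ be locally integrable with weak gradient $\nabla\varphi\in W^{3,\infty}(\mathbb{R}^N)$, and put $$\mathcal M_\varphi[u(t)]=2\,\mathrm{Im}\int_{\mathbb{R}^N}\overline{u}(t)\,\nabla\varphi\cdot\nabla u(t)\,dx,\qquad u_m(t)=c_s(-\Delta+m)^{-1}u(t)\quad(m>0),\qquad c_s=\sqrt{\frac{\sin\pi s}{\pi}}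 .$$ Then $t\mapsto\mathcal M_\varphi[u(t)]$ is differentiable on $[0,T)$ (one-sidedly at $t=0$), and for every $t\in[0,T)$ $$\frac{d}{dt}\mathcal M_\varphi[u(t)]=\int_0^\infty m^s\int_{\mathbb{R}^N}\Big\{4\,\overline{\partial_k u_m}\,(\partial^2_{kl}\varphi)\,\partial_l u_m-(\Delta^2\varphi)|u_m|^2\Big\}\,dx\,dm-\frac{2\sigma}{\sigma+1}\int_{\mathbb{R}^N}(\Delta\varphi)\,|u|^{2\sigma+2}\,dx ,$$ with summation over $k,l=1,\dots,N$. All derivatives of $\varphi$, $u$ and $u_m$ in space are weak derivatives. Moreover the integral defining $\mathcal M_\varphi[u(t)]$, the inner $x$-integral for each $m>0$, the outer $m$-integral of the resulting function of $m$, and the last integral all converge absolutely. -/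

import Mathlib

open MeasureTheory Set Filter Topology FourierTransform
open scoped SchwartzMap ContDiff ENNReal

noncomputable section

namespace FracNLS

/-- Euclidean space `ℝ^N`. -/
abbrev E (N : ℕ) : Type := EuclideanSpace ℝ (Fin N)

/-- The complex Hilbert space `L²(ℝ^N)`. -/
abbrev L2 (N : ℕ) : Type := Lp ℂ 2 (volume : Measure (E N))

variable {N : ℕ} {F : Type*} [NormedAddCommGroup F] [NormedSpace ℝ F]

/-- Real-valued test functions: smooth with compact support. -/
def IsTest (ψ : E N → ℝ) : Prop := ContDiff ℝ ∞ ψ ∧ HasCompactSupport ψ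

/-- `g` is a weak partial derivative `∂_k f` (both functions are locally integrable). -/
def HasWeakPartial (k : Fin N) (f g : E N → F) : Prop :=
  LocallyIntegrable f ∧ LocallyIntegrable g ∧
    ∀ ψ : E N → ℝ, IsTest ψ →
      ∫ x, (fderiv ℝ ψ x (EuclideanSpace.single k (1 : ℝ))) • f x = - ∫ x, ψ x • g x

open Classical in
/-- The weak partial derivative `∂_k f` (unique up to null sets); zero if there is none. -/
def weakPartial (k : Fin N) (f : E N → F) : E N → F :=
  if h : ∃ g, HasWeakPartial k f g then h.choose else 0

/-- The Laplacian `Δ f = ∑_k ∂_k ∂_k f` in the weak sense. -/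
def weakLaplacian (f : E N → F) : E N → F :=
  fun x => ∑ k, weakPartial k (weakPartial k f) x

/-- Membership in the Sobolev space `W^{n,∞}(ℝ^N)`. -/
def MemWInfty : ℕ → (E N → ℝ) → Prop
  | 0, f => MemLp f ∞ volume
  | n + 1, f => MemLp f ∞ volume ∧ ∀ k, ∃ g, HasWeakPartial k f g ∧ MemWInfty n g

/-- `∇φ ∈ W^{n,∞}(ℝ^N)` for a locally integrable real-valued function `φ`. -/
def GradMemWInfty (n : ℕ) (φ : E N → ℝ) : Prop :=
  LocallyIntegrable φ ∧ ∀ k, ∃ g, HasWeakPartial k φ g ∧ MemWInfty n g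

open Classical in
/-- The operator `𝓕⁻¹ a 𝓕` on `L²(ℝ^N)` with its maximal domain `{f | a 𝓕 f ∈ L²}`;
zero off the domain. The Fourier transform is normalised with the kernel `exp (-2πi x·ξ)`. -/
def l2Multiplier (a : E N → ℝ) (f : L2 N) : L2 N :=
  if h : MemLp (fun ξ => (a ξ : ℂ) * (𝓕 f : L2 N) ξ) 2 volume then 𝓕⁻ (h.toLp _) else 0

/-- The fractional Laplacian `(-Δ)^s`, whose symbol is `(2π|ξ|)^{2s}` in the normalisation of the
Fourier transform used here (that is, `|ξ|^{2s}` for the kernel `exp (-i x·ξ)`). -/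
def fracLaplacian (s : ℝ) (f : L2 N) : L2 N :=
  l2Multiplier (fun ξ => (2 * Real.pi * ‖ξ‖) ^ (2 * s)) f

/-- The constant `c_s = √(sin(πs)/π)`. -/
def cs (s : ℝ) : ℝ := √(Real.sin (Real.pi * s) / Real.pi)

/-- The auxiliary function `u_m = c_s (-Δ + m)⁻¹ u`. -/
def aux (s m : ℝ) (f : L2 N) : L2 N :=
  (cs s : ℂ) • l2Multiplier (fun ξ => 1 / ((2 * Real.pi * ‖ξ‖) ^ 2 + m)) f

/-- The time interval `[0,T)`, where `T = ∞` is allowed. -/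
def timeInterval (T : EReal) : Set ℝ := {t | 0 ≤ t ∧ (t : EReal) < T}

/-- `u ∈ C(I; H^r(ℝ^N))`: the function `(1 + |ξ|²)^{r/2} 𝓕 u(t)` is, up to the unitary map `𝓕`,
an element `v t` of `L²` that depends continuously on `t ∈ I`. -/
def ContinuousInSobolev (r : ℝ) (I : Set ℝ) (u : ℝ → L2 N) : Prop :=
  ∃ v : ℝ → L2 N, ContinuousOn v I ∧
    ∀ t ∈ I, TemperedDistribution.besselPotential (E N) ℂ r (u t : 𝓢'(E N, ℂ)) =
      (v t : 𝓢'(E N, ℂ))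

/-- `u ∈ C(I; L^p(ℝ^N))`. -/
def ContinuousInLp (p : ℝ≥0∞) (I : Set ℝ) (u : ℝ → L2 N) : Prop :=
  (∀ t ∈ I, MemLp (u t) p volume) ∧
    ∀ t ∈ I, Tendsto (fun τ => eLpNorm (fun x => u τ x - u t x) p volume) (𝓝[I] t) (𝓝 0)

/-- `u ∈ C([0,T); H^{2s}(ℝ^N) ∩ L^{2σ+2}(ℝ^N))` solves `i ∂_t u = (-Δ)^s u - |u|^{2σ} u`, where the
equation is understood in the sense of distributions on `ℝ^N` at every time. -/
structure IsSolution (s σ : ℝ) (T : EReal) (u : ℝ → L2 N) : Prop where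
  sobolev : ContinuousInSobolev (2 * s) (timeInterval T) u
  lebesgue : ContinuousInLp (ENNReal.ofReal (2 * σ + 2)) (timeInterval T) u
  equation : ∀ ψ : E N → ℝ, IsTest ψ → ∀ t ∈ timeInterval T, ∃ d : ℂ,
    HasDerivWithinAt (fun τ => ∫ x, ψ x • u τ x) d (timeInterval T) t ∧
      Complex.I * d = (∫ x, ψ x • fracLaplacian s (u t) x)
        - ∫ x, ψ x • ((‖u t x‖ ^ (2 * σ) : ℝ) • u t x)

/-- The integrand `ū ∇φ·∇u` of the localized virial. -/
def virialDensity (φ : E N → ℝ) (f : L2 N) (x : E N) : ℂ :=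
  (starRingEnd ℂ) (f x) * ∑ k, ((weakPartial k φ x : ℝ) : ℂ) * weakPartial k f x

/-- The localized virial `M_φ[u] = 2 Im ∫ ū ∇φ·∇u dx`. -/
def virial (φ : E N → ℝ) (f : L2 N) : ℝ := 2 * (∫ x, virialDensity φ f x).im

/-- The function `4 ∂_k f̄ (∂²_{kl} φ) ∂_l f - (Δ²φ) |f|²`, summed over `k` and `l`. -/
def dispersiveDensity (φ : E N → ℝ) (f : L2 N) (x : E N) : ℂ :=
  4 * (∑ k, ∑ l, (starRingEnd ℂ) (weakPartial k f x) *
      ((weakPartial k (weakPartial l φ) x : ℝ) : ℂ) * weakPartial l f x)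
    - ((weakLaplacian (weakLaplacian φ) x : ℝ) : ℂ) * ((‖f x‖ ^ 2 : ℝ) : ℂ)

end FracNLS

end

noncomputable section

namespace FracNLS

variable {N : ℕ} {F : Type*} [NormedAddCommGroup F] [NormedSpace ℝ F]

/-! Let A = 2∇φ·∇ + Δφ (`gen`). Integration by parts makes A antisymmetric on H¹ (`inner_gen`), and
∫ Δφ |u|² is real, so the virial equals Im⟨u, Au⟩ (`virial_eq`). Formally its time derivative is 2
Im⟨∂ₜu, Au⟩, that is, 2 Re⟨(-Δ)^s u, Au⟩ - 2 Re⟨|u|^{2σ}u, Au⟩.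

Dispersive part. Balakrishnan's formula (`inner_fracLaplacian`) writes (-Δ)^s as sin(πs)/π times the
integral of m^{s-1} (-Δ)(-Δ+m)⁻¹ over m > 0. With v = (-Δ+m)⁻¹u one has u = -Δv + mv, where -Δv is
again in H¹. Antisymmetry kills Re⟨-Δv, A(-Δv)⟩, so 2 Re⟨-Δv, Au⟩ = m · 2 Re⟨-Δv, Av⟩, and the
classical commutator computation for v turns this into the Hessian form (`two_mul_re_inner_gen`,
`re_inner_resolvent`). The extra m raises m^{s-1} to m^s, and c_s² is the factor sin(πs)/π.

Nonlinear part. The function |u|^{2σ}u is only known to lie in the dual of L^{2σ+2}, while Au is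
only in L², so the formal pairing need not make sense. Therefore u is replaced by T(u), where T z =
step(ε|z|²) z. Since DT(z)(iz) = iT(z), the velocity of T(u) is DT(u)(-i(-Δ)^s u) + i|u|^{2σ}T(u),
which lies in L² and is continuous in time. The nonlinear term is then the integral of ∇φ against
the gradient of a primitive of 2 Re(conj(|z|^{2σ}Tz) dT), plus a pointwise Δφ term
(`re_inner_pow_gen`).

The chain rule in time is the delicate point, because u itself is differentiable only when tested.
The Taylor remainder of T is quadratic, and ‖u(r) - u(t)‖² = o(|r-t|) in L²
(`IsSolution.norm_sub_sq_isLittleO`): this follows by testing the equation with truncations of the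
conjugate increment itself. The virial identity for T(u) is then integrated in time, ε tends to 0 by
dominated convergence (`IsSolution.integral_virialRate`), and continuity of the limiting rate allows
differentiating again. -/

/-- The `k`-th standard basis vector. -/
abbrev e (k : Fin N) : E N := EuclideanSpace.single k (1 : ℝ)

/-! ### Mollification, cutoffs and integration by parts for weak derivatives. -/

open scoped Convolution in
-- Uniform continuity of g makes the mollifications converge uniformly, and once the radius is below
-- 1 they vanish outside the ball of radius R + 1. Hence (C + 1)|c| on that ball dominates.
theorem tendsto_integral_mollify_smul {g : E N → ℝ} (hg : Continuous g) (hgs : HasCompactSupport g)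
    {c : E N → ℝ} (hc : LocallyIntegrable c) {φ : ℕ → ContDiffBump (0 : E N)}
    (hφ : Tendsto (fun n => (φ n).rOut) atTop (𝓝 0)) :
    Tendsto (fun n => ∫ x, ((φ n).normed volume ⋆[ContinuousLinearMap.lsmul ℝ ℝ, volume] g) x • c x)
      atTop (𝓝 (∫ x, g x • c x)) := by
  obtain ⟨R, hR⟩ := hgs.isCompact.isBounded.subset_closedBall (0 : E N)
  have hzero : ∀ x, R < ‖x‖ → g x = 0 := fun x hx => by
    by_contra h
    have := hR (subset_tsupport g h)
    simp at this; linarith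
  obtain ⟨C, hC⟩ := hg.bounded_above_of_compact_support hgs
  have hunif := hgs.uniformContinuous_of_continuous hg
  have hdist : ∀ ε > 0, ∀ᶠ n in atTop, ∀ x,
      dist (((φ n).normed volume ⋆[ContinuousLinearMap.lsmul ℝ ℝ, volume] g) x) (g x) ≤ ε := by
    intro ε hε
    obtain ⟨δ, hδ, h⟩ := Metric.uniformContinuous_iff.1 hunif ε hε
    filter_upwards [hφ.eventually_lt_const hδ] with n hn x
    refine ContDiffBump.dist_normed_convolution_le hg.aestronglyMeasurable fun y hy => ?_
    exact (h (lt_trans (Metric.mem_ball.1 hy) hn)).le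
  refine tendsto_integral_filter_of_dominated_convergence
    ((Metric.closedBall (0 : E N) (R + 1)).indicator fun x => (C + 1) * ‖c x‖) ?_ ?_ ?_ ?_
  · refine Eventually.of_forall fun n => ?_
    have h1 : Continuous ((φ n).normed volume ⋆[ContinuousLinearMap.lsmul ℝ ℝ, volume] g) :=
      hgs.continuous_convolution_right _ ((φ n).continuous_normed.locallyIntegrable) hg
    exact h1.aestronglyMeasurable.smul hc.aestronglyMeasurable
  · filter_upwards [hdist 1 one_pos, hφ.eventually_lt_const one_pos] with n hn hr
    refine Eventually.of_forall fun x => ?_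
    by_cases hx : ‖x‖ ≤ R + 1
    · rw [indicator_of_mem (by simpa using hx), norm_smul]
      gcongr
      have := hn x
      rw [dist_eq_norm] at this
      calc _ ≤ ‖g x‖ + ‖((φ n).normed volume ⋆[ContinuousLinearMap.lsmul ℝ ℝ, volume] g) x - g x‖ :=
            norm_le_insert' _ _
        _ ≤ C + 1 := add_le_add (hC x) this
    · rw [indicator_of_notMem (by simpa using hx)]
      have : ((φ n).normed volume ⋆[ContinuousLinearMap.lsmul ℝ ℝ, volume] g) x = g x := by
        refine ContDiffBump.normed_convolution_eq_right fun y hy => ?_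
        rw [Metric.mem_ball, dist_eq_norm] at hy
        rw [hzero x (by linarith), hzero y]
        have := norm_le_insert' x y
        rw [norm_sub_rev] at this
        linarith
      simp [this, hzero x (by linarith)]
  · refine IntegrableOn.integrable_indicator ?_ Metric.isClosed_closedBall.measurableSet
    exact ((hc.integrableOn_isCompact (isCompact_closedBall _ _)).norm).const_mul _
  · refine Eventually.of_forall fun x => ?_
    refine Tendsto.smul_const ?_ _
    rw [Metric.tendsto_nhds]
    intro ε hε
    filter_upwards [hdist (ε / 2) (by positivity)] with n hn
    exact (hn x).trans_lt (by linarith)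

open scoped Convolution in
/-- The test functions in the definition of a weak derivative may be taken in `C¹_c`. -/
theorem HasWeakPartial.integral_fderiv_smul_of_hasCompactSupport {k : Fin N} {c c' : E N → ℝ}
    (h : HasWeakPartial k c c') {ψ : E N → ℝ} (hψ : ContDiff ℝ 1 ψ) (hs : HasCompactSupport ψ) :
    ∫ x, fderiv ℝ ψ x (e k) • c x = - ∫ x, ψ x • c' x := by
  obtain ⟨hc, hc', h⟩ := h
  let φ : ℕ → ContDiffBump (0 : E N) := fun n =>
    ⟨1 / (n + 2), 1 / (n + 1), by positivity, by
      refine one_div_lt_one_div_of_lt (by positivity) (by linarith)⟩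
  have hφ : Tendsto (fun n => (φ n).rOut) atTop (𝓝 0) := tendsto_one_div_add_atTop_nhds_zero_nat
  have hd : Continuous fun x => fderiv ℝ ψ x (e k) :=
    (hψ.continuous_fderiv one_ne_zero).clm_apply continuous_const
  have hds : HasCompactSupport fun x => fderiv ℝ ψ x (e k) := hs.fderiv_apply ℝ (e k)
  have h1 := tendsto_integral_mollify_smul hd hds hc hφ
  have h2 := (tendsto_integral_mollify_smul hψ.continuous hs hc' hφ).neg
  refine tendsto_nhds_unique h1 (h2.congr fun n => ?_)
  have ht : IsTest ((φ n).normed volume ⋆[ContinuousLinearMap.lsmul ℝ ℝ, volume] ψ) :=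
    ⟨(φ n).hasCompactSupport_normed.contDiff_convolution_left _ (φ n).contDiff_normed
      hψ.continuous.locallyIntegrable,
      (φ n).hasCompactSupport_normed.convolution _ hs⟩
  rw [← h _ ht]
  refine integral_congr_ae (Eventually.of_forall fun x => ?_)
  simp only
  congr 1
  -- The derivative of the convolution is put on the factor ψ, so ∂ₖ of the mollified ψ is the
  -- mollified ∂ₖψ, as in `h1`.
  rw [(hs.hasFDerivAt_convolution_right (ContinuousLinearMap.lsmul ℝ ℝ)
    ((φ n).continuous_normed.locallyIntegrable (μ := volume)) hψ x).fderiv]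
  rw [convolution_precompR_apply _ ((φ n).continuous_normed.locallyIntegrable) (hs.fderiv ℝ)
    (hψ.continuous_fderiv one_ne_zero)]

/-- A smooth cutoff function on the ball of radius `n + 1`. -/
def cutoff (N : ℕ) (n : ℕ) (x : E N) : ℝ :=
  (⟨1, 2, one_pos, one_lt_two⟩ : ContDiffBump (0 : E N)) (((n : ℝ) + 1)⁻¹ • x)

theorem contDiff_cutoff (n : ℕ) : ContDiff ℝ ∞ (cutoff N n) :=
  (ContDiffBump.contDiff _).comp (contDiff_const_smul _)

theorem hasCompactSupport_cutoff (n : ℕ) : HasCompactSupport (cutoff N n) :=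
  (ContDiffBump.hasCompactSupport _).comp_smul (by positivity)

theorem norm_cutoff_le (n : ℕ) (x : E N) : ‖cutoff N n x‖ ≤ 1 := by
  rw [cutoff, Real.norm_of_nonneg (ContDiffBump.nonneg _)]
  exact ContDiffBump.le_one _

theorem tendsto_cutoff (x : E N) : Tendsto (fun n => cutoff N n x) atTop (𝓝 1) := by
  have h : Tendsto (fun n : ℕ => (((n : ℝ) + 1)⁻¹) • x) atTop (𝓝 0) := by
    have := (tendsto_one_div_add_atTop_nhds_zero_nat (𝕜 := ℝ)).smul_const x
    simpa using this
  have h2 := ((ContDiffBump.continuous (⟨1, 2, one_pos, one_lt_two⟩ : ContDiffBump (0 : E N))).tendsto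
    0).comp h
  rwa [ContDiffBump.one_of_mem_closedBall _ (by simp)] at h2

/-- Dilating a fixed bump by n + 1 gains a factor 1/(n+1), so the terms in which the cutoff is
differentiated vanish in the limit. -/
theorem exists_norm_fderiv_cutoff_le (N : ℕ) :
    ∃ C, ∀ n (x v : E N), ‖fderiv ℝ (cutoff N n) x v‖ ≤ C * ((n : ℝ) + 1)⁻¹ * ‖v‖ := by
  let f : ContDiffBump (0 : E N) := ⟨1, 2, one_pos, one_lt_two⟩
  obtain ⟨C, hC⟩ := ((f.contDiff (n := 1)).continuous_fderiv one_ne_zero).bounded_above_of_compact_support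
    (f.hasCompactSupport.fderiv ℝ)
  refine ⟨C, fun n x v => ?_⟩
  have : HasFDerivAt (cutoff N n) ((fderiv ℝ f (((n : ℝ) + 1)⁻¹ • x)).comp
      (((n : ℝ) + 1)⁻¹ • ContinuousLinearMap.id ℝ (E N))) x :=
    HasFDerivAt.comp x (((f.contDiff (n := 1)).differentiable one_ne_zero _).hasFDerivAt)
      (((((n : ℝ) + 1)⁻¹) • ContinuousLinearMap.id ℝ (E N)).hasFDerivAt)
  rw [this.fderiv]
  have h1 := (fderiv ℝ f (((n : ℝ) + 1)⁻¹ • x)).le_opNorm ((((n : ℝ) + 1)⁻¹) • v)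
  rw [norm_smul, norm_inv, Real.norm_of_nonneg (by positivity : (0 : ℝ) ≤ (n : ℝ) + 1)] at h1
  refine h1.trans ?_
  rw [mul_assoc]
  gcongr
  exact hC _

/-- Integration by parts of a bounded function with bounded weak derivative against a `C¹` function
in `W^{1,1}`. -/
theorem HasWeakPartial.integral_smul_fderiv_real {k : Fin N} {c c' : E N → ℝ}
    (h : HasWeakPartial k c c') (hc : MemLp c ∞ volume) (hc' : MemLp c' ∞ volume)
    {ψ : E N → ℝ} (hψ : ContDiff ℝ 1 ψ) (hi : Integrable ψ)
    (hi' : Integrable fun x => fderiv ℝ ψ x (e k)) :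
    ∫ x, c x * fderiv ℝ ψ x (e k) = - ∫ x, c' x * ψ x := by
  obtain ⟨C, hC⟩ := exists_norm_fderiv_cutoff_le N
  have hC0 : 0 ≤ C := by
    have := (norm_nonneg _).trans (hC 0 0 (e k))
    simpa using this
  have hcψ : Integrable fun x => c' x * ψ x := hi.mul_of_top_right hc'
  have hcψ' : Integrable fun x => c x * fderiv ℝ ψ x (e k) := hi'.mul_of_top_right hc
  have hcψ2 : Integrable fun x => c x * ψ x := hi.mul_of_top_right hc
  have hd : ∀ n x, fderiv ℝ (fun x => cutoff N n x * ψ x) x (e k) =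
      cutoff N n x * fderiv ℝ ψ x (e k) + ψ x * fderiv ℝ (cutoff N n) x (e k) := by
    intro n x
    rw [fderiv_fun_mul ((contDiff_cutoff n).differentiable (by simp) x)
      (hψ.differentiable one_ne_zero x)]
    simp
  -- The compactly supported version is applied to cutoff · ψ; n → ∞ then removes the cutoff by
  -- dominated convergence.
  have key : ∀ n, ∫ x, (cutoff N n x * (c x * fderiv ℝ ψ x (e k)) +
      fderiv ℝ (cutoff N n) x (e k) * (c x * ψ x)) = - ∫ x, cutoff N n x * (c' x * ψ x) := by
    intro n
    have := h.integral_fderiv_smul_of_hasCompactSupport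
      (ψ := fun x => cutoff N n x * ψ x) (((contDiff_cutoff n).of_le (by simp)).mul hψ)
      ((hasCompactSupport_cutoff n).mul_right)
    simp only [hd, smul_eq_mul] at this
    convert this using 2
    · ext x; ring
    · congr 1; ext x; ring
  refine tendsto_nhds_unique ?_ ((tendsto_integral_of_dominated_convergence
    (fun x => ‖c' x * ψ x‖) ?_ hcψ.norm ?_ ?_).neg.congr fun n => (key n).symm)
  · refine tendsto_integral_of_dominated_convergence
      (fun x => ‖c x * fderiv ℝ ψ x (e k)‖ + C * ‖c x * ψ x‖) ?_ ?_ ?_ ?_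
    · intro n
      exact ((contDiff_cutoff n).continuous.aestronglyMeasurable.mul hcψ'.1).add
        ((((contDiff_cutoff n).continuous_fderiv (by simp)).clm_apply
          continuous_const).aestronglyMeasurable.mul hcψ2.1)
    · exact hcψ'.norm.add (hcψ2.norm.const_mul C)
    · refine fun n => Eventually.of_forall fun x => (norm_add_le _ _).trans ?_
      rw [norm_mul (cutoff N n x), norm_mul (fderiv ℝ (cutoff N n) x (e k))]
      gcongr
      · exact mul_le_of_le_one_left (norm_nonneg _) (norm_cutoff_le n x)
      · refine (hC n x (e k)).trans ?_
        simp only [PiLp.norm_single, norm_one, mul_one]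
        exact mul_le_of_le_one_right hC0 (inv_le_one_of_one_le₀ (by simp))
    · refine Eventually.of_forall fun x => ?_
      have h1 := (tendsto_cutoff x).mul_const (c x * fderiv ℝ ψ x (e k))
      have h2 : Tendsto (fun n => fderiv ℝ (cutoff N n) x (e k)) atTop (𝓝 0) := by
        refine squeeze_zero_norm (fun n => hC n x (e k)) ?_
        have := ((tendsto_one_div_add_atTop_nhds_zero_nat (𝕜 := ℝ)).const_mul C).mul_const
          ‖(e k : E N)‖
        simpa using this
      simpa using h1.add (h2.mul_const (c x * ψ x))
  · exact fun n => (contDiff_cutoff n).continuous.aestronglyMeasurable.mul hcψ.1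
  · refine fun n => Eventually.of_forall fun x => ?_
    rw [norm_mul]
    exact mul_le_of_le_one_left (norm_nonneg _) (norm_cutoff_le n x)
  · refine Eventually.of_forall fun x => ?_
    simpa using (tendsto_cutoff x).mul_const (c' x * ψ x)

theorem HasWeakPartial.integral_mul_fderiv {k : Fin N} {c c' : E N → ℝ}
    (h : HasWeakPartial k c c') (hc : MemLp c ∞ volume) (hc' : MemLp c' ∞ volume)
    {ψ : E N → ℂ} (hψ : ContDiff ℝ 1 ψ) (hi : Integrable ψ)
    (hi' : Integrable fun x => fderiv ℝ ψ x (e k)) :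
    ∫ x, (c x : ℂ) * fderiv ℝ ψ x (e k) = - ∫ x, (c' x : ℂ) * ψ x := by
  have hcψ : Integrable fun x => (c' x : ℂ) * ψ x := hi.mul_of_top_right hc'.ofReal
  have hcψ' : Integrable fun x => (c x : ℂ) * fderiv ℝ ψ x (e k) := hi'.mul_of_top_right hc.ofReal
  have hL : ∀ L : ℂ →L[ℝ] ℝ, ∀ x, fderiv ℝ (fun x => L (ψ x)) x (e k) = L (fderiv ℝ ψ x (e k)) := by
    intro L x
    have := (L.hasFDerivAt (x := ψ x)).comp x (hψ.differentiable one_ne_zero x).hasFDerivAt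
    rw [HasFDerivAt.fderiv (f := fun x => L (ψ x)) this]
    rfl
  have key : ∀ L : ℂ →L[ℝ] ℝ, (∀ (r : ℝ) z, L (r * z) = r * L z) →
      L (∫ x, (c x : ℂ) * fderiv ℝ ψ x (e k)) = L (- ∫ x, (c' x : ℂ) * ψ x) := by
    intro L hLr
    rw [map_neg, ← L.integral_comp_comm hcψ, ← L.integral_comp_comm hcψ']
    simp only [hLr, ← hL]
    refine h.integral_smul_fderiv_real hc hc' (L.contDiff.comp hψ) (L.integrable_comp hi) ?_
    simp only [hL]
    exact L.integrable_comp hi'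
  exact Complex.ext (key Complex.reCLM (by simp)) (key Complex.imCLM (by simp))

/-! ### Uniqueness and calculus of weak partial derivatives; the spaces W^{n,∞}. -/

theorem HasWeakPartial.congr {k : Fin N} {f f' g g' : E N → F} (h : HasWeakPartial k f g)
    (hf : f =ᵐ[volume] f') (hg : g =ᵐ[volume] g') : HasWeakPartial k f' g' := by
  refine ⟨h.1.congr hf, h.2.1.congr hg, fun ψ hψ => ?_⟩
  have h1 : ∫ x, (fderiv ℝ ψ x (e k)) • f' x = ∫ x, (fderiv ℝ ψ x (e k)) • f x :=
    integral_congr_ae (hf.mono fun x hx => by simp only [hx])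
  have h2 : ∫ x, ψ x • g' x = ∫ x, ψ x • g x :=
    integral_congr_ae (hg.mono fun x hx => by simp only [hx])
  rw [h1, h2, h.2.2 ψ hψ]

theorem HasWeakPartial.ae_unique [CompleteSpace F] {k : Fin N} {f g g' : E N → F}
    (h : HasWeakPartial k f g) (h' : HasWeakPartial k f g') : g =ᵐ[volume] g' := by
  refine ae_eq_of_integral_contDiff_smul_eq h.2.1 h'.2.1 fun ψ h1 h2 => ?_
  rw [← neg_inj, ← h.2.2 ψ ⟨h1, h2⟩, ← h'.2.2 ψ ⟨h1, h2⟩]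

theorem HasWeakPartial.hasWeakPartial_weakPartial {k : Fin N} {f g : E N → F}
    (h : HasWeakPartial k f g) : HasWeakPartial k f (weakPartial k f) := by
  have h' : ∃ g, HasWeakPartial k f g := ⟨g, h⟩
  rw [weakPartial, dif_pos h']
  exact h'.choose_spec

/-- The function selected by choice in `weakPartial` may thus be replaced by any explicit weak
derivative, up to a null set. -/
theorem HasWeakPartial.weakPartial_ae_eq [CompleteSpace F] {k : Fin N} {f g : E N → F}
    (h : HasWeakPartial k f g) : weakPartial k f =ᵐ[volume] g :=
  h.hasWeakPartial_weakPartial.ae_unique h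

theorem IsTest.continuous {ψ : E N → ℝ} (h : IsTest ψ) : Continuous ψ := h.1.continuous

theorem IsTest.fderiv_apply {ψ : E N → ℝ} (h : IsTest ψ) (v : E N) :
    IsTest fun x => fderiv ℝ ψ x v :=
  ⟨(h.1.fderiv_right (by simp)).clm_apply contDiff_const, h.2.fderiv_apply ℝ v⟩

theorem IsTest.integrable_smul {ψ : E N → ℝ} (h : IsTest ψ) {f : E N → F}
    (hf : LocallyIntegrable f) : Integrable fun x => ψ x • f x :=
  hf.integrable_smul_left_of_hasCompactSupport h.continuous h.2

theorem HasWeakPartial.add {k : Fin N} {f f' g g' : E N → F} (h : HasWeakPartial k f g)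
    (h' : HasWeakPartial k f' g') :
    HasWeakPartial k (fun x => f x + f' x) (fun x => g x + g' x) := by
  refine ⟨h.1.add h'.1, h.2.1.add h'.2.1, fun ψ hψ => ?_⟩
  simp only [smul_add]
  rw [integral_add ((hψ.fderiv_apply _).integrable_smul h.1)
    ((hψ.fderiv_apply _).integrable_smul h'.1), integral_add (hψ.integrable_smul h.2.1)
    (hψ.integrable_smul h'.2.1), h.2.2 ψ hψ, h'.2.2 ψ hψ, neg_add]

theorem hasWeakPartial_zero (k : Fin N) : HasWeakPartial k (fun _ => (0 : F)) (fun _ => 0) :=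
  ⟨locallyIntegrable_zero, locallyIntegrable_zero, by simp⟩

theorem memWInfty_zero (n : ℕ) : MemWInfty n (fun _ : E N => (0 : ℝ)) := by
  induction n with
  | zero => exact MemLp.zero
  | succ n ih => exact ⟨MemLp.zero, fun k => ⟨_, hasWeakPartial_zero k, ih⟩⟩

theorem MemWInfty.memLp {n : ℕ} {f : E N → ℝ} (h : MemWInfty n f) : MemLp f ∞ volume := by
  cases n with
  | zero => exact h
  | succ n => exact h.1

theorem MemWInfty.add {n : ℕ} {f g : E N → ℝ} (hf : MemWInfty n f) (hg : MemWInfty n g) :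
    MemWInfty n fun x => f x + g x := by
  induction n generalizing f g with
  | zero => exact MemLp.add hf hg
  | succ n ih =>
    refine ⟨hf.1.add hg.1, fun k => ?_⟩
    obtain ⟨f', hf', h1⟩ := hf.2 k
    obtain ⟨g', hg', h2⟩ := hg.2 k
    exact ⟨_, hf'.add hg', ih h1 h2⟩

theorem MemWInfty.sum {n : ℕ} {ι : Type*} (s : Finset ι) {f : ι → E N → ℝ}
    (hf : ∀ i, MemWInfty n (f i)) : MemWInfty n fun x => ∑ i ∈ s, f i x := by
  classical
  induction s using Finset.induction_on with
  | empty => simpa using memWInfty_zero n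
  | insert i s hi ih => simpa only [Finset.sum_insert hi] using (hf i).add ih

theorem MemWInfty.congr {n : ℕ} {f g : E N → ℝ} (hf : MemWInfty n f) (h : f =ᵐ[volume] g) :
    MemWInfty n g := by
  cases n with
  | zero => exact (memLp_congr_ae h).1 hf
  | succ n =>
    refine ⟨(memLp_congr_ae h).1 hf.1, fun k => ?_⟩
    obtain ⟨f', hf', h1⟩ := hf.2 k
    exact ⟨f', hf'.congr h .rfl, h1⟩

theorem MemWInfty.hasWeakPartial {n : ℕ} {f : E N → ℝ} (hf : MemWInfty (n + 1) f) (k : Fin N) :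
    HasWeakPartial k f (weakPartial k f) := by
  obtain ⟨f', hf', -⟩ := hf.2 k
  exact hf'.hasWeakPartial_weakPartial

theorem MemWInfty.weakPartial {n : ℕ} {f : E N → ℝ} (hf : MemWInfty (n + 1) f) (k : Fin N) :
    MemWInfty n (weakPartial k f) := by
  obtain ⟨f', hf', h⟩ := hf.2 k
  exact h.congr hf'.weakPartial_ae_eq.symm

theorem GradMemWInfty.hasWeakPartial {n : ℕ} {φ : E N → ℝ} (hφ : GradMemWInfty n φ) (k : Fin N) :
    HasWeakPartial k φ (weakPartial k φ) := by
  obtain ⟨f', hf', -⟩ := hφ.2 k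
  exact hf'.hasWeakPartial_weakPartial

theorem GradMemWInfty.weakPartial {n : ℕ} {φ : E N → ℝ} (hφ : GradMemWInfty n φ) (k : Fin N) :
    MemWInfty n (weakPartial k φ) := by
  obtain ⟨f', hf', h⟩ := hφ.2 k
  exact h.congr hf'.weakPartial_ae_eq.symm

theorem GradMemWInfty.weakLaplacian {n : ℕ} {φ : E N → ℝ} (hφ : GradMemWInfty (n + 1) φ) :
    MemWInfty n (weakLaplacian φ) :=
  MemWInfty.sum Finset.univ fun k => (hφ.weakPartial k).weakPartial k

/-- Weak derivatives commute. -/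
theorem GradMemWInfty.weakPartial_comm {n : ℕ} {φ : E N → ℝ} (hφ : GradMemWInfty (n + 1) φ)
    (k l : Fin N) : FracNLS.weakPartial k (FracNLS.weakPartial l φ) =ᵐ[volume]
      FracNLS.weakPartial l (FracNLS.weakPartial k φ) := by
  -- Both derivatives are moved onto the test function, where the symmetry of the classical second
  -- derivative applies.
  have key : ∀ k l : Fin N, ∀ ψ : E N → ℝ, IsTest ψ →
      ∫ x, ψ x • FracNLS.weakPartial k (FracNLS.weakPartial l φ) x =
        ∫ x, fderiv ℝ (fun y => fderiv ℝ ψ y (e k)) x (e l) • φ x := by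
    intro k l ψ hψ
    rw [(hφ.hasWeakPartial l).2.2 _ (hψ.fderiv_apply (e k)),
      ((hφ.weakPartial l).hasWeakPartial k).2.2 ψ hψ, neg_neg]
  refine ae_eq_of_integral_contDiff_smul_eq ((hφ.weakPartial l).hasWeakPartial k).2.1
    ((hφ.weakPartial k).hasWeakPartial l).2.1 fun ψ h1 h2 => ?_
  rw [key k l ψ ⟨h1, h2⟩, key l k ψ ⟨h1, h2⟩]
  refine integral_congr_ae (Eventually.of_forall fun x => ?_)
  have hd : DifferentiableAt ℝ (fderiv ℝ ψ) x :=
    (h1.fderiv_right (m := 1) (WithTop.coe_le_coe.2 le_top)).differentiable one_ne_zero x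
  have hs : ∀ v w : E N, fderiv ℝ (fun y => fderiv ℝ ψ y v) x w = fderiv ℝ (fderiv ℝ ψ) x w v := by
    intro v w
    rw [fderiv_clm_apply hd (differentiableAt_const v)]
    simp
  simp only [hs]
  rw [(h1.contDiffAt (x := x)).isSymmSndFDerivAt (by
    rw [minSmoothness_of_isRCLikeNormedField]; exact WithTop.coe_le_coe.2 le_top)]

/-! ### Multiplication operators and inner products on L². -/

/-- Multiplication by an essentially bounded function, as an operator on `L²`. -/
def mulL (c : E N → ℂ) (hc : MemLp c ∞ volume) : L2 N →L[ℂ] L2 N :=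
  (ContinuousLinearMap.mul ℂ ℂ).holderL volume ∞ 2 2 (hc.toLp c)

theorem coeFn_mulL (c : E N → ℂ) (hc : MemLp c ∞ volume) (f : L2 N) :
    mulL c hc f =ᵐ[volume] fun x => c x * f x := by
  filter_upwards [(ContinuousLinearMap.mul ℂ ℂ).coeFn_holder (r := 2) (hc.toLp c) f,
    hc.coeFn_toLp] with x h1 h2
  rw [mulL, ContinuousLinearMap.holderL_apply_apply, h1, h2]
  rfl

/-- Multiplication by an essentially bounded real function, as an operator on `L²`. -/
abbrev mulR (c : E N → ℝ) (hc : MemLp c ∞ volume) : L2 N →L[ℂ] L2 N :=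
  mulL (fun x => (c x : ℂ)) hc.ofReal

theorem coeFn_mulR (c : E N → ℝ) (hc : MemLp c ∞ volume) (f : L2 N) :
    mulR c hc f =ᵐ[volume] fun x => (c x : ℂ) * f x := coeFn_mulL _ hc.ofReal f

theorem integrable_conj_mul (f g : L2 N) :
    Integrable fun x => (starRingEnd ℂ) (f x) * g x := by
  have := L2.integrable_inner (𝕜 := ℂ) f g
  simpa only [RCLike.inner_apply'] using this

theorem inner_eq_integral (f g : L2 N) :
    inner ℂ f g = ∫ x, (starRingEnd ℂ) (f x) * g x := by
  rw [L2.inner_def]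
  simp only [RCLike.inner_apply']

theorem inner_mulR_right (c : E N → ℝ) (hc : MemLp c ∞ volume) (f g : L2 N) :
    inner ℂ f (mulR c hc g) = ∫ x, (c x : ℂ) * ((starRingEnd ℂ) (f x) * g x) := by
  rw [inner_eq_integral]
  refine integral_congr_ae ?_
  filter_upwards [coeFn_mulR c hc g] with x hx
  rw [hx]; ring

theorem integrable_mul_conj_mul (c : E N → ℝ) (hc : MemLp c ∞ volume) (f g : L2 N) :
    Integrable fun x => (c x : ℂ) * ((starRingEnd ℂ) (f x) * g x) :=
  (integrable_conj_mul f g).mul_of_top_right hc.ofReal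

theorem inner_mulR_left (c : E N → ℝ) (hc : MemLp c ∞ volume) (f g : L2 N) :
    inner ℂ (mulR c hc f) g = inner ℂ f (mulR c hc g) := by
  rw [inner_mulR_right, inner_eq_integral]
  refine integral_congr_ae ?_
  filter_upwards [coeFn_mulR c hc f] with x hx
  rw [hx, map_mul, Complex.conj_ofReal]; ring

theorem norm_sq_eq_integral (f : L2 N) : ‖f‖ ^ 2 = ∫ x, ‖f x‖ ^ 2 := by
  have h := inner_self_eq_norm_sq (𝕜 := ℂ) f
  rw [← h, inner_eq_integral, ← RCLike.reCLM_apply,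
    ← ContinuousLinearMap.integral_comp_comm _ (integrable_conj_mul f f)]
  refine integral_congr_ae (Eventually.of_forall fun x => ?_)
  simp only [← Complex.normSq_eq_conj_mul_self, Complex.normSq_eq_norm_sq]
  exact Complex.ofReal_re _

/-- Dominated convergence in `L²`. -/
theorem tendsto_L2_of_dominated {f : ℕ → L2 N} {f' : L2 N} {g : E N → ℝ}
    (hg : MemLp g 2 volume) (hb : ∀ n, ∀ᵐ x, ‖f n x‖ ≤ g x)
    (h : ∀ᵐ x, Tendsto (fun n => f n x) atTop (𝓝 (f' x))) : Tendsto f atTop (𝓝 f') := by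
  rw [tendsto_iff_norm_sub_tendsto_zero]
  have hb' : ∀ᵐ x, ‖f' x‖ ≤ g x := by
    filter_upwards [h, ae_all_iff.2 hb] with x hx hbx
    exact le_of_tendsto hx.norm (Eventually.of_forall hbx)
  have h2 : Tendsto (fun n => ‖f n - f'‖ ^ 2) atTop (𝓝 0) := by
    simp only [norm_sq_eq_integral]
    rw [← integral_zero (E N) ℝ (μ := volume)]
    refine tendsto_integral_of_dominated_convergence (fun x => (2 * g x) ^ 2) ?_ ?_ ?_ ?_
    · exact fun n => ((Lp.aestronglyMeasurable _).norm.pow 2)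
    · exact (hg.const_mul 2).integrable_sq
    · intro n
      filter_upwards [hb n, hb', Lp.coeFn_sub (f n) f'] with x h1 h2 h3
      rw [h3, Pi.sub_apply, norm_pow, norm_norm]
      gcongr
      exact (norm_sub_le _ _).trans (by linarith)
    · filter_upwards [h, ae_all_iff.2 fun n => Lp.coeFn_sub (f n) f'] with x h1 h2
      simp only [h2, Pi.sub_apply]
      have := (h1.sub_const (f' x)).norm.pow 2
      simpa using this
  have h3 := h2.sqrt
  simpa using h3

/-! ### Superposition operators (f, g) ↦ Φ(f) g on L². -/

open scoped BoundedContinuousFunction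

theorem nem_aux (Φ : ℂ →ᵇ (ℂ →L[ℝ] ℂ)) (f g : L2 N) :
    MemLp (fun x => Φ (f x) (g x)) 2 volume := by
  refine (Lp.memLp g).of_le_mul (c := ‖Φ‖) ?_ (Eventually.of_forall fun x => ?_)
  · have h1 := Φ.continuous.comp_aestronglyMeasurable (Lp.aestronglyMeasurable f)
    exact (ContinuousLinearMap.apply ℝ ℂ).flip.aestronglyMeasurable_comp₂ h1
      (Lp.aestronglyMeasurable g)
  · exact (Φ (f x)).le_of_opNorm_le (Φ.norm_coe_le_norm _) _

/-- The map `(f, g) ↦ Φ(f) g` on `L² × L²`, for a bounded continuous operator-valued function. -/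
def nem (Φ : ℂ →ᵇ (ℂ →L[ℝ] ℂ)) (f g : L2 N) : L2 N := (nem_aux Φ f g).toLp _

theorem coeFn_nem (Φ : ℂ →ᵇ (ℂ →L[ℝ] ℂ)) (f g : L2 N) :
    nem Φ f g =ᵐ[volume] fun x => Φ (f x) (g x) := (nem_aux Φ f g).coeFn_toLp

theorem norm_nem_le (Φ : ℂ →ᵇ (ℂ →L[ℝ] ℂ)) (f g : L2 N) : ‖nem Φ f g‖ ≤ ‖Φ‖ * ‖g‖ := by
  refine Lp.norm_le_mul_norm_of_ae_le_mul ?_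
  filter_upwards [coeFn_nem Φ f g] with x hx
  rw [hx]
  exact (Φ (f x)).le_of_opNorm_le (Φ.norm_coe_le_norm _) _

theorem nem_sub (Φ : ℂ →ᵇ (ℂ →L[ℝ] ℂ)) (f g g' : L2 N) :
    nem Φ f (g - g') = nem Φ f g - nem Φ f g' := by
  apply Lp.ext
  filter_upwards [coeFn_nem Φ f (g - g'), coeFn_nem Φ f g, coeFn_nem Φ f g', Lp.coeFn_sub g g',
    Lp.coeFn_sub (nem Φ f g) (nem Φ f g')] with x h1 h2 h3 h4 h5
  rw [h1, h5, h4, Pi.sub_apply, Pi.sub_apply, h2, h3, map_sub]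

/-- L² convergence gives a.e. convergence along a subsequence. With g fixed, boundedness of Φ allows
dominated convergence; the change in g costs at most ‖Φ‖ times its norm. Since every subsequence has
such a further one, the full sequence converges. -/
theorem continuous_nem (Φ : ℂ →ᵇ (ℂ →L[ℝ] ℂ)) :
    Continuous fun p : L2 N × L2 N => nem Φ p.1 p.2 := by
  refine continuous_iff_seqContinuous.2 fun p q hpq => ?_
  refine tendsto_of_subseq_tendsto fun ns hns => ?_
  have hp1 := ((continuous_fst.tendsto q).comp hpq).comp hns
  have hp2 := ((continuous_snd.tendsto q).comp hpq).comp hns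
  obtain ⟨ms, hms, hae⟩ := (tendstoInMeasure_of_tendsto_Lp hp1).exists_seq_tendsto_ae
  refine ⟨ms, ?_⟩
  have h1 : Tendsto (fun n => nem Φ (p (ns (ms n))).1 q.2) atTop (𝓝 (nem Φ q.1 q.2)) := by
    refine tendsto_L2_of_dominated (g := fun x => ‖Φ‖ * ‖q.2 x‖) ((Lp.memLp q.2).norm.const_mul _)
      ?_ ?_
    · intro n
      filter_upwards [coeFn_nem Φ (p (ns (ms n))).1 q.2] with x hx
      rw [hx]
      exact (Φ _).le_of_opNorm_le (Φ.norm_coe_le_norm _) _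
    · filter_upwards [hae, coeFn_nem Φ q.1 q.2,
        ae_all_iff.2 fun n => coeFn_nem Φ (p (ns (ms n))).1 q.2] with x h1 h2 h3
      simp only [h2, h3]
      exact ((ContinuousLinearMap.apply ℝ ℂ (q.2 x)).continuous.tendsto _).comp
        ((Φ.continuous.tendsto _).comp h1)
  have h2 : Tendsto (fun n => nem Φ (p (ns (ms n))).1 ((p (ns (ms n))).2 - q.2)) atTop (𝓝 0) := by
    refine squeeze_zero_norm (fun n => norm_nem_le _ _ _) ?_
    have := ((hp2.comp hms.tendsto_atTop).sub_const q.2).norm.const_mul ‖Φ‖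
    simpa using this
  have h3 := h2.add h1
  simpa [nem_sub] using h3

/-! ### H¹ as the closed graph of the gradient; identities pass from C¹ functions to the closure. -/

/-- Classical `C¹` functions in `L²` with gradient in `L²`, together with their gradients. -/
def classicalH1 (N : ℕ) : Set (L2 N × (Fin N → L2 N)) :=
  {p | ∃ ψ : E N → ℂ, ContDiff ℝ 1 ψ ∧ p.1 =ᵐ[volume] ψ ∧
    ∀ k, p.2 k =ᵐ[volume] fun x => fderiv ℝ ψ x (e k)}

/-- The graph of the gradient on the Sobolev space `H¹`. -/
def gradGraph (N : ℕ) : Set (L2 N × (Fin N → L2 N)) := closure (classicalH1 N)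

theorem continuous_inner_mulR {X : Type*} [TopologicalSpace X] (c : E N → ℝ)
    (hc : MemLp c ∞ volume) {f g : X → L2 N} (hf : Continuous f) (hg : Continuous g) :
    Continuous fun p => inner ℂ (f p) (mulR c hc (g p)) :=
  hf.inner ((mulR c hc).continuous.comp hg)

/-- The product conj(ψ) χ is C¹, and it and its derivative are integrable as sums of products of L²
functions, so the W^{1,1} integration by parts applies to it. -/
theorem inner_mulR_classical {k : Fin N} {c c' : E N → ℝ} (h : HasWeakPartial k c c')
    (hc : MemLp c ∞ volume) (hc' : MemLp c' ∞ volume) {f f' g g' : L2 N} {ψ χ : E N → ℂ}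
    (hψ : ContDiff ℝ 1 ψ) (hχ : ContDiff ℝ 1 χ) (hf : f =ᵐ[volume] ψ)
    (hf' : f' =ᵐ[volume] fun x => fderiv ℝ ψ x (e k)) (hg : g =ᵐ[volume] χ)
    (hg' : g' =ᵐ[volume] fun x => fderiv ℝ χ x (e k)) :
    inner ℂ f (mulR c hc g') + inner ℂ f' (mulR c hc g) = - inner ℂ f (mulR c' hc' g) := by
  rw [inner_mulR_right, inner_mulR_right, inner_mulR_right]
  rw [← integral_add (integrable_mul_conj_mul c hc _ _) (integrable_mul_conj_mul c hc _ _)]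
  have hconj : ContDiff ℝ 1 fun x => (starRingEnd ℂ) (ψ x) :=
    (Complex.conjCLE.contDiff (n := 1)).comp hψ
  have hd : ∀ x, fderiv ℝ (fun x => (starRingEnd ℂ) (ψ x) * χ x) x (e k) =
      (starRingEnd ℂ) (ψ x) * fderiv ℝ χ x (e k) + (starRingEnd ℂ) (fderiv ℝ ψ x (e k)) * χ x := by
    intro x
    have h1 : HasFDerivAt (fun x => (starRingEnd ℂ) (ψ x))
        ((Complex.conjCLE : ℂ →L[ℝ] ℂ).comp (fderiv ℝ ψ x)) x :=
      (Complex.conjCLE : ℂ →L[ℝ] ℂ).hasFDerivAt.comp x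
        (hψ.differentiable one_ne_zero x).hasFDerivAt
    rw [(h1.fun_mul (hχ.differentiable one_ne_zero x).hasFDerivAt).fderiv]
    simp
    ring
  have hI : Integrable fun x => (starRingEnd ℂ) (ψ x) * χ x := by
    refine (integrable_conj_mul f g).congr ?_
    filter_upwards [hf, hg] with x h1 h2
    rw [h1, h2]
  have hI' : Integrable fun x => fderiv ℝ (fun x => (starRingEnd ℂ) (ψ x) * χ x) x (e k) := by
    simp only [hd]
    refine ((integrable_conj_mul f (g')).add (integrable_conj_mul (f') g)).congr ?_
    filter_upwards [hf, hg, hf', hg'] with x h1 h2 h3 h4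
    rw [Pi.add_apply, h1, h2, h3, h4]
  have key := h.integral_mul_fderiv hc hc' (hconj.mul hχ) hI hI'
  simp only [hd] at key
  convert key using 1
  · refine integral_congr_ae ?_
    filter_upwards [hf, hg, hf', hg'] with x h1 h2 h3 h4
    rw [h1, h2, h3, h4]
    ring
  · congr 1
    refine integral_congr_ae ?_
    filter_upwards [hf, hg] with x h1 h2
    rw [h1, h2]

/-- Integration by parts in `H¹` against a bounded function with bounded weak derivative. -/
theorem inner_mulR_grad {k : Fin N} {c c' : E N → ℝ} (h : HasWeakPartial k c c')
    (hc : MemLp c ∞ volume) (hc' : MemLp c' ∞ volume) {p q : L2 N × (Fin N → L2 N)}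
    (hp : p ∈ gradGraph N) (hq : q ∈ gradGraph N) :
    inner ℂ p.1 (mulR c hc (q.2 k)) + inner ℂ (p.2 k) (mulR c hc q.1) =
      - inner ℂ p.1 (mulR c' hc' q.1) := by
  -- Both sides are jointly continuous in the pair, so it is enough to treat two classical
  -- functions.
  have hpq : (p, q) ∈ closure (classicalH1 N ×ˢ classicalH1 N) := by
    rw [closure_prod_eq]; exact ⟨hp, hq⟩
  let L : (L2 N × (Fin N → L2 N)) × (L2 N × (Fin N → L2 N)) → ℂ := fun r =>
    inner ℂ r.1.1 (mulR c hc (r.2.2 k)) + inner ℂ (r.1.2 k) (mulR c hc r.2.1)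
  let R : (L2 N × (Fin N → L2 N)) × (L2 N × (Fin N → L2 N)) → ℂ := fun r =>
    - inner ℂ r.1.1 (mulR c' hc' r.2.1)
  have hL : Continuous L := (continuous_inner_mulR c hc (by fun_prop) (by fun_prop)).add
    (continuous_inner_mulR c hc (by fun_prop) (by fun_prop))
  have hR : Continuous R := (continuous_inner_mulR c' hc' (by fun_prop) (by fun_prop)).neg
  have hsub : classicalH1 N ×ˢ classicalH1 N ⊆ {r | L r = R r} := by
    rintro ⟨⟨f, f'⟩, ⟨g, g'⟩⟩ ⟨⟨ψ, hψ, hf, hf'⟩, ⟨χ, hχ, hg, hg'⟩⟩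
    exact inner_mulR_classical h hc hc' hψ hχ hf (hf' k) hg (hg' k)
  have := closure_minimal hsub (isClosed_eq hL hR) hpq
  exact this

theorem IsTest.memLp {ψ : E N → ℝ} (h : IsTest ψ) (p : ℝ≥0∞) : MemLp ψ p volume :=
  h.continuous.memLp_of_hasCompactSupport h.2

theorem IsTest.memLp_ofReal {ψ : E N → ℝ} (h : IsTest ψ) (p : ℝ≥0∞) :
    MemLp (fun x => (ψ x : ℂ)) p volume := (h.memLp p).ofReal

/-- A test function as an element of `L²`. -/
def testL2 (ψ : E N → ℝ) (h : IsTest ψ) : L2 N := (h.memLp_ofReal 2).toLp (fun x => (ψ x : ℂ))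

theorem inner_testL2 {ψ : E N → ℝ} (h : IsTest ψ) (f : L2 N) :
    inner ℂ (testL2 ψ h) f = ∫ x, ψ x • f x := by
  rw [inner_eq_integral]
  refine integral_congr_ae ?_
  filter_upwards [(h.memLp_ofReal 2).coeFn_toLp] with x hx
  rw [testL2, hx]
  simp

theorem locallyIntegrable_L2 (f : L2 N) : LocallyIntegrable f :=
  (Lp.memLp f).locallyIntegrable one_le_two

/-- For a fixed test function the defining identity is a closed condition on the pair, and for
classical pairs it is ordinary integration by parts. -/
theorem hasWeakPartial_of_mem_gradGraph {p : L2 N × (Fin N → L2 N)} (hp : p ∈ gradGraph N)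
    (k : Fin N) : HasWeakPartial k p.1 (p.2 k) := by
  refine ⟨locallyIntegrable_L2 _, locallyIntegrable_L2 _, fun ψ hψ => ?_⟩
  have hcl : IsClosed {r : L2 N × (Fin N → L2 N) |
      inner ℂ (testL2 _ (hψ.fderiv_apply (e k))) r.1 = - inner ℂ (testL2 _ hψ) (r.2 k)} :=
    isClosed_eq (by fun_prop) (by fun_prop)
  have := (closure_minimal (s := classicalH1 N) ?_ hcl) hp
  · simpa only [mem_ofPred_eq, inner_testL2] using this
  rintro ⟨f, f'⟩ ⟨χ, hχ, hf, hf'⟩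
  simp only [mem_ofPred_eq, inner_testL2]
  dsimp only at hf hf'
  have h1 : ∀ v : E N → ℝ, ∀ g : L2 N, ∀ g' : E N → ℂ, g =ᵐ[volume] g' →
      (fun x => v x • g x) =ᵐ[volume] fun x => v x • g' x :=
    fun v g g' h => h.mono fun x hx => by simp only [hx]
  rw [integral_congr_ae (h1 _ _ _ hf), integral_congr_ae (h1 _ _ _ (hf' k)), ← neg_eq_iff_eq_neg,
    eq_comm]
  have hc := hχ.continuous
  have hc' : Continuous fun x => fderiv ℝ χ x (e k) :=
    (hχ.continuous_fderiv one_ne_zero).clm_apply continuous_const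
  have hB := integral_bilinear_fderiv_right_eq_neg_left_of_integrable (μ := (volume : Measure (E N)))
    (B := ContinuousLinearMap.lsmul ℝ ℝ) (f := ψ) (g := χ) (v := e k)
    ((hψ.fderiv_apply (e k)).integrable_smul hc.locallyIntegrable)
    (hψ.integrable_smul hc'.locallyIntegrable) (hψ.integrable_smul hc.locallyIntegrable)
    (fun x _ => hψ.1.differentiable (by simp) x) (fun x _ => hχ.differentiable one_ne_zero x)
  simpa using hB

theorem weakPartial_ae_eq_of_mem_gradGraph {p : L2 N × (Fin N → L2 N)} (hp : p ∈ gradGraph N)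
    (k : Fin N) : weakPartial k p.1 =ᵐ[volume] p.2 k :=
  (hasWeakPartial_of_mem_gradGraph hp k).weakPartial_ae_eq

/-- The chain rule in `H¹`. -/
theorem nem_mem_gradGraph {Φ Ψ : ℂ →ᵇ (ℂ →L[ℝ] ℂ)}
    (h : ∀ z, HasFDerivAt (fun z => Φ z z) (Ψ z) z) {p : L2 N × (Fin N → L2 N)}
    (hp : p ∈ gradGraph N) : (nem Φ p.1 p.1, fun k => nem Ψ p.1 (p.2 k)) ∈ gradGraph N := by
  -- By `continuous_nem` the chain-rule map is continuous on pairs, so only its action on C¹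
  -- functions has to be checked.
  refine map_mem_closure (f := fun p : L2 N × (Fin N → L2 N) =>
    (nem Φ p.1 p.1, fun k => nem Ψ p.1 (p.2 k))) ?_ hp ?_
  · refine Continuous.prodMk ((continuous_nem Φ).comp (continuous_fst.prodMk continuous_fst))
      (continuous_pi fun k => (continuous_nem Ψ).comp (continuous_fst.prodMk (by fun_prop)))
  · rintro ⟨f, f'⟩ ⟨χ, hχ, hf, hf'⟩
    have hT : ContDiff ℝ 1 fun z => Φ z z := by
      rw [contDiff_one_iff_hasFDerivAt]
      exact ⟨Ψ, Ψ.continuous, h⟩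
    refine ⟨fun x => Φ (χ x) (χ x), hT.comp hχ, ?_, fun k => ?_⟩
    · filter_upwards [coeFn_nem Φ f f, hf] with x h1 h2
      simp only [h1, h2]
    · filter_upwards [coeFn_nem Ψ f (f' k), hf, hf' k] with x h1 h2 h3
      have := (h (χ x)).comp x (hχ.differentiable one_ne_zero x).hasFDerivAt
      rw [HasFDerivAt.fderiv (f := fun x => Φ (χ x) (χ x)) this]
      simp only [h1, h2, h3]
      rfl

/-! ### The antisymmetric operator 2∇φ·∇ + Δφ and its commutator with the Laplacian. -/

/-- The operator `2 ∇φ·∇ + Δφ`, on pairs consisting of a function and its gradient. -/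
def gen {φ : E N → ℝ} (hφ : GradMemWInfty 3 φ) (p : L2 N × (Fin N → L2 N)) : L2 N :=
  (2 : ℂ) • ∑ k, mulR (weakPartial k φ) (hφ.weakPartial k).memLp (p.2 k)
    + mulR (weakLaplacian φ) hφ.weakLaplacian.memLp p.1

theorem continuous_gen {φ : E N → ℝ} (hφ : GradMemWInfty 3 φ) : Continuous (gen hφ) := by
  unfold gen; fun_prop

theorem coeFn_sum_L2 {ι : Type*} [Fintype ι] (f : ι → L2 N) :
    (∑ i, f i : L2 N) =ᵐ[volume] fun x => ∑ i, f i x := by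
  filter_upwards [Lp.coeFn_finsetSum Finset.univ f] with x hx
  rw [hx, Finset.sum_apply]

theorem weakLaplacian_mul_eq_sum {φ : E N → ℝ} (hφ : GradMemWInfty 3 φ) (f : L2 N) :
    mulR (weakLaplacian φ) hφ.weakLaplacian.memLp f =
      ∑ k, mulR (weakPartial k (weakPartial k φ)) ((hφ.weakPartial k).weakPartial k).memLp f := by
  apply Lp.ext
  have h : ∀ᵐ x, ∀ k, mulR (weakPartial k (weakPartial k φ))
      ((hφ.weakPartial k).weakPartial k).memLp f x =
        ((weakPartial k (weakPartial k φ) x : ℝ) : ℂ) * f x :=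
    ae_all_iff.2 fun k => coeFn_mulR _ _ f
  filter_upwards [coeFn_mulR (weakLaplacian φ) hφ.weakLaplacian.memLp f, h, coeFn_sum_L2
    fun k => mulR (weakPartial k (weakPartial k φ))
      ((hφ.weakPartial k).weakPartial k).memLp f] with x h1 h2 h3
  rw [h1, h3]
  simp only [h2, weakLaplacian]
  push_cast
  rw [Finset.sum_mul]

/-- The operator `2 ∇φ·∇ + Δφ` is antisymmetric on `H¹`. -/
theorem inner_gen {φ : E N → ℝ} (hφ : GradMemWInfty 3 φ) {p q : L2 N × (Fin N → L2 N)}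
    (hp : p ∈ gradGraph N) (hq : q ∈ gradGraph N) :
    inner ℂ p.1 (gen hφ q) = - inner ℂ (gen hφ p) q.1 := by
  have key : ∀ k, inner ℂ p.1 (mulR (weakPartial k φ) (hφ.weakPartial k).memLp (q.2 k)) +
      inner ℂ (p.2 k) (mulR (weakPartial k φ) (hφ.weakPartial k).memLp q.1) =
      - inner ℂ p.1 (mulR (weakPartial k (weakPartial k φ))
        ((hφ.weakPartial k).weakPartial k).memLp q.1) := fun k =>
    inner_mulR_grad ((hφ.weakPartial k).hasWeakPartial k) _ _ hp hq
  rw [gen, gen, inner_add_left, inner_add_right, inner_smul_left, inner_smul_right, inner_sum,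
    sum_inner, inner_mulR_left, weakLaplacian_mul_eq_sum hφ, inner_sum]
  have := Finset.sum_congr (rfl : (Finset.univ : Finset (Fin N)) = Finset.univ) fun k _ => key k
  rw [Finset.sum_add_distrib, Finset.sum_neg_distrib] at this
  simp only [inner_mulR_left, map_ofNat]
  -- Integrating the first-order parts by parts produces -2Δφ, which cancels the zeroth-order Δφ
  -- contributed by each of the two sides.
  linear_combination 2 * this

/-- An antisymmetric form is purely imaginary on the diagonal. This is what removes the term
quadratic in -Δv in `re_inner_resolvent`. -/
theorem inner_gen_self_re {φ : E N → ℝ} (hφ : GradMemWInfty 3 φ) {p : L2 N × (Fin N → L2 N)}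
    (hp : p ∈ gradGraph N) : (inner ℂ p.1 (gen hφ p)).re = 0 := by
  have h := congrArg Complex.re (inner_gen hφ hp hp)
  rw [← inner_conj_symm (gen hφ p) p.1] at h
  simp only [Complex.neg_re, Complex.conj_re] at h
  linarith

theorem virialDensity_ae_eq {φ : E N → ℝ} {p : L2 N × (Fin N → L2 N)} (hp : p ∈ gradGraph N) :
    virialDensity φ p.1 =ᵐ[volume] fun x => ∑ k, ((weakPartial k φ x : ℝ) : ℂ) *
      ((starRingEnd ℂ) (p.1 x) * p.2 k x) := by
  filter_upwards [ae_all_iff.2 fun k => weakPartial_ae_eq_of_mem_gradGraph hp k] with x hx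
  rw [virialDensity, Finset.mul_sum]
  refine Finset.sum_congr rfl fun k _ => ?_
  rw [hx k]; ring

theorem integrable_virialDensity {φ : E N → ℝ} (hφ : GradMemWInfty 3 φ)
    {p : L2 N × (Fin N → L2 N)} (hp : p ∈ gradGraph N) : Integrable (virialDensity φ p.1) :=
  (integrable_finsetSum _ fun k _ => integrable_mul_conj_mul (weakPartial k φ)
    (hφ.weakPartial k).memLp p.1 (p.2 k)).congr (virialDensity_ae_eq hp).symm

/-- Multiplication by the real function Δφ is symmetric, so adding it to 2∇φ·∇ leaves the imaginary
part unchanged and makes the operator antisymmetric. -/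
theorem virial_eq {φ : E N → ℝ} (hφ : GradMemWInfty 3 φ) {p : L2 N × (Fin N → L2 N)}
    (hp : p ∈ gradGraph N) : virial φ p.1 = (inner ℂ p.1 (gen hφ p)).im := by
  rw [virial, integral_congr_ae (virialDensity_ae_eq hp), integral_finsetSum _ fun k _ =>
    integrable_mul_conj_mul (weakPartial k φ) (hφ.weakPartial k).memLp p.1 (p.2 k)]
  simp only [← inner_mulR_right (weakPartial _ φ) (hφ.weakPartial _).memLp]
  rw [← inner_sum, gen, inner_add_right, inner_smul_right]
  have h := congrArg Complex.im (inner_mulR_left (weakLaplacian φ) hφ.weakLaplacian.memLp p.1 p.1)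
  rw [← inner_conj_symm, Complex.conj_im] at h
  rw [Complex.add_im, show (inner ℂ p.1 (mulR (weakLaplacian φ) hφ.weakLaplacian.memLp p.1)).im = 0
    by linarith]
  simp

/-- The quadratic form `∫ 4 ∂_k f̄ (∂²_{kl} φ) ∂_l f - (Δ²φ) |f|²`. -/
def dispersiveForm {φ : E N → ℝ} (hφ : GradMemWInfty 3 φ) (p : L2 N × (Fin N → L2 N)) : ℂ :=
  4 * ∑ k, ∑ l, inner ℂ (p.2 k) (mulR (weakPartial k (weakPartial l φ))
      ((hφ.weakPartial l).weakPartial k).memLp (p.2 l))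
    - inner ℂ p.1 (∑ k, mulR (weakPartial k (weakPartial k (weakLaplacian φ)))
      ((hφ.weakLaplacian.weakPartial k).weakPartial k).memLp p.1)

theorem dispersiveDensity_ae_eq {φ : E N → ℝ} {p : L2 N × (Fin N → L2 N)}
    (hp : p ∈ gradGraph N) : dispersiveDensity φ p.1 =ᵐ[volume] fun x =>
      4 * (∑ k, ∑ l, ((weakPartial k (weakPartial l φ) x : ℝ) : ℂ) *
        ((starRingEnd ℂ) (p.2 k x) * p.2 l x)) -
      ∑ k, ((weakPartial k (weakPartial k (weakLaplacian φ)) x : ℝ) : ℂ) *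
        ((starRingEnd ℂ) (p.1 x) * p.1 x) := by
  filter_upwards [ae_all_iff.2 fun k => weakPartial_ae_eq_of_mem_gradGraph hp k] with x hx
  rw [dispersiveDensity]
  simp only [hx]
  congr 2
  · refine Finset.sum_congr rfl fun k _ => Finset.sum_congr rfl fun l _ => ?_
    ring
  · rw [← Finset.sum_mul, weakLaplacian]
    push_cast
    rw [Complex.conj_mul']

theorem integrable_dispersiveDensity_aux {φ : E N → ℝ} (hφ : GradMemWInfty 3 φ)
    (p : L2 N × (Fin N → L2 N)) : Integrable (fun x =>
      4 * (∑ k, ∑ l, ((weakPartial k (weakPartial l φ) x : ℝ) : ℂ) *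
        ((starRingEnd ℂ) (p.2 k x) * p.2 l x))) ∧ Integrable (fun x =>
      ∑ k, ((weakPartial k (weakPartial k (weakLaplacian φ)) x : ℝ) : ℂ) *
        ((starRingEnd ℂ) (p.1 x) * p.1 x)) :=
  ⟨(integrable_finsetSum _ fun k _ => integrable_finsetSum _ fun l _ =>
    integrable_mul_conj_mul _ ((hφ.weakPartial l).weakPartial k).memLp _ _).const_mul _,
  integrable_finsetSum _ fun k _ =>
    integrable_mul_conj_mul _ ((hφ.weakLaplacian.weakPartial k).weakPartial k).memLp _ _⟩

theorem integrable_dispersiveDensity {φ : E N → ℝ} (hφ : GradMemWInfty 3 φ)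
    {p : L2 N × (Fin N → L2 N)} (hp : p ∈ gradGraph N) : Integrable (dispersiveDensity φ p.1) :=
  ((integrable_dispersiveDensity_aux hφ p).1.sub (integrable_dispersiveDensity_aux hφ p).2).congr
    (dispersiveDensity_ae_eq hp).symm

theorem integral_dispersiveDensity {φ : E N → ℝ} (hφ : GradMemWInfty 3 φ)
    {p : L2 N × (Fin N → L2 N)} (hp : p ∈ gradGraph N) :
    ∫ x, dispersiveDensity φ p.1 x = dispersiveForm hφ p := by
  rw [integral_congr_ae (dispersiveDensity_ae_eq hp),
    integral_sub (integrable_dispersiveDensity_aux hφ p).1 (integrable_dispersiveDensity_aux hφ p).2,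
    integral_const_mul, dispersiveForm, inner_sum]
  congr 2
  · rw [integral_finsetSum _ fun k _ => integrable_finsetSum _ fun l _ =>
      integrable_mul_conj_mul _ ((hφ.weakPartial l).weakPartial k).memLp _ _]
    refine Finset.sum_congr rfl fun k _ => ?_
    rw [integral_finsetSum _ fun l _ =>
      integrable_mul_conj_mul _ ((hφ.weakPartial l).weakPartial k).memLp _ _]
    exact Finset.sum_congr rfl fun l _ => (inner_mulR_right _ _ _ _).symm
  · rw [integral_finsetSum _ fun k _ =>
      integrable_mul_conj_mul _ ((hφ.weakLaplacian.weakPartial k).weakPartial k).memLp _ _]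
    exact Finset.sum_congr rfl fun l _ => (inner_mulR_right _ _ _ _).symm

theorem mulR_congr {c c' : E N → ℝ} (hc : MemLp c ∞ volume) (hc' : MemLp c' ∞ volume)
    (h : c =ᵐ[volume] c') (f : L2 N) : mulR c hc f = mulR c' hc' f := by
  apply Lp.ext
  filter_upwards [coeFn_mulR c hc f, coeFn_mulR c' hc' f, h] with x h1 h2 h3
  rw [h1, h2, h3]

theorem inner_mulR_conj (c : E N → ℝ) (hc : MemLp c ∞ volume) (f g : L2 N) :
    (starRingEnd ℂ) (inner ℂ f (mulR c hc g)) = inner ℂ g (mulR c hc f) := by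
  rw [inner_conj_symm, inner_mulR_left]

theorem inner_mulR_self_im (c : E N → ℝ) (hc : MemLp c ∞ volume) (f : L2 N) :
    (inner ℂ f (mulR c hc f)).im = 0 := by
  have := congrArg Complex.im (inner_mulR_conj c hc f f)
  rw [Complex.conj_im] at this
  linarith

/-- The Hessian of φ is real and symmetric, so conjugation only exchanges k and l. Real parts
therefore determine the complex-valued integrals of the dispersive density. -/
theorem dispersiveForm_im {φ : E N → ℝ} (hφ : GradMemWInfty 3 φ) (p : L2 N × (Fin N → L2 N)) :
    (dispersiveForm hφ p).im = 0 := by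
  have h : (∑ k, ∑ l, inner ℂ (p.2 k) (mulR (weakPartial k (weakPartial l φ))
      ((hφ.weakPartial l).weakPartial k).memLp (p.2 l))).im = 0 := by
    rw [← Complex.conj_eq_iff_im, map_sum, Finset.sum_comm]
    simp only [map_sum]
    refine Finset.sum_congr rfl fun k _ => Finset.sum_congr rfl fun l _ => ?_
    rw [inner_mulR_conj, mulR_congr _ _ (hφ.weakPartial_comm l k)]
  have h' : (inner ℂ p.1 (∑ k, mulR (weakPartial k (weakPartial k (weakLaplacian φ)))
      ((hφ.weakLaplacian.weakPartial k).weakPartial k).memLp p.1)).im = 0 := by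
    rw [inner_sum, Complex.im_sum]
    exact Finset.sum_eq_zero fun k _ => inner_mulR_self_im _ _ _
  rw [dispersiveForm, Complex.sub_im, h', Complex.mul_im, h]
  simp

/-- The commutator identity: `2 Re ⟨-Δf, (2∇φ·∇ + Δφ) f⟩` is the dispersive form of `f ∈ H²`. -/
theorem two_mul_re_inner_gen {φ : E N → ℝ} (hφ : GradMemWInfty 3 φ) {f : L2 N} {D : Fin N → L2 N}
    {H : Fin N → Fin N → L2 N} (hf : (f, D) ∈ gradGraph N) (hD : ∀ k, (D k, H k) ∈ gradGraph N)
    (hH : ∀ k l, H k l = H l k) :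
    2 * (inner ℂ (-∑ k, H k k) (gen hφ (f, D))).re = (dispersiveForm hφ (f, D)).re := by
  have ha := fun l => (hφ.weakPartial l).memLp
  have hda := fun k l => ((hφ.weakPartial l).weakPartial k).memLp
  have hb := hφ.weakLaplacian.memLp
  have hb' := fun k => (hφ.weakLaplacian.weakPartial k).memLp
  have hb'' := fun k => ((hφ.weakLaplacian.weakPartial k).weakPartial k).memLp
  -- One derivative is taken off ∂ₖ∂ₖf, against the coefficient ∂ₗφ.
  have h1 : ∀ k l, (inner ℂ (D k) (mulR (weakPartial l φ) (ha l) (H l k))).re +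
      (inner ℂ (H k k) (mulR (weakPartial l φ) (ha l) (D l))).re =
      - (inner ℂ (D k) (mulR (weakPartial k (weakPartial l φ)) (hda k l) (D l))).re := fun k l =>
    congrArg Complex.re (inner_mulR_grad ((hφ.weakPartial l).hasWeakPartial k) (ha l) (hda k l)
      (hD k) (hD l))
  -- Symmetry of the Hessian of f makes this the pairing of ∂ₗφ with the l-derivative of |∂ₖf|².
  have h2 : ∀ k l, 2 * (inner ℂ (D k) (mulR (weakPartial l φ) (ha l) (H l k))).re =
      - (inner ℂ (D k) (mulR (weakPartial l (weakPartial l φ)) (hda l l) (D k))).re := by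
    intro k l
    have := congrArg Complex.re (inner_mulR_grad ((hφ.weakPartial l).hasWeakPartial l) (ha l)
      (hda l l) (hD k) (hD k))
    simp only [Complex.add_re, Complex.neg_re] at this
    rw [← inner_mulR_conj _ _ (D k) (H k l), Complex.conj_re, hH k l] at this
    linarith
  have h3 : ∀ k, (inner ℂ (D k) (mulR _ hb (D k))).re + (inner ℂ (H k k) (mulR _ hb f)).re =
      - (inner ℂ (D k) (mulR _ (hb' k) f)).re := fun k =>
    congrArg Complex.re (inner_mulR_grad (hφ.weakLaplacian.hasWeakPartial k) hb (hb' k) (hD k) hf)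
  -- Here 2 Re(conj(∂ₖf) f) is the k-derivative of |f|²; moving that derivative completes Δ²φ.
  have h4 : ∀ k, 2 * (inner ℂ (D k) (mulR _ (hb' k) f)).re =
      - (inner ℂ f (mulR _ (hb'' k) f)).re := by
    intro k
    have := congrArg Complex.re (inner_mulR_grad
      ((hφ.weakLaplacian.weakPartial k).hasWeakPartial k) (hb' k) (hb'' k) hf hf)
    simp only [Complex.add_re, Complex.neg_re] at this
    rw [← inner_mulR_conj _ _ (D k) f, Complex.conj_re] at this
    linarith
  have h5 : ∀ k, (inner ℂ (D k) (mulR _ hb (D k))).re =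
      ∑ l, (inner ℂ (D k) (mulR (weakPartial l (weakPartial l φ)) (hda l l) (D k))).re := by
    intro k
    rw [weakLaplacian_mul_eq_sum hφ, inner_sum, Complex.re_sum]
  rw [dispersiveForm, gen, inner_neg_left, sum_inner]
  simp only [inner_add_right, inner_smul_right, inner_sum, Complex.neg_re, Complex.re_sum,
    Complex.add_re, Complex.sub_re, Complex.mul_re, Complex.re_ofNat, Complex.im_ofNat, zero_mul,
    sub_zero]
  have e1 : ∀ k l, (inner ℂ (H k k) (mulR (weakPartial l φ) (ha l) (D l))).re =
      - (inner ℂ (D k) (mulR (weakPartial k (weakPartial l φ)) (hda k l) (D l))).re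
      + (inner ℂ (D k) (mulR (weakPartial l (weakPartial l φ)) (hda l l) (D k))).re / 2 := by
    intro k l
    linarith [h1 k l, h2 k l]
  have e2 : ∀ k, (inner ℂ (H k k) (mulR _ hb f)).re = (inner ℂ f (mulR _ (hb'' k) f)).re / 2 -
      ∑ l, (inner ℂ (D k) (mulR (weakPartial l (weakPartial l φ)) (hda l l) (D k))).re := by
    intro k
    linarith [h3 k, h4 k, h5 k]
  -- The first-order part of the operator and its Δφ part contribute Δφ |∇f|² with opposite signs,
  -- so only the Hessian and bi-Laplacian terms survive.
  simp only [e1, e2]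
  simp only [Finset.sum_add_distrib, Finset.sum_sub_distrib, Finset.sum_neg_distrib,
    ← Finset.sum_div, ← Finset.mul_sum]
  ring

/-! ### The constant in Balakrishnan's formula. -/

/-- The substitution x = t/(1+t) turns the integral of t^{s-1}/(1+t) into the Beta integral B(s,
1-s) = Γ(s)Γ(1-s), evaluated by the reflection formula. -/
theorem integral_rpowIntegrand_one {s : ℝ} (hs : s ∈ Ioo (0 : ℝ) 1) :
    ∫ t in Ioi 0, Real.rpowIntegrand₀₁ s t 1 = Real.pi / Real.sin (Real.pi * s) := by
  have h1 := ProbabilityTheory.beta_eq_betaIntegralReal s (1 - s) hs.1 (by linarith [hs.2])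
  rw [ProbabilityTheory.beta, add_sub_cancel, Real.Gamma_one, div_one,
    Real.Gamma_mul_Gamma_one_sub] at h1
  have h2 : (fun t : ℝ => t / (1 + t)) '' Ioi 0 = Ioo 0 1 := by
    ext x
    simp only [mem_image, mem_Ioi, mem_Ioo]
    constructor
    · rintro ⟨t, ht, rfl⟩
      exact ⟨by positivity, by rw [div_lt_one (by positivity)]; linarith⟩
    · rintro ⟨h0, h1⟩
      have : 1 - x ≠ 0 := by linarith
      refine ⟨x / (1 - x), div_pos h0 (by linarith), ?_⟩
      field_simp
      ring
  have h3 := integral_image_eq_integral_abs_deriv_smul (s := Ioi (0 : ℝ))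
    (f := fun t : ℝ => t / (1 + t)) (f' := fun t => 1 / (1 + t) ^ 2) measurableSet_Ioi
    (fun t ht => by
      have ht' : 1 + t ≠ 0 := by have := mem_Ioi.1 ht; positivity
      have := ((hasDerivAt_id t).div ((hasDerivAt_id t).const_add 1) ht').hasDerivWithinAt
        (s := Ioi 0)
      refine this.congr_deriv ?_
      simp)
    (fun a ha b hb hab => by
      have ha' : 1 + a ≠ 0 := by have := mem_Ioi.1 ha; positivity
      have hb' : 1 + b ≠ 0 := by have := mem_Ioi.1 hb; positivity
      field_simp at hab
      linarith)
    (fun x => x ^ (s - 1) * (1 - x) ^ ((1 - s) - 1))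
  rw [h2] at h3
  have h4 : ∫ t in Ioi 0, Real.rpowIntegrand₀₁ s t 1 =
      ∫ x in Ioo (0 : ℝ) 1, x ^ (s - 1) * (1 - x) ^ ((1 - s) - 1) := by
    rw [h3]
    refine setIntegral_congr_fun measurableSet_Ioi fun t ht => ?_
    have ht0 : 0 < t := ht
    have ht1 : 0 < 1 + t := by positivity
    rw [Real.rpowIntegrand₀₁_eq_pow_div hs ht0.le zero_le_one]
    have e1 : 1 - t / (1 + t) = (1 + t)⁻¹ := by field_simp; ring
    rw [e1, Real.div_rpow ht0.le ht1.le, Real.inv_rpow ht1.le, abs_of_pos (by positivity),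
      ← Real.rpow_neg ht1.le, div_eq_mul_inv (t ^ (s - 1)) ((1 + t) ^ (s - 1)), ← Real.rpow_neg ht1.le, smul_eq_mul, mul_assoc
      (t ^ (s - 1)), ← Real.rpow_add ht1]
    rw [show -(s - 1) + -(1 - s - 1) = (1 : ℝ) by ring, Real.rpow_one]
    field_simp
    ring
  rw [h4, h1, Complex.betaIntegral, intervalIntegral.integral_of_le zero_le_one,
    integral_Ioc_eq_integral_Ioo, ← Complex.ofReal_re (∫ x in Ioo (0 : ℝ) 1, _),
    ← integral_complex_ofReal]
  congr 1
  refine setIntegral_congr_fun measurableSet_Ioo fun x hx => ?_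
  have hx1 : 0 ≤ 1 - x := by linarith [hx.2]
  push_cast
  rw [Complex.ofReal_cpow hx.1.le, Complex.ofReal_cpow hx1]
  push_cast
  rfl

/-! ### Fourier multipliers, Bessel potentials and the Fourier description of H¹. -/

/-- The Fourier multiplier with a bounded symbol. -/
def op (b : E N → ℂ) (hb : MemLp b ∞ volume) : L2 N →L[ℂ] L2 N :=
  ((Lp.fourierTransformₗᵢ (E N) ℂ).symm.toContinuousLinearEquiv : L2 N →L[ℂ] L2 N) ∘L
    mulL b hb ∘L ((Lp.fourierTransformₗᵢ (E N) ℂ).toContinuousLinearEquiv : L2 N →L[ℂ] L2 N)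

theorem op_eq (b : E N → ℂ) (hb : MemLp b ∞ volume) (f : L2 N) :
    op b hb f = 𝓕⁻ (mulL b hb (𝓕 f)) := rfl

theorem fourier_op (b : E N → ℂ) (hb : MemLp b ∞ volume) (f : L2 N) :
    (𝓕 (op b hb f) : L2 N) = mulL b hb (𝓕 f) := by
  rw [op_eq, fourier_fourierInv_eq]

theorem fourier_op_ae (b : E N → ℂ) (hb : MemLp b ∞ volume) (f : L2 N) :
    (𝓕 (op b hb f) : L2 N) =ᵐ[volume] fun ξ => b ξ * (𝓕 f : L2 N) ξ := by
  rw [fourier_op]; exact coeFn_mulL b hb _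

theorem eq_of_fourier_ae_eq {f g : L2 N} (h : (𝓕 f : L2 N) =ᵐ[volume] (𝓕 g : L2 N)) : f = g := by
  have := congrArg (fun h : L2 N => (𝓕⁻ h : L2 N)) (Lp.ext h)
  simpa only [fourierInv_fourier_eq] using this

/-- The symbol of `∂_k`. -/
def gradSymbol (k : Fin N) (ξ : E N) : ℂ := 2 * Real.pi * Complex.I * (ξ k : ℝ)

theorem memLp_top_of_continuous {b : E N → ℂ} (hb : Continuous b) (C : ℝ) (h : ∀ ξ, ‖b ξ‖ ≤ C) :
    MemLp b ∞ volume :=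
  memLp_top_of_bound hb.aestronglyMeasurable C (Eventually.of_forall h)

theorem norm_gradSymbol_le (k : Fin N) (ξ : E N) : ‖gradSymbol k ξ‖ ≤ 2 * Real.pi * ‖ξ‖ := by
  rw [gradSymbol]
  simp only [norm_mul, Complex.norm_I, Complex.norm_real, Complex.norm_ofNat, mul_one,
    Real.norm_of_nonneg Real.pi_pos.le]
  gcongr
  exact PiLp.norm_apply_le ξ k

theorem continuous_gradSymbol (k : Fin N) : Continuous (gradSymbol (N := N) k) := by
  unfold gradSymbol; fun_prop

/-- The symbol of the Bessel potential of order `-r`. -/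
def besselSymbol (N : ℕ) (r : ℝ) (ξ : E N) : ℂ := (((1 + ‖ξ‖ ^ 2) ^ (-r / 2) : ℝ) : ℂ)

theorem hasTemperateGrowth_besselSymbol (r : ℝ) : (besselSymbol N r).HasTemperateGrowth := by
  unfold besselSymbol; fun_prop

theorem continuous_besselSymbol (r : ℝ) : Continuous (besselSymbol N r) :=
  (hasTemperateGrowth_besselSymbol r).1.continuous

theorem norm_besselSymbol (r : ℝ) (ξ : E N) :
    ‖besselSymbol N r ξ‖ = (1 + ‖ξ‖ ^ 2) ^ (-r / 2) := by
  rw [besselSymbol, Complex.norm_real, Real.norm_of_nonneg (by positivity)]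

/-- From ‖ξ‖^q ≤ (1 + ‖ξ‖²)^{q/2}. The cases q = 0, 1 and 2s bound the symbols of the Bessel
potential, of its gradient, and of the fractional Laplacian composed with it. -/
theorem rpow_norm_mul_bessel_le {q r : ℝ} (hq : 0 ≤ q) (hqr : q ≤ r) (ξ : E N) :
    ‖ξ‖ ^ q * (1 + ‖ξ‖ ^ 2) ^ (-r / 2) ≤ 1 := by
  have h1 : ‖ξ‖ ^ q ≤ (1 + ‖ξ‖ ^ 2) ^ (q / 2) := by
    have : ‖ξ‖ ^ q = (‖ξ‖ ^ 2) ^ (q / 2) := by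
      rw [← Real.rpow_natCast, ← Real.rpow_mul (norm_nonneg _)]; congr 1; push_cast; ring
    rw [this]
    gcongr
    linarith
  calc _ ≤ (1 + ‖ξ‖ ^ 2) ^ (q / 2) * (1 + ‖ξ‖ ^ 2) ^ (-r / 2) := by gcongr
    _ = (1 + ‖ξ‖ ^ 2) ^ (q / 2 + -r / 2) := by rw [Real.rpow_add (by positivity)]
    _ ≤ 1 := Real.rpow_le_one_of_one_le_of_nonpos (by nlinarith [norm_nonneg ξ]) (by linarith)

theorem besselSymbol_mul (r q : ℝ) (ξ : E N) :
    besselSymbol N r ξ * besselSymbol N q ξ = besselSymbol N (r + q) ξ := by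
  rw [besselSymbol, besselSymbol, besselSymbol, ← Complex.ofReal_mul,
    ← Real.rpow_add (by positivity)]
  congr 3; ring

theorem besselSymbol_zero (ξ : E N) : besselSymbol N 0 ξ = 1 := by
  simp [besselSymbol]

theorem memLp_besselSymbol {r : ℝ} (hr : 0 ≤ r) : MemLp (besselSymbol N r) ∞ volume := by
  refine memLp_top_of_continuous (continuous_besselSymbol r) 1 fun ξ => ?_
  rw [norm_besselSymbol]
  simpa using rpow_norm_mul_bessel_le le_rfl hr ξ

theorem memLp_gradSymbol_mul_besselSymbol (k : Fin N) {r : ℝ} (hr : 1 ≤ r) :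
    MemLp (fun ξ => gradSymbol k ξ * besselSymbol N r ξ) ∞ volume := by
  refine memLp_top_of_continuous ((continuous_gradSymbol k).mul (continuous_besselSymbol r))
    (2 * Real.pi) fun ξ => ?_
  rw [norm_mul, norm_besselSymbol]
  have := rpow_norm_mul_bessel_le zero_le_one hr ξ
  rw [Real.rpow_one] at this
  calc _ ≤ (2 * Real.pi * ‖ξ‖) * (1 + ‖ξ‖ ^ 2) ^ (-r / 2) := by
        gcongr; exact norm_gradSymbol_le k ξ
    _ = 2 * Real.pi * (‖ξ‖ * (1 + ‖ξ‖ ^ 2) ^ (-r / 2)) := by ring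
    _ ≤ 2 * Real.pi * 1 := by gcongr
    _ = _ := mul_one _

theorem schwartz_mem_gradGraph (f : 𝓢(E N, ℂ)) :
    (f.toLp 2 volume, fun k => (LineDeriv.lineDerivOp (e k) f : 𝓢(E N, ℂ)).toLp 2 volume) ∈ gradGraph N := by
  refine subset_closure ⟨f, f.smooth 1, f.coeFn_toLp 2 volume, fun k => ?_⟩
  filter_upwards [(LineDeriv.lineDerivOp (e k) f : 𝓢(E N, ℂ)).coeFn_toLp 2 volume] with x hx
  rw [hx, SchwartzMap.lineDerivOp_apply_eq_fderiv]

/-- Both multipliers are bounded, so the condition on v is closed and Schwartz functions suffice by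
density. For those the potential is again Schwartz, hence classical. -/
theorem bessel_mem_gradGraph (v : L2 N) :
    (op _ (memLp_besselSymbol (N := N) zero_le_one) v,
      fun k => op _ (memLp_gradSymbol_mul_besselSymbol (N := N) k le_rfl) v) ∈ gradGraph N := by
  have hcl : IsClosed {v : L2 N | (op _ (memLp_besselSymbol (N := N) zero_le_one) v,
      fun k => op _ (memLp_gradSymbol_mul_besselSymbol (N := N) k le_rfl) v) ∈ gradGraph N} :=
    IsClosed.preimage (by fun_prop) isClosed_closure
  have hd := SchwartzMap.denseRange_toLpCLM (E := E N) (F := ℂ) (p := 2)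
    (μ := volume) ENNReal.ofNat_ne_top
  refine hd.induction_on v hcl fun g => ?_
  set f : 𝓢(E N, ℂ) := 𝓕⁻ (SchwartzMap.smulLeftCLM ℂ (besselSymbol N 1) (𝓕 g)) with hf
  convert schwartz_mem_gradGraph f using 2
  · refine eq_of_fourier_ae_eq ?_
    rw [SchwartzMap.toLpCLM_apply, SchwartzMap.toLp_fourier_eq]
    filter_upwards [fourier_op_ae _ (memLp_besselSymbol (N := N) zero_le_one) (g.toLp 2 volume),
      (𝓕 f).coeFn_toLp 2 volume, (𝓕 g).coeFn_toLp 2 volume] with ξ h1 h2 h3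
    rw [h1, h2, SchwartzMap.toLp_fourier_eq, h3, hf, fourier_fourierInv_eq,
      SchwartzMap.smulLeftCLM_apply_apply (hasTemperateGrowth_besselSymbol 1), smul_eq_mul]
  · ext1 k
    refine eq_of_fourier_ae_eq ?_
    rw [SchwartzMap.toLpCLM_apply, SchwartzMap.toLp_fourier_eq]
    have hk : (inner ℝ · (e k) : E N → ℝ).HasTemperateGrowth := by fun_prop
    filter_upwards [fourier_op_ae _ (memLp_gradSymbol_mul_besselSymbol (N := N) k le_rfl) (g.toLp 2 volume),
      (𝓕 (LineDeriv.lineDerivOp (e k) f : 𝓢(E N, ℂ))).coeFn_toLp 2 volume, (𝓕 g).coeFn_toLp 2 volume]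
      with ξ h1 h2 h3
    rw [h1, h2, SchwartzMap.toLp_fourier_eq, h3, SchwartzMap.fourier_lineDerivOp_eq, hf,
      fourier_fourierInv_eq, _root_.smul_apply, SchwartzMap.smulLeftCLM_apply_apply hk,
      SchwartzMap.smulLeftCLM_apply_apply (hasTemperateGrowth_besselSymbol 1), gradSymbol]
    simp [EuclideanSpace.inner_single_right]
    ring

/-- `D` is the gradient of `f` on the Fourier side. -/
def IsFourierGrad (f : L2 N) (D : Fin N → L2 N) : Prop :=
  ∀ k, (𝓕 (D k) : L2 N) =ᵐ[volume] fun ξ => gradSymbol k ξ * (𝓕 f : L2 N) ξ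

/-- Since (1 + ‖ξ‖²)^{1/2} is at most 1 + ∑ |2πξₖ|, its product with the transform of f is dominated
by |𝓕f| + ∑ₖ |𝓕Dₖ|. Thus f is a Bessel potential of order -1 of an L² function. -/
theorem IsFourierGrad.mem_gradGraph {f : L2 N} {D : Fin N → L2 N} (h : IsFourierGrad f D) :
    (f, D) ∈ gradGraph N := by
  have hm : MemLp (fun ξ => besselSymbol N (-1) ξ * (𝓕 f : L2 N) ξ) 2 volume := by
    have hg : MemLp (fun ξ => ‖(𝓕 f : L2 N) ξ‖ + ∑ k, ‖(𝓕 (D k) : L2 N) ξ‖) 2 volume :=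
      (Lp.memLp _).norm.add (memLp_finsetSum _ fun k _ => (Lp.memLp _).norm)
    refine hg.of_le ((continuous_besselSymbol _).aestronglyMeasurable.mul
      (Lp.aestronglyMeasurable _)) ?_
    filter_upwards [ae_all_iff.2 h] with ξ hξ
    rw [norm_mul, norm_besselSymbol, Real.norm_of_nonneg (by positivity)]
    simp only [hξ, norm_mul]
    rw [← Finset.sum_mul, ← one_add_mul]
    gcongr
    have h1 : ‖ξ‖ ≤ ∑ k, ‖gradSymbol k ξ‖ := by
      calc ‖ξ‖ ≤ ∑ k, ‖ξ k‖ := by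
            rw [EuclideanSpace.norm_eq]
            refine (Real.sqrt_le_sqrt (Finset.sum_sq_le_sq_sum_of_nonneg fun i _ =>
              norm_nonneg _)).trans ?_
            rw [Real.sqrt_sq (by positivity)]
        _ ≤ _ := by
            refine Finset.sum_le_sum fun k _ => ?_
            rw [gradSymbol]
            simp only [norm_mul, Complex.norm_I, Complex.norm_real, Complex.norm_ofNat, mul_one,
              Real.norm_of_nonneg Real.pi_pos.le]
            nlinarith [norm_nonneg (ξ k), Real.pi_gt_three]
    rw [neg_neg, ← Real.sqrt_eq_rpow]
    refine Real.sqrt_le_iff.2 ⟨by positivity, ?_⟩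
    nlinarith [norm_nonneg ξ]
  convert bessel_mem_gradGraph (𝓕⁻ (hm.toLp _) : L2 N) using 2
  · refine eq_of_fourier_ae_eq ?_
    filter_upwards [fourier_op_ae _ (memLp_besselSymbol (N := N) zero_le_one)
      (𝓕⁻ (hm.toLp _) : L2 N), hm.coeFn_toLp] with ξ h1 h2
    rw [h1, fourier_fourierInv_eq, h2, ← mul_assoc, besselSymbol_mul, add_neg_cancel,
      besselSymbol_zero, one_mul]
  · ext1 k
    refine eq_of_fourier_ae_eq ?_
    filter_upwards [fourier_op_ae _ (memLp_gradSymbol_mul_besselSymbol (N := N) k le_rfl)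
      (𝓕⁻ (hm.toLp _) : L2 N), hm.coeFn_toLp, h k] with ξ h1 h2 h3
    rw [h1, h3, fourier_fourierInv_eq, h2, mul_assoc, ← mul_assoc (besselSymbol N 1 ξ),
      besselSymbol_mul, add_neg_cancel, besselSymbol_zero, one_mul]

/-- The distributional Bessel potential is inverted on the Fourier side, and L² embeds injectively
in tempered distributions. The Sobolev hypothesis thereby says that u is a bounded multiplier
applied to a continuous L² curve. -/
theorem eq_op_of_besselPotential_eq {r : ℝ} (hr : 0 ≤ r) {f v : L2 N}
    (h : TemperedDistribution.besselPotential (E N) ℂ r (f : 𝓢'(E N, ℂ)) = (v : 𝓢'(E N, ℂ))) :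
    f = op _ (memLp_besselSymbol hr) v := by
  have h1 := (TemperedDistribution.besselPotential_neg_apply_eq_iff r (v : 𝓢'(E N, ℂ)) f).2 h
  have h2 := congrArg (fun g : 𝓢'(E N, ℂ) => 𝓕 g) h1
  simp only [TemperedDistribution.fourier_besselPotential_eq_smulLeftCLM_fourier_apply] at h2
  rw [Lp.fourier_toTemperedDistribution_eq, Lp.fourier_toTemperedDistribution_eq] at h2
  have h3 := Lp.toTemperedDistribution_smul_eq (p := ∞) (q := 2) (r := 2)
    (hasTemperateGrowth_besselSymbol (N := N) r) (memLp_besselSymbol hr) (𝓕 v : L2 N)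
  have h4 : (((memLp_besselSymbol (N := N) hr).toLp _ • (𝓕 v : L2 N) : L2 N) : 𝓢'(E N, ℂ)) =
      ((𝓕 f : L2 N) : 𝓢'(E N, ℂ)) := by
    rw [h3, ← h2]; rfl
  have h5 : (memLp_besselSymbol (N := N) hr).toLp _ • (𝓕 v : L2 N) = (𝓕 f : L2 N) := by
    have hk := Lp.ker_toTemperedDistributionCLM_eq_bot (F := ℂ) (p := 2)
      (μ := (volume : Measure (E N)))
    exact LinearMap.ker_eq_bot.1 hk h4
  refine eq_of_fourier_ae_eq ?_
  rw [← h5]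
  filter_upwards [Lp.coeFn_lpSMul (r := 2) ((memLp_besselSymbol (N := N) hr).toLp _) (𝓕 v : L2 N),
    (memLp_besselSymbol (N := N) hr).coeFn_toLp, fourier_op_ae _ (memLp_besselSymbol hr) v]
    with ξ h1 h2 h3
  rw [h1, h3, Pi.smul_apply', h2, smul_eq_mul]

/-- The existence of g in L² itself places f in the maximal domain, so the default value zero of
`l2Multiplier` does not arise. -/
theorem l2Multiplier_eq {a : E N → ℝ} {f g : L2 N}
    (h : (𝓕 g : L2 N) =ᵐ[volume] fun ξ => (a ξ : ℂ) * (𝓕 f : L2 N) ξ) : l2Multiplier a f = g := by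
  have hm : MemLp (fun ξ => (a ξ : ℂ) * (𝓕 f : L2 N) ξ) 2 volume :=
    (memLp_congr_ae h).1 (Lp.memLp _)
  rw [l2Multiplier, dif_pos hm]
  refine eq_of_fourier_ae_eq ?_
  rw [fourier_fourierInv_eq]
  exact hm.coeFn_toLp.trans h.symm

/-- The symbol of `(-Δ)^s (1 - (2π)⁻²Δ)^{-s}`. -/
def fracSymbol (N : ℕ) (s : ℝ) (ξ : E N) : ℂ :=
  (((2 * Real.pi * ‖ξ‖) ^ (2 * s) : ℝ) : ℂ) * besselSymbol N (2 * s) ξ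

theorem memLp_fracSymbol {s : ℝ} (hs : 0 ≤ s) : MemLp (fracSymbol N s) ∞ volume := by
  refine memLp_top_of_continuous ?_ ((2 * Real.pi) ^ (2 * s)) fun ξ => ?_
  · refine Continuous.mul ?_ (continuous_besselSymbol _)
    exact Complex.continuous_ofReal.comp
      ((continuous_const.mul continuous_norm).rpow_const fun _ => Or.inr (by positivity))
  · rw [fracSymbol, norm_mul, norm_besselSymbol, Complex.norm_real,
      Real.norm_of_nonneg (by positivity), Real.mul_rpow (by positivity) (norm_nonneg _), mul_assoc]
    exact mul_le_of_le_one_right (by positivity) (rpow_norm_mul_bessel_le (by positivity) le_rfl ξ)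

theorem fracLaplacian_op {s : ℝ} (hs : 0 ≤ s) (v : L2 N) :
    fracLaplacian s (op _ (memLp_besselSymbol (by positivity : 0 ≤ 2 * s)) v) =
      op _ (memLp_fracSymbol hs) v := by
  refine l2Multiplier_eq ?_
  filter_upwards [fourier_op_ae _ (memLp_fracSymbol hs) v,
    fourier_op_ae _ (memLp_besselSymbol (by positivity : 0 ≤ 2 * s)) v] with ξ h1 h2
  rw [h1, h2, fracSymbol, mul_assoc]

theorem fourier_fracLaplacian_op {s : ℝ} (hs : 0 ≤ s) (v : L2 N) :
    (𝓕 (op _ (memLp_fracSymbol hs) v) : L2 N) =ᵐ[volume] fun ξ =>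
      (((2 * Real.pi * ‖ξ‖) ^ (2 * s) : ℝ) : ℂ) *
        (𝓕 (op _ (memLp_besselSymbol (by positivity : 0 ≤ 2 * s)) v) : L2 N) ξ := by
  filter_upwards [fourier_op_ae _ (memLp_fracSymbol hs) v,
    fourier_op_ae _ (memLp_besselSymbol (by positivity : 0 ≤ 2 * s)) v] with ξ h1 h2
  rw [h1, h2, fracSymbol, mul_assoc]

theorem isFourierGrad_op {b : E N → ℂ} (hb : MemLp b ∞ volume)
    (hk : ∀ k, MemLp (fun ξ => gradSymbol k ξ * b ξ) ∞ volume) (v : L2 N) :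
    IsFourierGrad (op b hb v) fun k => op _ (hk k) v := by
  intro k
  filter_upwards [fourier_op_ae _ (hk k) v, fourier_op_ae _ hb v] with ξ h1 h2
  rw [h1, h2, mul_assoc]

theorem fourier_add_ae (f g : L2 N) : (𝓕 (f + g) : L2 N) =ᵐ[volume]
    fun ξ => (𝓕 f : L2 N) ξ + (𝓕 g : L2 N) ξ := by
  rw [FourierTransform.fourier_add]; exact Lp.coeFn_add _ _

theorem fourier_smul_ae (c : ℂ) (f : L2 N) : (𝓕 (c • f) : L2 N) =ᵐ[volume]
    fun ξ => c * (𝓕 f : L2 N) ξ := by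
  rw [FourierTransform.fourier_smul]; exact Lp.coeFn_smul _ _

theorem IsFourierGrad.add {f g : L2 N} {D D' : Fin N → L2 N} (h : IsFourierGrad f D)
    (h' : IsFourierGrad g D') : IsFourierGrad (f + g) fun k => D k + D' k := by
  intro k
  filter_upwards [h k, h' k, fourier_add_ae f g, fourier_add_ae (D k) (D' k)] with ξ h1 h2 h3 h4
  rw [h4, h1, h2, h3, mul_add]

theorem IsFourierGrad.const_smul {f : L2 N} {D : Fin N → L2 N} (h : IsFourierGrad f D) (c : ℂ) :
    IsFourierGrad (c • f) fun k => c • D k := by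
  intro k
  filter_upwards [h k, fourier_smul_ae c f, fourier_smul_ae c (D k)] with ξ h1 h2 h3
  rw [h3, h1, h2, mul_left_comm]

theorem gen_add_smul {φ : E N → ℝ} (hφ : GradMemWInfty 3 φ) (p q : L2 N × (Fin N → L2 N))
    (c : ℂ) : gen hφ (p.1 + c • q.1, fun k => p.2 k + c • q.2 k) = gen hφ p + c • gen hφ q := by
  simp only [gen, map_add, map_smul, Finset.sum_add_distrib, ← Finset.smul_sum, smul_add]
  rw [smul_comm c (2 : ℂ)]
  abel

theorem dispersiveForm_smul {φ : E N → ℝ} (hφ : GradMemWInfty 3 φ) (p : L2 N × (Fin N → L2 N))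
    (c : ℝ) : dispersiveForm hφ ((c : ℂ) • p.1, fun k => (c : ℂ) • p.2 k) =
      (c : ℂ) ^ 2 * dispersiveForm hφ p := by
  simp only [dispersiveForm, map_smul, inner_smul_left, inner_smul_right, Complex.conj_ofReal,
    ← Finset.smul_sum, ← Finset.mul_sum]
  ring

/-! ### The resolvent (-Δ + m)⁻¹ and the dispersive form. -/

/-- The symbol of `(-Δ + m)⁻¹`. -/
def resolventSymbol (N : ℕ) (m : ℝ) (ξ : E N) : ℂ :=
  ((1 / ((2 * Real.pi * ‖ξ‖) ^ 2 + m) : ℝ) : ℂ)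

theorem continuous_resolventSymbol {m : ℝ} (hm : 0 < m) : Continuous (resolventSymbol N m) := by
  refine Complex.continuous_ofReal.comp (continuous_const.div (by fun_prop) fun ξ => ?_)
  positivity

theorem resolventSymbol_mul {m : ℝ} (hm : 0 < m) (ξ : E N) :
    resolventSymbol N m ξ * ((((2 * Real.pi * ‖ξ‖) ^ 2 : ℝ) : ℂ) + m) = 1 := by
  rw [resolventSymbol, ← Complex.ofReal_add, ← Complex.ofReal_mul,
    one_div_mul_cancel (by positivity), Complex.ofReal_one]

theorem norm_resolventSymbol {m : ℝ} (hm : 0 < m) (ξ : E N) :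
    ‖resolventSymbol N m ξ‖ = 1 / ((2 * Real.pi * ‖ξ‖) ^ 2 + m) := by
  rw [resolventSymbol, Complex.norm_real, Real.norm_of_nonneg (by positivity)]

theorem memLp_resolventSymbol {m : ℝ} (hm : 0 < m) : MemLp (resolventSymbol N m) ∞ volume := by
  refine memLp_top_of_continuous (continuous_resolventSymbol hm) (1 / m) fun ξ => ?_
  rw [norm_resolventSymbol hm]
  gcongr
  nlinarith [sq_nonneg (2 * Real.pi * ‖ξ‖)]

theorem memLp_grad_resolventSymbol {m : ℝ} (hm : 0 < m) (k : Fin N) :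
    MemLp (fun ξ => gradSymbol k ξ * resolventSymbol N m ξ) ∞ volume := by
  -- With y = 2π‖ξ‖, the constant works because (1 + 1/m)(y² + m) ≥ y² + 1 ≥ y.
  refine memLp_top_of_continuous ((continuous_gradSymbol k).mul (continuous_resolventSymbol hm))
    (1 + 1 / m) fun ξ => ?_
  rw [norm_mul, norm_resolventSymbol hm]
  have := norm_gradSymbol_le k ξ
  set y := 2 * Real.pi * ‖ξ‖
  rw [mul_one_div, div_le_iff₀ (by positivity)]
  have : (1 + 1 / m) * (y ^ 2 + m) = y ^ 2 + m + y ^ 2 / m + 1 := by field_simp; ring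
  rw [this]
  have : 0 ≤ y ^ 2 / m := by positivity
  nlinarith [sq_nonneg (y - 1)]

theorem memLp_hess_resolventSymbol {m : ℝ} (hm : 0 < m) (k l : Fin N) :
    MemLp (fun ξ => gradSymbol l ξ * (gradSymbol k ξ * resolventSymbol N m ξ)) ∞ volume := by
  refine memLp_top_of_continuous ((continuous_gradSymbol l).mul ((continuous_gradSymbol k).mul
    (continuous_resolventSymbol hm))) 1 fun ξ => ?_
  rw [norm_mul, norm_mul, norm_resolventSymbol hm]
  have h1 := norm_gradSymbol_le k ξ
  have h2 := norm_gradSymbol_le l ξ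
  set y := 2 * Real.pi * ‖ξ‖
  rw [mul_one_div, mul_div_assoc', div_le_one (by positivity)]
  have := mul_le_mul h2 h1 (norm_nonneg _) (by positivity)
  nlinarith

theorem sum_gradSymbol_sq (ξ : E N) :
    -∑ k, gradSymbol k ξ * gradSymbol k ξ = (((2 * Real.pi * ‖ξ‖) ^ 2 : ℝ) : ℂ) := by
  rw [mul_pow, EuclideanSpace.norm_sq_eq]
  push_cast
  rw [← Finset.sum_neg_distrib, Finset.mul_sum]
  refine Finset.sum_congr rfl fun k _ => ?_
  rw [gradSymbol, ← Complex.ofReal_pow ‖ξ k‖, Real.norm_eq_abs, sq_abs]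
  push_cast
  linear_combination (-(2 * Real.pi * (ξ k : ℂ)) ^ 2) * Complex.I_mul_I

theorem aux_eq (s : ℝ) {m : ℝ} (hm : 0 < m) (f : L2 N) :
    aux s m f = (cs s : ℂ) • op _ (memLp_resolventSymbol hm) f := by
  rw [aux]
  congr 1
  exact l2Multiplier_eq (fourier_op_ae _ (memLp_resolventSymbol hm) f)

/-- `Re ⟨-Δ(-Δ + m)⁻¹ f, (2∇φ·∇ + Δφ) f⟩` in terms of the dispersive form of `(-Δ + m)⁻¹ f`. -/
theorem re_inner_resolvent {φ : E N → ℝ} (hφ : GradMemWInfty 3 φ) {m : ℝ} (hm : 0 < m) {f : L2 N}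
    {D : Fin N → L2 N} (hf : IsFourierGrad f D) :
    2 * (inner ℂ (f - (m : ℂ) • op _ (memLp_resolventSymbol hm) f) (gen hφ (f, D))).re =
      m * (dispersiveForm hφ (op _ (memLp_resolventSymbol hm) f,
        fun k => op _ (memLp_grad_resolventSymbol hm k) f)).re := by
  set v := op _ (memLp_resolventSymbol hm) f with hv
  set V : Fin N → L2 N := fun k => op _ (memLp_grad_resolventSymbol hm k) f with hV
  have hvV : IsFourierGrad v V := isFourierGrad_op _ _ _
  set H : Fin N → Fin N → L2 N := fun k l => op _ (memLp_hess_resolventSymbol hm k l) f with hH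
  have hVH : ∀ k, IsFourierGrad (V k) (H k) := fun k => isFourierGrad_op _ _ _
  have hsymm : ∀ k l, H k l = H l k := by
    intro k l
    refine eq_of_fourier_ae_eq ?_
    filter_upwards [fourier_op_ae _ (memLp_hess_resolventSymbol hm k l) f,
      fourier_op_ae _ (memLp_hess_resolventSymbol hm l k) f] with ξ h1 h2
    simp only [hH]
    rw [h1, h2]; ring
  set w := f - (m : ℂ) • v with hw
  have hw' : w = f + (-m : ℂ) • v := by rw [hw, neg_smul, sub_eq_add_neg]
  have hwW : IsFourierGrad w fun k => D k + (-m : ℂ) • V k := by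
    rw [hw']; exact hf.add (hvV.const_smul _)
  -- This says f - m v = -Δv, so -Δv has an L² gradient although v is only handled through two
  -- derivatives.
  have hwH : w = - ∑ k, H k k := by
    have : ∑ k, H k k = (m : ℂ) • v - f := by
      refine eq_of_fourier_ae_eq ?_
      have hsum : (𝓕 (∑ k, H k k) : L2 N) = ∑ k, (𝓕 (H k k) : L2 N) :=
        map_sum (Lp.fourierTransformₗᵢ (E N) ℂ) _ _
      have hv' : (m : ℂ) • v - f = (m : ℂ) • v + (-1 : ℂ) • f := by
        rw [neg_one_smul, sub_eq_add_neg]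
      rw [hsum, hv']
      filter_upwards [coeFn_sum_L2 fun k => (𝓕 (H k k) : L2 N), fourier_add_ae ((m : ℂ) • v)
        ((-1 : ℂ) • f), fourier_smul_ae (m : ℂ) v, fourier_smul_ae (-1 : ℂ) f,
        fourier_op_ae _ (memLp_resolventSymbol hm) f,
        ae_all_iff.2 fun k => fourier_op_ae _ (memLp_hess_resolventSymbol hm k k) f]
        with ξ h1 h2 h3 h4 h5 h6
      rw [h1, h2, h3, h4, h5]
      simp only [hH, h6]
      simp only [← mul_assoc, ← Finset.sum_mul]
      rw [← neg_neg (∑ k, gradSymbol k ξ * gradSymbol k ξ), sum_gradSymbol_sq]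
      linear_combination (-(𝓕 f : L2 N) ξ) * resolventSymbol_mul hm ξ
    rw [this, hw]; abel
  -- Splitting f = w + m v: the pairing of w with its own image has zero real part, and the pairing
  -- with the image of v is the commutator identity.
  have hgen : gen hφ (f, D) = gen hφ (w, fun k => D k + (-m : ℂ) • V k) + (m : ℂ) • gen hφ (v, V) := by
    rw [← gen_add_smul]
    simp [hw]
  rw [hgen, inner_add_right, inner_smul_right, Complex.add_re, inner_gen_self_re hφ hwW.mem_gradGraph,
    zero_add, ← two_mul_re_inner_gen hφ hvV.mem_gradGraph (fun k => (hVH k).mem_gradGraph) hsymm,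
    ← hwH]
  simp
  ring

/-! ### Balakrishnan's formula on the Fourier side. -/

/-- The kernel of the Fubini argument behind the Balakrishnan formula. -/
def balakrishnanKernel (s : ℝ) (f y : L2 N) (p : E N × ℝ) : ℂ :=
  ((Real.rpowIntegrand₀₁ s p.2 ((2 * Real.pi * ‖p.1‖) ^ 2) : ℝ) : ℂ) *
    ((starRingEnd ℂ) ((𝓕 f : L2 N) p.1) * (𝓕 y : L2 N) p.1)

theorem aestronglyMeasurable_balakrishnanKernel (s : ℝ) (f y : L2 N) :
    AEStronglyMeasurable (balakrishnanKernel s f y)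
      ((volume : Measure (E N)).prod (volume.restrict (Ioi (0 : ℝ)))) := by
  refine AEStronglyMeasurable.mul ?_ (integrable_conj_mul (𝓕 f : L2 N) (𝓕 y)).1.comp_fst
  refine (Measurable.complex_ofReal ?_).aestronglyMeasurable
  unfold Real.rpowIntegrand₀₁
  fun_prop

theorem sq_rpow_eq (s x : ℝ) (hx : 0 ≤ x) : (x ^ 2) ^ s = x ^ (2 * s) := by
  rw [Real.rpow_mul hx]; norm_cast

theorem integral_balakrishnanKernel_right {s : ℝ} (hs : s ∈ Ioo (0 : ℝ) 1) {f w : L2 N} (y : L2 N)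
    {ξ : E N} (hw : (𝓕 w : L2 N) ξ =
      (((2 * Real.pi * ‖ξ‖) ^ (2 * s) : ℝ) : ℂ) * (𝓕 f : L2 N) ξ) :
    ∫ m in Ioi (0 : ℝ), balakrishnanKernel s f y (ξ, m) =
      ((Real.pi / Real.sin (Real.pi * s) : ℝ) : ℂ) *
        ((starRingEnd ℂ) ((𝓕 w : L2 N) ξ) * (𝓕 y : L2 N) ξ) := by
  simp only [balakrishnanKernel]
  rw [integral_mul_const, integral_complex_ofReal,
    Real.integral_rpowIntegrand₀₁_eq_rpow_mul_const hs (by positivity),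
    integral_rpowIntegrand_one hs, hw, sq_rpow_eq _ _ (by positivity), map_mul, Complex.conj_ofReal]
  push_cast
  ring

/-- The m-factor is nonnegative, so integrating norms in m gives exactly π/sin(πs) times |𝓕w| |𝓕y|,
a product of two L² functions. -/
theorem integrable_balakrishnanKernel {s : ℝ} (hs : s ∈ Ioo (0 : ℝ) 1) {f w : L2 N} (y : L2 N)
    (hw : (𝓕 w : L2 N) =ᵐ[volume] fun ξ =>
      (((2 * Real.pi * ‖ξ‖) ^ (2 * s) : ℝ) : ℂ) * (𝓕 f : L2 N) ξ) :
    Integrable (balakrishnanKernel s f y)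
      ((volume : Measure (E N)).prod (volume.restrict (Ioi (0 : ℝ)))) := by
  rw [integrable_prod_iff (aestronglyMeasurable_balakrishnanKernel s f y)]
  constructor
  · refine Eventually.of_forall fun ξ => ?_
    have h := Real.integrableOn_rpowIntegrand₀₁_Ioi hs
      (by positivity : 0 ≤ (2 * Real.pi * ‖ξ‖) ^ 2)
    have h' : Integrable (fun m : ℝ =>
        ((Real.rpowIntegrand₀₁ s m ((2 * Real.pi * ‖ξ‖) ^ 2) : ℝ) : ℂ))
        (volume.restrict (Ioi 0)) := Integrable.ofReal h
    simp only [balakrishnanKernel]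
    exact h'.mul_const _
  · refine (((integrable_conj_mul (𝓕 w : L2 N) (𝓕 y)).norm).const_mul
      (Real.pi / Real.sin (Real.pi * s))).congr ?_
    filter_upwards [hw] with ξ hξ
    have h1 : ∀ m ∈ Ioi (0 : ℝ), ‖balakrishnanKernel s f y (ξ, m)‖ =
        Real.rpowIntegrand₀₁ s m ((2 * Real.pi * ‖ξ‖) ^ 2) *
        ‖(starRingEnd ℂ) ((𝓕 f : L2 N) ξ) * (𝓕 y : L2 N) ξ‖ := by
      intro m hm
      rw [balakrishnanKernel, norm_mul, Complex.norm_real, Real.norm_of_nonneg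
        (Real.rpowIntegrand₀₁_nonneg hs.1 (le_of_lt hm) (by positivity))]
    rw [setIntegral_congr_fun measurableSet_Ioi h1, integral_mul_const,
      Real.integral_rpowIntegrand₀₁_eq_rpow_mul_const hs (by positivity),
      integral_rpowIntegrand_one hs, hξ, sq_rpow_eq _ _ (by positivity), map_mul, norm_mul,
      norm_mul, norm_mul, Complex.conj_ofReal, Complex.norm_real,
      Real.norm_of_nonneg (by positivity)]
    ring

/-- The symbol of 1 - m(-Δ+m)⁻¹ is |2πξ|²/(m + |2πξ|²), which is the integrand without the factor
m^{s-1}; the rest is Plancherel. -/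
theorem integral_balakrishnanKernel_left {s : ℝ} (hs : s ∈ Ioo (0 : ℝ) 1) (f y : L2 N) {m : ℝ}
    (hm : 0 < m) : ∫ ξ, balakrishnanKernel s f y (ξ, m) =
      ((m ^ (s - 1) : ℝ) : ℂ) *
        inner ℂ (f - (m : ℂ) • op _ (memLp_resolventSymbol hm) f) y := by
  have h : (𝓕 (f - (m : ℂ) • op _ (memLp_resolventSymbol hm) f) : L2 N) =ᵐ[volume] fun ξ =>
      (((2 * Real.pi * ‖ξ‖) ^ 2 / (m + (2 * Real.pi * ‖ξ‖) ^ 2) : ℝ) : ℂ) * (𝓕 f : L2 N) ξ := by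
    have e1 : f - (m : ℂ) • op _ (memLp_resolventSymbol hm) f =
        f + (-m : ℂ) • op _ (memLp_resolventSymbol hm) f := by rw [neg_smul, sub_eq_add_neg]
    rw [e1]
    filter_upwards [fourier_add_ae f ((-m : ℂ) • op _ (memLp_resolventSymbol hm) f),
      fourier_smul_ae (-m : ℂ) (op _ (memLp_resolventSymbol hm) f),
      fourier_op_ae _ (memLp_resolventSymbol hm) f] with ξ h1 h2 h3
    rw [h1, h2, h3]
    have h4 := resolventSymbol_mul hm ξ
    have h5 : (((2 * Real.pi * ‖ξ‖) ^ 2 / (m + (2 * Real.pi * ‖ξ‖) ^ 2) : ℝ) : ℂ) =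
        (((2 * Real.pi * ‖ξ‖) ^ 2 : ℝ) : ℂ) * resolventSymbol N m ξ := by
      rw [resolventSymbol, ← Complex.ofReal_mul, mul_one_div, add_comm]
    rw [h5]
    linear_combination (-(𝓕 f : L2 N) ξ) * h4
  rw [← Lp.inner_fourier_eq, inner_eq_integral, ← integral_const_mul]
  refine integral_congr_ae ?_
  filter_upwards [h] with ξ hξ
  rw [hξ, balakrishnanKernel, Real.rpowIntegrand₀₁_eq_pow_div hs hm.le (by positivity), map_mul,
    Complex.conj_ofReal, mul_div_assoc]
  push_cast
  ring

/-- Balakrishnan's formula for the fractional Laplacian, in weak form. -/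
theorem inner_fracLaplacian {s : ℝ} (hs : s ∈ Ioo (0 : ℝ) 1) {f w : L2 N} (y : L2 N)
    (hw : (𝓕 w : L2 N) =ᵐ[volume] fun ξ =>
      (((2 * Real.pi * ‖ξ‖) ^ (2 * s) : ℝ) : ℂ) * (𝓕 f : L2 N) ξ) :
    inner ℂ w y = ((Real.sin (Real.pi * s) / Real.pi : ℝ) : ℂ) *
      ∫ m in Ioi (0 : ℝ), ∫ ξ, balakrishnanKernel s f y (ξ, m) := by
  rw [← integral_integral_swap (f := fun ξ m => balakrishnanKernel s f y (ξ, m))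
    (integrable_balakrishnanKernel hs y hw)]
  have h1 : ∫ ξ, ∫ m in Ioi (0 : ℝ), balakrishnanKernel s f y (ξ, m) =
      ∫ ξ, ((Real.pi / Real.sin (Real.pi * s) : ℝ) : ℂ) *
        ((starRingEnd ℂ) ((𝓕 w : L2 N) ξ) * (𝓕 y : L2 N) ξ) :=
    integral_congr_ae (hw.mono fun ξ hξ => integral_balakrishnanKernel_right hs y hξ)
  rw [h1, integral_const_mul, ← inner_eq_integral, Lp.inner_fourier_eq, ← mul_assoc,
    ← Complex.ofReal_mul]
  have : Real.sin (Real.pi * s) ≠ 0 := by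
    refine (Real.sin_pos_of_pos_of_lt_pi (mul_pos Real.pi_pos hs.1) ?_).ne'
    nlinarith [hs.2, Real.pi_pos]
  have h2 : Real.sin (Real.pi * s) / Real.pi * (Real.pi / Real.sin (Real.pi * s)) = 1 := by
    field_simp
  rw [h2]
  simp

theorem integrableOn_balakrishnanKernel {s : ℝ} (hs : s ∈ Ioo (0 : ℝ) 1) {f w : L2 N} (y : L2 N)
    (hw : (𝓕 w : L2 N) =ᵐ[volume] fun ξ =>
      (((2 * Real.pi * ‖ξ‖) ^ (2 * s) : ℝ) : ℂ) * (𝓕 f : L2 N) ξ) :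
    IntegrableOn (fun m => ∫ ξ, balakrishnanKernel s f y (ξ, m)) (Ioi (0 : ℝ)) :=
  (integrable_balakrishnanKernel hs y hw).integral_prod_right

theorem cs_sq {s : ℝ} (hs : s ∈ Ioo (0 : ℝ) 1) : cs s ^ 2 = Real.sin (Real.pi * s) / Real.pi := by
  rw [cs, Real.sq_sqrt]
  refine div_nonneg (Real.sin_nonneg_of_nonneg_of_le_pi (by have := hs.1; positivity) ?_)
    Real.pi_pos.le
  nlinarith [hs.2, Real.pi_pos]

theorem integrable_dispersiveDensity_aux_resolvent {φ : E N → ℝ} (hφ : GradMemWInfty 3 φ)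
    (s : ℝ) {m : ℝ} (hm : 0 < m) (f : L2 N) :
    Integrable (dispersiveDensity φ (aux s m f)) := by
  have h0 := isFourierGrad_op (memLp_resolventSymbol hm) (memLp_grad_resolventSymbol hm) f
  have h1 := (h0.const_smul (cs s : ℂ)).mem_gradGraph
  have h2 := integrable_dispersiveDensity hφ h1
  rw [aux_eq s hm]
  exact h2

/-- The density is quadratic in u_m, which supplies c_s², and m^s = m^{s-1} · m uses the factor m of
`re_inner_resolvent`. Integrability and evaluation of the m-integral are thus inherited from the
Fubini kernel. -/
theorem rpow_mul_integral_dispersiveDensity {φ : E N → ℝ} (hφ : GradMemWInfty 3 φ) {s : ℝ} {f : L2 N}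
    {D : Fin N → L2 N} (hs : s ∈ Ioo (0 : ℝ) 1) (hf : IsFourierGrad f D)
    {m : ℝ} (hm : 0 < m) :
    ((m ^ s : ℝ) : ℂ) * ∫ x, dispersiveDensity φ (aux s m f) x =
      ((2 * (cs s ^ 2 * (∫ ξ, balakrishnanKernel s f (gen hφ (f, D)) (ξ, m)).re) : ℝ) : ℂ) := by
  have h0 := isFourierGrad_op (memLp_resolventSymbol hm) (memLp_grad_resolventSymbol hm) f
  have h1 := (h0.const_smul (cs s : ℂ)).mem_gradGraph
  rw [aux_eq s hm, integral_dispersiveDensity hφ h1, dispersiveForm_smul hφ (_, _),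
    integral_balakrishnanKernel_left hs _ _ hm]
  have h2 := re_inner_resolvent hφ hm hf
  have h3 := dispersiveForm_im hφ (op _ (memLp_resolventSymbol hm) f,
        fun k => op _ (memLp_grad_resolventSymbol hm k) f)
  have h4 : m ^ s = m ^ (s - 1) * m := by
    rw [← Real.rpow_add_one hm.ne', sub_add_cancel]
  apply Complex.ext
  · rw [Complex.ofReal_re, Complex.re_ofReal_mul, Complex.re_ofReal_mul, ← Complex.ofReal_pow,
      Complex.re_ofReal_mul, h4]
    linear_combination (-m ^ (s - 1) * cs s ^ 2) * h2
  · rw [Complex.ofReal_im, Complex.im_ofReal_mul, ← Complex.ofReal_pow, Complex.im_ofReal_mul, h3]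
    simp

theorem integrableOn_rpow_mul_integral_dispersiveDensity {φ : E N → ℝ} (hφ : GradMemWInfty 3 φ)
    {s : ℝ} {f w : L2 N} {D : Fin N → L2 N} (hs : s ∈ Ioo (0 : ℝ) 1)
    (hf : IsFourierGrad f D) (hw : (𝓕 w : L2 N) =ᵐ[volume] fun ξ =>
      (((2 * Real.pi * ‖ξ‖) ^ (2 * s) : ℝ) : ℂ) * (𝓕 f : L2 N) ξ) :
    IntegrableOn (fun m : ℝ => ((m ^ s : ℝ) : ℂ) * ∫ x, dispersiveDensity φ (aux s m f) x)
      (Ioi 0) := by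
  have h := integrableOn_balakrishnanKernel hs (gen hφ (f, D)) hw
  have h1 : IntegrableOn (fun m : ℝ => 2 * (cs s ^ 2 *
      (∫ ξ, balakrishnanKernel s f (gen hφ (f, D)) (ξ, m)).re)) (Ioi 0) :=
    ((Complex.reCLM.integrable_comp h).const_mul (cs s ^ 2)).const_mul 2
  have h2 : IntegrableOn (fun m : ℝ => ((2 * (cs s ^ 2 *
      (∫ ξ, balakrishnanKernel s f (gen hφ (f, D)) (ξ, m)).re) : ℝ) : ℂ)) (Ioi 0) :=
    Integrable.ofReal h1
  exact h2.congr_fun (fun m hm => (rpow_mul_integral_dispersiveDensity hφ hs hf hm).symm)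
    measurableSet_Ioi

theorem integral_rpow_mul_integral_dispersiveDensity {φ : E N → ℝ} (hφ : GradMemWInfty 3 φ)
    {s : ℝ} {f w : L2 N} {D : Fin N → L2 N} (hs : s ∈ Ioo (0 : ℝ) 1)
    (hf : IsFourierGrad f D) (hw : (𝓕 w : L2 N) =ᵐ[volume] fun ξ =>
      (((2 * Real.pi * ‖ξ‖) ^ (2 * s) : ℝ) : ℂ) * (𝓕 f : L2 N) ξ) :
    ∫ m in Ioi (0 : ℝ), ((m ^ s : ℝ) : ℂ) * ∫ x, dispersiveDensity φ (aux s m f) x =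
      ((2 * (inner ℂ w (gen hφ (f, D))).re : ℝ) : ℂ) := by
  have h := integrableOn_balakrishnanKernel hs (gen hφ (f, D)) hw
  rw [setIntegral_congr_fun measurableSet_Ioi fun m hm =>
    rpow_mul_integral_dispersiveDensity hφ hs hf hm, integral_complex_ofReal, integral_const_mul,
    integral_const_mul, inner_fracLaplacian hs _ hw, Complex.re_ofReal_mul, cs_sq hs]
  congr 4
  exact Complex.reCLM.integral_comp_comm h

/-! ### Smooth truncation of complex values, with bounds uniform in the truncation parameter. -/

/-- A gauge-equivariant truncation `T z = cut z z` of the identity of `ℂ`, with derivative `der`;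
`pow z z = |z|^{2σ} T z`, and `pot` is a primitive of `2 Re (conj (|z|^{2σ} T z) dT)`. -/
structure Truncation (σ C : ℝ) where
  cut : ℂ →ᵇ (ℂ →L[ℝ] ℂ)
  der : ℂ →ᵇ (ℂ →L[ℝ] ℂ)
  pow : ℂ →ᵇ (ℂ →L[ℝ] ℂ)
  ratio : ℂ →ᵇ (ℂ →L[ℝ] ℂ)
  pot : ℂ → ℝ
  pot' : ℂ → ℂ →L[ℝ] ℝ
  hasFDerivAt_cut : ∀ z, HasFDerivAt (fun z => cut z z) (der z) z
  taylor : ∃ L, ∀ z d, ‖cut (z + d) (z + d) - cut z z - der z d‖ ≤ L * ‖d‖ ^ 2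
  -- Differentiated gauge invariance: it turns the image of i|z|^{2σ}z under the derivative into
  -- i|z|^{2σ}T z, which the cutoff keeps in L².
  der_I : ∀ z, der z (Complex.I * z) = Complex.I * cut z z
  pow_apply : ∀ z v, pow z v = (‖z‖ ^ (2 * σ) : ℝ) • cut z v
  hasFDerivAt_pot : ∀ z, HasFDerivAt pot (pot' z) z
  continuous_pot' : Continuous pot'
  pot'_apply : ∀ z v, pot' z v = 2 * ((starRingEnd ℂ) (pow z z) * der z v).re
  -- The quotient of `pot` by |z|² is bounded, so integrals of `pot` are L² inner products and hence
  -- continuous in the function.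
  pot_eq : ∀ z, (pot z : ℂ) = (starRingEnd ℂ) z * ratio z z
  -- The bounds from here on share the constant C, which stays fixed as the truncation is removed;
  -- bounds on `pow`, `ratio` and in `taylor` may blow up.
  norm_cut_le : ∀ z v, ‖cut z v‖ ≤ C * ‖v‖
  norm_der_le : ∀ z v, ‖der z v‖ ≤ C * ‖v‖
  abs_pot_le : ∀ z, |pot z| ≤ C * ‖z‖ ^ (2 * σ + 2)

/-- A smooth function equal to `1` on `(-∞, 1]` and to `0` on `[2, ∞)`. -/
def step (y : ℝ) : ℝ := Real.smoothTransition (2 - y)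

theorem contDiff_step : ContDiff ℝ ∞ step :=
  Real.smoothTransition.contDiff.comp (contDiff_const.sub contDiff_id)

theorem step_of_le {y : ℝ} (h : y ≤ 1) : step y = 1 :=
  Real.smoothTransition.one_of_one_le (by linarith)

theorem step_of_ge {y : ℝ} (h : 2 ≤ y) : step y = 0 :=
  Real.smoothTransition.zero_of_nonpos (by linarith)

theorem abs_step_le (y : ℝ) : |step y| ≤ 1 := by
  rw [step, abs_of_nonneg (Real.smoothTransition.nonneg _)]
  exact Real.smoothTransition.le_one _

theorem hasDerivAt_step (y : ℝ) : HasDerivAt step (deriv step y) y :=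
  (contDiff_step.differentiable (by simp) y).hasDerivAt

theorem continuous_deriv_step : Continuous (deriv step) :=
  contDiff_step.continuous_deriv (by simp)

theorem deriv_step_of_lt {y : ℝ} (h : y < 1) : deriv step y = 0 := by
  have : step =ᶠ[𝓝 y] fun _ => 1 := by
    filter_upwards [Iio_mem_nhds h] with x hx using step_of_le (le_of_lt hx)
  rw [this.deriv_eq]; simp

theorem deriv_step_of_gt {y : ℝ} (h : 2 < y) : deriv step y = 0 := by
  have : step =ᶠ[𝓝 y] fun _ => 0 := by
    filter_upwards [Ioi_mem_nhds h] with x hx using step_of_ge (le_of_lt hx)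
  rw [this.deriv_eq]; simp

/-- The derivative is supported in [1, 2]. The quantity y step'(y) is scale invariant, which makes
the bounds on the truncation independent of ε. -/
theorem exists_abs_mul_deriv_step_le : ∃ C, 0 ≤ C ∧ ∀ y, |y * deriv step y| ≤ C := by
  have hs : HasCompactSupport fun y => y * deriv step y := by
    refine HasCompactSupport.of_support_subset_isCompact (isCompact_Icc (a := 1) (b := 2)) ?_
    intro y hy
    by_contra h
    rw [mem_Icc, not_and_or, not_le, not_le] at h
    rcases h with h | h
    · exact hy (by simp [deriv_step_of_lt h])
    · exact hy (by simp [deriv_step_of_gt h])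
  obtain ⟨C, hC⟩ := (continuous_id.mul continuous_deriv_step).bounded_above_of_compact_support hs
  exact ⟨C, (norm_nonneg _).trans (hC 0), hC⟩

/-- The derivative of `y ↦ y step(y)²`. -/
def stepSq (y : ℝ) : ℝ := step y ^ 2 + 2 * step y * (y * deriv step y)

theorem continuous_stepSq : Continuous stepSq := by
  have := continuous_deriv_step
  have := contDiff_step.continuous
  unfold stepSq; fun_prop

theorem stepSq_of_lt {y : ℝ} (h : y < 1) : stepSq y = 1 := by
  simp [stepSq, step_of_le h.le, deriv_step_of_lt h]

theorem stepSq_of_ge {y : ℝ} (h : 2 ≤ y) : stepSq y = 0 := by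
  simp [stepSq, step_of_ge h]

theorem abs_stepSq_le {C : ℝ} (hC : ∀ y, |y * deriv step y| ≤ C) (y : ℝ) :
    |stepSq y| ≤ 1 + 2 * C := by
  have h1 := abs_step_le y
  have h2 : |step y ^ 2| ≤ 1 := by rw [abs_pow]; exact pow_le_one₀ (abs_nonneg _) h1
  have h3 : |2 * step y * (y * deriv step y)| ≤ 2 * C := by
    rw [abs_mul, abs_mul, abs_two]
    nlinarith [hC y, abs_nonneg (step y), abs_nonneg (y * deriv step y)]
  exact (abs_add_le _ _).trans (add_le_add h2 h3)

/-- The truncated density `x^σ stepSq(ε x)`. -/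
def potDensity (σ ε x : ℝ) : ℝ := x ^ σ * stepSq (ε * x)

theorem continuous_potDensity {σ : ℝ} (hσ : 0 < σ) (ε : ℝ) : Continuous (potDensity σ ε) :=
  (Real.continuous_rpow_const hσ.le).mul (continuous_stepSq.comp (continuous_const.mul continuous_id))

theorem exists_abs_potDensity_le {σ : ℝ} (hσ : 0 < σ) {ε : ℝ} (hε : 0 < ε) :
    ∃ K, ∀ x, 0 ≤ x → |potDensity σ ε x| ≤ K := by
  obtain ⟨K, hK⟩ := (isCompact_Icc (a := (0 : ℝ)) (b := 2 / ε)).exists_bound_of_continuousOn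
    (continuous_potDensity hσ ε).continuousOn
  refine ⟨K, fun x hx => ?_⟩
  by_cases h : x ≤ 2 / ε
  · exact hK x ⟨hx, h⟩
  · have h2 : 2 ≤ ε * x := by
      rw [not_le, div_lt_iff₀ hε] at h
      linarith
    rw [potDensity, stepSq_of_ge h2, mul_zero, abs_zero]
    exact (norm_nonneg _).trans (hK 0 ⟨le_rfl, by positivity⟩)

theorem inner_I_mul (z : ℂ) : inner ℝ z (Complex.I * z) = (0 : ℝ) := by
  rw [Complex.inner]; simp; ring

theorem hasFDerivAt_norm_sq_complex (z : ℂ) :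
    HasFDerivAt (fun z : ℂ => ‖z‖ ^ 2) (2 • innerSL ℝ z) z :=
  (hasStrictFDerivAt_norm_sq z).hasFDerivAt

theorem hasFDerivAt_step_smul (ε : ℝ) (z : ℂ) : HasFDerivAt (fun z : ℂ => step (ε * ‖z‖ ^ 2) • z)
    (step (ε * ‖z‖ ^ 2) • ContinuousLinearMap.id ℝ ℂ +
      (2 * ε * deriv step (ε * ‖z‖ ^ 2)) • (innerSL ℝ z).smulRight z) z := by
  have h1 := (hasDerivAt_step (ε * ‖z‖ ^ 2)).comp_hasFDerivAt z
    ((hasFDerivAt_norm_sq_complex z).const_mul ε)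
  have h2 := h1.smul (hasFDerivAt_id z)
  refine h2.congr_fderiv ?_
  ext
  simp
  ring

theorem contDiff_step_smul (ε : ℝ) : ContDiff ℝ ∞ fun z : ℂ => step (ε * ‖z‖ ^ 2) • z :=
  (contDiff_step.comp (contDiff_const.mul (contDiff_norm_sq ℝ))).smul contDiff_id

theorem hasCompactSupport_step_smul {ε : ℝ} (hε : 0 < ε) :
    HasCompactSupport fun z : ℂ => step (ε * ‖z‖ ^ 2) • z := by
  refine HasCompactSupport.of_support_subset_isCompact
    (isCompact_closedBall (0 : ℂ) (√(2 / ε))) fun z hz => ?_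
  rw [mem_closedBall_zero_iff]
  refine Real.le_sqrt_of_sq_le ?_
  by_contra h
  rw [not_le, div_lt_iff₀ hε] at h
  exact hz (by dsimp only; rw [step_of_ge (by linarith), zero_smul])

/-- A smooth compactly supported map has a Lipschitz derivative, and the mean value inequality on
the ball of radius ‖d‖ gives a quadratic remainder. The constant depends on ε, which is harmless
because ε is fixed when time is differentiated. -/
theorem taylor_step_smul {ε : ℝ} (hε : 0 < ε) : ∃ L, ∀ z d : ℂ,
    ‖step (ε * ‖z + d‖ ^ 2) • (z + d) - step (ε * ‖z‖ ^ 2) • z -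
      fderiv ℝ (fun z : ℂ => step (ε * ‖z‖ ^ 2) • z) z d‖ ≤ L * ‖d‖ ^ 2 := by
  set T : ℂ → ℂ := fun z => step (ε * ‖z‖ ^ 2) • z with hT
  have hs : HasCompactSupport T := hasCompactSupport_step_smul hε
  obtain ⟨L, hL⟩ := ContDiff.lipschitzWith_of_hasCompactSupport (hs.fderiv ℝ)
    ((contDiff_step_smul ε).fderiv_right (m := 1) (WithTop.coe_le_coe.2 le_top)) one_ne_zero
  refine ⟨L, fun z d => ?_⟩
  have hb : ∀ y ∈ Metric.closedBall z ‖d‖, ‖fderiv ℝ T y - fderiv ℝ T z‖ ≤ L * ‖d‖ := by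
    intro y hy
    have := hL.dist_le_mul y z
    rw [dist_eq_norm] at this
    exact this.trans (by gcongr; exact hy)
  have := (convex_closedBall z ‖d‖).norm_image_sub_le_of_norm_hasFDerivWithin_le' (f := T)
    (f' := fderiv ℝ T) (φ := fderiv ℝ T z) (x := z) (y := z + d)
    (fun y _ => ((contDiff_step_smul ε).differentiable (by simp) y).hasFDerivAt.hasFDerivWithinAt)
    hb (by simp) (by simp)
  rw [add_sub_cancel_left] at this
  calc _ ≤ _ := this
    _ = _ := by ring

theorem norm_sq_rpow (σ : ℝ) (z : ℂ) : (‖z‖ ^ 2) ^ σ = ‖z‖ ^ (2 * σ) := by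
  rw [Real.rpow_mul (norm_nonneg z)]; norm_cast

/-- Take T z = step(ε|z|²) z. As 2 Re(conj(|z|^{2σ}Tz) dT) depends only on |z|² and its
differential, its primitive is the integral over [0, |z|²] of x^σ times the derivative of y step(y)²
at y = εx. -/
theorem exists_truncation {σ : ℝ} (hσ : 0 < σ) {C : ℝ} (hC0 : 0 ≤ C)
    (hC : ∀ y, |y * deriv step y| ≤ C) {ε : ℝ} (hε : 0 < ε) :
    ∃ τ : Truncation σ (1 + 2 * C), ∀ z : ℂ, ε * ‖z‖ ^ 2 < 1 →
      τ.cut z = ContinuousLinearMap.id ℝ ℂ ∧ τ.der z = ContinuousLinearMap.id ℝ ℂ ∧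
        τ.pot z = ‖z‖ ^ (2 * σ + 2) / (σ + 1) := by
  have hstep := contDiff_step.continuous
  have hstep' := continuous_deriv_step
  have hinner : Continuous fun z : ℂ => (innerSL ℝ z : ℂ →L[ℝ] ℝ) := (innerSL ℝ).continuous
  obtain ⟨K, hK⟩ := exists_abs_potDensity_le hσ hε
  have hcutn : ∀ z : ℂ, ‖step (ε * ‖z‖ ^ 2) • ContinuousLinearMap.id ℝ ℂ‖ ≤ 1 := by
    intro z
    rw [norm_smul, ContinuousLinearMap.norm_id, mul_one]
    exact abs_step_le _
  let cut : ℂ →ᵇ (ℂ →L[ℝ] ℂ) := BoundedContinuousFunction.ofNormedAddCommGroup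
    (fun z => step (ε * ‖z‖ ^ 2) • ContinuousLinearMap.id ℝ ℂ) (by fun_prop) 1 hcutn
  have hdern : ∀ z : ℂ, ‖step (ε * ‖z‖ ^ 2) • ContinuousLinearMap.id ℝ ℂ +
      (2 * ε * deriv step (ε * ‖z‖ ^ 2)) • (innerSL ℝ z).smulRight z‖ ≤ 1 + 2 * C := by
    intro z
    refine (norm_add_le _ _).trans (add_le_add (hcutn z) ?_)
    rw [norm_smul, ContinuousLinearMap.norm_smulRight_apply, innerSL_apply_norm, Real.norm_eq_abs]
    have := hC (ε * ‖z‖ ^ 2)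
    calc |2 * ε * deriv step (ε * ‖z‖ ^ 2)| * (‖z‖ * ‖z‖)
        = 2 * |ε * ‖z‖ ^ 2 * deriv step (ε * ‖z‖ ^ 2)| := by
          simp only [abs_mul, abs_pow, abs_norm, abs_two]; ring
      _ ≤ _ := by gcongr
  have hderc : Continuous fun z : ℂ => step (ε * ‖z‖ ^ 2) • ContinuousLinearMap.id ℝ ℂ +
      (2 * ε * deriv step (ε * ‖z‖ ^ 2)) • (innerSL ℝ z).smulRight z := by
    have := (contDiff_step_smul ε).continuous_fderiv (by simp)
    rwa [funext fun z => (hasFDerivAt_step_smul ε z).fderiv] at this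
  let der : ℂ →ᵇ (ℂ →L[ℝ] ℂ) := BoundedContinuousFunction.ofNormedAddCommGroup
    (fun z => step (ε * ‖z‖ ^ 2) • ContinuousLinearMap.id ℝ ℂ +
      (2 * ε * deriv step (ε * ‖z‖ ^ 2)) • (innerSL ℝ z).smulRight z) hderc (1 + 2 * C) hdern
  have hpowc : Continuous fun z : ℂ => ‖z‖ ^ (2 * σ) :=
    continuous_norm.rpow_const fun _ => Or.inr (by positivity)
  have hpown : ∃ M, ∀ z : ℂ,
      ‖(‖z‖ ^ (2 * σ) * step (ε * ‖z‖ ^ 2)) • ContinuousLinearMap.id ℝ ℂ‖ ≤ M := by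
    obtain ⟨M, hM⟩ := (isCompact_closedBall (0 : ℂ) (√(2 / ε))).exists_bound_of_continuousOn
      (f := fun z : ℂ => ‖z‖ ^ (2 * σ)) hpowc.continuousOn
    refine ⟨M, fun z => ?_⟩
    rw [norm_smul, ContinuousLinearMap.norm_id, mul_one, norm_mul]
    by_cases h : ‖z‖ ≤ √(2 / ε)
    · calc _ ≤ M * 1 := mul_le_mul (hM z (mem_closedBall_zero_iff.2 h)) (abs_step_le _)
            (abs_nonneg _) ((norm_nonneg _).trans (hM z (mem_closedBall_zero_iff.2 h)))
        _ = M := mul_one M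
    · rw [not_le] at h
      rw [Real.sqrt_lt' ((Real.sqrt_nonneg _).trans_lt h), div_lt_iff₀ hε] at h
      rw [step_of_ge (by linarith), norm_zero, mul_zero]
      exact (norm_nonneg _).trans (hM 0 (mem_closedBall_zero_iff.2 (by rw [norm_zero]; exact Real.sqrt_nonneg _)))
  obtain ⟨M, hM⟩ := hpown
  let pow : ℂ →ᵇ (ℂ →L[ℝ] ℂ) := BoundedContinuousFunction.ofNormedAddCommGroup
    (fun z => (‖z‖ ^ (2 * σ) * step (ε * ‖z‖ ^ 2)) • ContinuousLinearMap.id ℝ ℂ) (by fun_prop) M hM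
  have hdc := continuous_potDensity hσ ε
  have hration : ∀ z : ℂ, ‖(∫ t in (0 : ℝ)..1, potDensity σ ε (‖z‖ ^ 2 * t)) •
      ContinuousLinearMap.id ℝ ℂ‖ ≤ K := by
    intro z
    rw [norm_smul, ContinuousLinearMap.norm_id, mul_one]
    have := intervalIntegral.norm_integral_le_of_norm_le_const (a := 0) (b := 1) (C := K)
      (f := fun t => potDensity σ ε (‖z‖ ^ 2 * t)) fun t ht => by
        rw [uIoc_of_le zero_le_one] at ht
        exact hK _ (mul_nonneg (by positivity) ht.1.le)
    simpa using this
  -- Rescaling the interval [0, ‖z‖²] to [0, 1] expresses `pot`/‖z‖² without dividing by zero at the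
  -- origin.
  let ratio : ℂ →ᵇ (ℂ →L[ℝ] ℂ) := BoundedContinuousFunction.ofNormedAddCommGroup
    (fun z => (∫ t in (0 : ℝ)..1, potDensity σ ε (‖z‖ ^ 2 * t)) • ContinuousLinearMap.id ℝ ℂ)
    ((intervalIntegral.continuous_parametric_intervalIntegral_of_continuous'
      (f := fun (z : ℂ) t => potDensity σ ε (‖z‖ ^ 2 * t)) (hdc.comp (by fun_prop)) 0 1).smul continuous_const) K hration
  have hpot : ∀ z : ℂ, HasFDerivAt (fun z : ℂ => ∫ x in (0 : ℝ)..‖z‖ ^ 2, potDensity σ ε x)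
      (potDensity σ ε (‖z‖ ^ 2) • (2 • innerSL ℝ z)) z := fun z =>
    HasDerivAt.comp_hasFDerivAt z (h₂ := fun y => ∫ x in (0 : ℝ)..y, potDensity σ ε x)
      (hdc.integral_hasStrictDerivAt 0 (‖z‖ ^ 2)).hasDerivAt (hasFDerivAt_norm_sq_complex z)
  let τ : Truncation σ (1 + 2 * C) :=
    { cut := cut
      der := der
      pow := pow
      ratio := ratio
      pot := fun z => ∫ x in (0 : ℝ)..‖z‖ ^ 2, potDensity σ ε x
      pot' := fun z => potDensity σ ε (‖z‖ ^ 2) • (2 • innerSL ℝ z)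
      hasFDerivAt_cut := fun z => hasFDerivAt_step_smul ε z
      taylor := by
        obtain ⟨L, hL⟩ := taylor_step_smul hε
        refine ⟨L, fun z d => ?_⟩
        have := hL z d
        rw [(hasFDerivAt_step_smul ε z).fderiv] at this
        exact this
      der_I := fun z => by
        simp only [der, cut, BoundedContinuousFunction.coe_ofNormedAddCommGroup, add_apply,
          smul_apply, ContinuousLinearMap.id_apply,
          ContinuousLinearMap.smulRight_apply, innerSL_apply_apply, inner_I_mul, zero_smul,
          smul_zero, add_zero, Complex.real_smul]
        ring
      pow_apply := fun z v => by simp [pow, cut, mul_assoc]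
      hasFDerivAt_pot := hpot
      continuous_pot' := by fun_prop
      pot'_apply := fun z v => by
        simp only [pow, der, BoundedContinuousFunction.coe_ofNormedAddCommGroup, add_apply,
          smul_apply, ContinuousLinearMap.id_apply,
          ContinuousLinearMap.smulRight_apply, innerSL_apply_apply, Complex.inner, potDensity,
          norm_sq_rpow, stepSq, Complex.real_smul, smul_eq_mul, nsmul_eq_mul, map_mul,
          Complex.conj_ofReal]
        have h : (starRingEnd ℂ) z * z = ((‖z‖ ^ 2 : ℝ) : ℂ) := by
          rw [← Complex.normSq_eq_conj_mul_self, Complex.normSq_eq_norm_sq]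
        -- Here P = ‖z‖^{2σ}, S is the step, D is 2ε times its derivative and r = ⟨z, v⟩; then S(S +
        -- D‖z‖²) is `stepSq`.
        have h2 : ∀ P S D r : ℝ, ((P * S : ℝ) : ℂ) * (starRingEnd ℂ) z *
            ((S : ℂ) * v + (D : ℂ) * ((r : ℂ) * z)) =
            ((P * S * S : ℝ) : ℂ) * (v * (starRingEnd ℂ) z) +
              ((P * S * D * r * ‖z‖ ^ 2 : ℝ) : ℂ) := by
          intro P S D r
          rw [show ((P * S * D * r * ‖z‖ ^ 2 : ℝ) : ℂ) =
            ((P * S * D * r : ℝ) : ℂ) * ((starRingEnd ℂ) z * z) by rw [h]; push_cast; ring]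
          push_cast
          ring
        rw [h2, Complex.add_re, Complex.re_ofReal_mul, Complex.ofReal_re]
        push_cast
        ring
      pot_eq := fun z => by
        have h := intervalIntegral.mul_integral_comp_mul_left (a := 0) (b := 1)
          (f := potDensity σ ε) (c := ‖z‖ ^ 2)
        rw [mul_zero, mul_one] at h
        rw [← h]
        simp only [ratio, BoundedContinuousFunction.coe_ofNormedAddCommGroup,
          smul_apply, ContinuousLinearMap.id_apply, Complex.real_smul]
        rw [mul_left_comm, ← Complex.normSq_eq_conj_mul_self, Complex.normSq_eq_norm_sq]
        push_cast
        ring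
      norm_cut_le := fun z v => by
        refine ((cut z).le_of_opNorm_le (hcutn z) v).trans ?_
        gcongr
        linarith
      norm_der_le := fun z v => (der z).le_of_opNorm_le (hdern z) v
      abs_pot_le := fun z => by
        refine (intervalIntegral.norm_integral_le_of_norm_le_const (a := 0) (b := ‖z‖ ^ 2)
          (f := potDensity σ ε) (C := (1 + 2 * C) * ‖z‖ ^ (2 * σ)) fun x hx => ?_).trans (le_of_eq ?_)
        · rw [uIoc_of_le (by positivity)] at hx
          rw [potDensity, norm_mul, mul_comm, ← norm_sq_rpow]
          refine mul_le_mul (abs_stepSq_le hC _) ?_ (norm_nonneg _) (by positivity)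
          rw [Real.norm_of_nonneg (Real.rpow_nonneg hx.1.le _)]
          exact Real.rpow_le_rpow hx.1.le hx.2 hσ.le
        · rw [sub_zero, abs_of_nonneg (by positivity), Real.rpow_add_of_nonneg (by positivity)
            (by positivity) (by positivity), Real.rpow_two, mul_assoc] }
  refine ⟨τ, fun z hz => ⟨?_, ?_, ?_⟩⟩
  · change step (ε * ‖z‖ ^ 2) • ContinuousLinearMap.id ℝ ℂ = _
    rw [step_of_le hz.le, one_smul]
  · change step (ε * ‖z‖ ^ 2) • ContinuousLinearMap.id ℝ ℂ +
      (2 * ε * deriv step (ε * ‖z‖ ^ 2)) • (innerSL ℝ z).smulRight z = _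
    rw [step_of_le hz.le, one_smul, deriv_step_of_lt hz, mul_zero, zero_smul, add_zero]
  · change ∫ x in (0 : ℝ)..‖z‖ ^ 2, potDensity σ ε x = _
    -- Where ε‖z‖² < 1 the truncation is inactive on the whole interval, leaving the integral of
    -- x^σ.
    rw [intervalIntegral.integral_congr (g := fun x => x ^ σ) fun x hx => ?_,
      integral_rpow (Or.inl (by linarith)), Real.zero_rpow (by positivity), sub_zero, norm_sq_rpow,
      mul_add, mul_one]
    rw [uIcc_of_le (by positivity)] at hx
    simp only [potDensity]
    rw [stepSq_of_lt (lt_of_le_of_lt (by gcongr; exact hx.2) hz), mul_one]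

theorem exists_truncation_seq {σ : ℝ} (hσ : 0 < σ) : ∃ C, 0 ≤ C ∧ ∃ τ : ℕ → Truncation σ C,
    ∀ z : ℂ, ∀ᶠ n in atTop, (τ n).cut z = ContinuousLinearMap.id ℝ ℂ ∧
      (τ n).der z = ContinuousLinearMap.id ℝ ℂ ∧
        (τ n).pot z = ‖z‖ ^ (2 * σ + 2) / (σ + 1) := by
  obtain ⟨C, hC0, hC⟩ := exists_abs_mul_deriv_step_le
  choose τ hτ using fun n : ℕ => exists_truncation hσ hC0 hC (ε := 1 / ((n : ℝ) + 1)) (by positivity)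
  refine ⟨1 + 2 * C, by positivity, τ, fun z => ?_⟩
  have h := (tendsto_one_div_add_atTop_nhds_zero_nat (𝕜 := ℝ)).mul_const (‖z‖ ^ 2)
  rw [zero_mul] at h
  filter_upwards [h.eventually_lt_const one_pos] with n hn
  exact hτ n z hn

/-! ### Truncation in H¹ and the truncated nonlinear term. -/

namespace Truncation

variable {σ C : ℝ} (τ : Truncation σ C)

/-- The truncation of an `L²` function. -/
def trunc (f : L2 N) : L2 N := nem τ.cut f f

/-- The truncation of an `H¹` function, with its gradient. -/
def truncH1 (p : L2 N × (Fin N → L2 N)) : L2 N × (Fin N → L2 N) :=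
  (τ.trunc p.1, fun k => nem τ.der p.1 (p.2 k))

theorem truncH1_mem {p : L2 N × (Fin N → L2 N)} (hp : p ∈ gradGraph N) :
    τ.truncH1 p ∈ gradGraph N := nem_mem_gradGraph τ.hasFDerivAt_cut hp

theorem continuous_truncH1 :
    Continuous (τ.truncH1 : L2 N × (Fin N → L2 N) → L2 N × (Fin N → L2 N)) :=
  Continuous.prodMk ((continuous_nem _).comp (continuous_fst.prodMk continuous_fst))
    (continuous_pi fun k => (continuous_nem _).comp (continuous_fst.prodMk (by fun_prop)))

theorem conj_mul_ratio_ae_eq (f : L2 N) :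
    (fun x => (starRingEnd ℂ) (f x) * nem τ.ratio f f x) =ᵐ[volume] fun x => (τ.pot (f x) : ℂ) := by
  filter_upwards [coeFn_nem τ.ratio f f] with x hx
  rw [hx, τ.pot_eq]

theorem integrable_pot (f : L2 N) : Integrable fun x => τ.pot (f x) :=
  ((integrable_conj_mul f (nem τ.ratio f f)).congr (τ.conj_mul_ratio_ae_eq f)).re.congr
    (Eventually.of_forall fun _ => Complex.ofReal_re _)

theorem inner_mulR_ratio (b : E N → ℝ) (hb : MemLp b ∞ volume) (f : L2 N) :
    inner ℂ f (mulR b hb (nem τ.ratio f f)) = ((∫ x, b x * τ.pot (f x) : ℝ) : ℂ) := by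
  rw [inner_mulR_right, ← integral_complex_ofReal]
  refine integral_congr_ae ?_
  filter_upwards [τ.conj_mul_ratio_ae_eq f] with x hx
  rw [hx]; push_cast; rfl

theorem contDiff_pot : ContDiff ℝ 1 τ.pot :=
  contDiff_one_iff_hasFDerivAt.2 ⟨τ.pot', τ.continuous_pot', τ.hasFDerivAt_pot⟩

theorem re_inner_mulR_ofReal {c : E N → ℝ} (hc : MemLp c ∞ volume) (f g : L2 N) :
    (inner ℂ f (mulR c hc g)).re = ∫ x, c x * ((starRingEnd ℂ) (f x) * g x).re := by
  rw [inner_mulR_right, ← RCLike.re_eq_complex_re, ← integral_re (integrable_mul_conj_mul c hc f g)]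
  refine integral_congr_ae (Eventually.of_forall fun x => ?_)
  exact Complex.re_ofReal_mul _ _

/-- For C¹ functions the left integrand is c ∂ₖ(pot ∘ f), and integration by parts gives the right
side. Both sides are continuous in the pair, thanks to `ratio`, so the identity extends to H¹. -/
theorem two_mul_re_inner_pow_der {k : Fin N} {c c' : E N → ℝ} (h : HasWeakPartial k c c')
    (hc : MemLp c ∞ volume) (hc' : MemLp c' ∞ volume) {p : L2 N × (Fin N → L2 N)}
    (hp : p ∈ gradGraph N) :
    2 * (inner ℂ (nem τ.pow p.1 p.1) (mulR c hc (nem τ.der p.1 (p.2 k)))).re =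
      - (inner ℂ p.1 (mulR c' hc' (nem τ.ratio p.1 p.1))).re := by
  have hn : ∀ Φ, Continuous fun q : L2 N × (Fin N → L2 N) => nem Φ q.1 q.1 := fun Φ =>
    (continuous_nem Φ).comp (continuous_fst.prodMk continuous_fst)
  have hn' : Continuous fun q : L2 N × (Fin N → L2 N) => nem τ.der q.1 (q.2 k) :=
    (continuous_nem _).comp (continuous_fst.prodMk (by fun_prop))
  have hcl : IsClosed {q : L2 N × (Fin N → L2 N) |
      2 * (inner ℂ (nem τ.pow q.1 q.1) (mulR c hc (nem τ.der q.1 (q.2 k)))).re =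
      - (inner ℂ q.1 (mulR c' hc' (nem τ.ratio q.1 q.1))).re} :=
    isClosed_eq (continuous_const.mul (Complex.continuous_re.comp
      (continuous_inner_mulR c hc (hn _) hn')))
      (Complex.continuous_re.comp (continuous_inner_mulR c' hc' continuous_fst (hn _))).neg
  refine closure_minimal (s := classicalH1 N) ?_ hcl hp
  rintro ⟨f, f'⟩ ⟨χ, hχ, hf, hf'⟩
  dsimp only at hf hf'
  rw [mem_ofPred_eq, τ.inner_mulR_ratio, Complex.ofReal_re, re_inner_mulR_ofReal]
  have hψ : ContDiff ℝ 1 fun x => τ.pot (χ x) := τ.contDiff_pot.comp hχ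
  have hd : ∀ x, fderiv ℝ (fun x => τ.pot (χ x)) x (e k) =
      2 * ((starRingEnd ℂ) (τ.pow (χ x) (χ x)) * τ.der (χ x) (fderiv ℝ χ x (e k))).re := by
    intro x
    have := (τ.hasFDerivAt_pot (χ x)).comp x (hχ.differentiable one_ne_zero x).hasFDerivAt
    rw [HasFDerivAt.fderiv (f := fun x => τ.pot (χ x)) this, ContinuousLinearMap.comp_apply,
      τ.pot'_apply]
  have hae : ∀ᵐ x, (starRingEnd ℂ) (nem τ.pow f f x) * nem τ.der f (f' k) x =
      (starRingEnd ℂ) (τ.pow (χ x) (χ x)) * τ.der (χ x) (fderiv ℝ χ x (e k)) := by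
    filter_upwards [coeFn_nem τ.pow f f, coeFn_nem τ.der f (f' k), hf, hf' k] with x h1 h2 h3 h4
    rw [h1, h2, h3, h4]
  have hi : Integrable fun x => τ.pot (χ x) := (τ.integrable_pot f).congr (by
    filter_upwards [hf] with x hx
    rw [hx])
  have hi' : Integrable fun x => fderiv ℝ (fun x => τ.pot (χ x)) x (e k) := by
    simp only [hd]
    refine (((integrable_conj_mul (nem τ.pow f f) (nem τ.der f (f' k))).congr hae).re.const_mul
      2).congr (Eventually.of_forall fun x => rfl)
  have key := h.integral_smul_fderiv_real hc hc' hψ hi hi'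
  rw [← integral_const_mul]
  calc _ = ∫ x, c x * fderiv ℝ (fun x => τ.pot (χ x)) x (e k) := by
        refine integral_congr_ae ?_
        filter_upwards [hae] with x hx
        rw [hx, hd]; ring
    _ = _ := by
        rw [key]
        congr 1
        refine integral_congr_ae ?_
        filter_upwards [hf] with x hx
        rw [hx]

theorem re_conj_pow_mul_cut (z : ℂ) : ((starRingEnd ℂ) (τ.pow z z) * τ.cut z z).re =
    ‖z‖ ^ (2 * σ) * ‖τ.cut z z‖ ^ 2 := by
  rw [τ.pow_apply, Complex.real_smul, map_mul, Complex.conj_ofReal, mul_assoc,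
    Complex.conj_mul', ← Complex.ofReal_pow, ← Complex.ofReal_mul, Complex.ofReal_re]

/-- The contribution of the truncated power nonlinearity to the virial identity. -/
theorem re_inner_pow_gen {φ : E N → ℝ} (hφ : GradMemWInfty 3 φ) {p : L2 N × (Fin N → L2 N)}
    (hp : p ∈ gradGraph N) :
    (inner ℂ (nem τ.pow p.1 p.1) (gen hφ (τ.truncH1 p))).re =
      - ∫ x, weakLaplacian φ x *
        (τ.pot (p.1 x) - ‖p.1 x‖ ^ (2 * σ) * ‖τ.cut (p.1 x) (p.1 x)‖ ^ 2) := by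
  have hb := hφ.weakLaplacian.memLp
  have h1 : (inner ℂ (nem τ.pow p.1 p.1) (mulR (weakLaplacian φ) hb (nem τ.cut p.1 p.1))).re =
      ∫ x, weakLaplacian φ x * (‖p.1 x‖ ^ (2 * σ) * ‖τ.cut (p.1 x) (p.1 x)‖ ^ 2) := by
    rw [re_inner_mulR_ofReal]
    refine integral_congr_ae ?_
    filter_upwards [coeFn_nem τ.pow p.1 p.1, coeFn_nem τ.cut p.1 p.1] with x h1 h2
    rw [h1, h2, τ.re_conj_pow_mul_cut]
  have hi1 : Integrable fun x => weakLaplacian φ x * τ.pot (p.1 x) :=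
    (τ.integrable_pot p.1).mul_of_top_right hb
  have hi2 : Integrable fun x =>
      weakLaplacian φ x * (‖p.1 x‖ ^ (2 * σ) * ‖τ.cut (p.1 x) (p.1 x)‖ ^ 2) := by
    refine Integrable.mul_of_top_right ?_ hb
    refine (integrable_conj_mul (nem τ.pow p.1 p.1) (nem τ.cut p.1 p.1)).re.congr ?_
    filter_upwards [coeFn_nem τ.pow p.1 p.1, coeFn_nem τ.cut p.1 p.1] with x h1 h2
    rw [h1, h2]
    exact τ.re_conj_pow_mul_cut _
  simp only [mul_sub]
  rw [integral_sub hi1 hi2, ← h1]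
  have h2 : (inner ℂ p.1 (mulR (weakLaplacian φ) hb (nem τ.ratio p.1 p.1))).re =
      ∫ x, weakLaplacian φ x * τ.pot (p.1 x) := by
    rw [τ.inner_mulR_ratio, Complex.ofReal_re]
  rw [← h2, weakLaplacian_mul_eq_sum hφ (nem τ.ratio p.1 p.1), inner_sum, Complex.re_sum, gen,
    inner_add_right, inner_smul_right, inner_sum, Complex.add_re, truncH1, trunc]
  have h3 := fun k => τ.two_mul_re_inner_pow_der ((hφ.weakPartial k).hasWeakPartial k)
    (hφ.weakPartial k).memLp ((hφ.weakPartial k).weakPartial k).memLp hp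
  simp only [← neg_eq_iff_eq_neg] at h3
  simp only [← h3]
  rw [Finset.sum_neg_distrib, ← Finset.mul_sum, Complex.mul_re, Complex.re_ofNat, Complex.im_ofNat,
    zero_mul, sub_zero, Complex.re_sum]
  ring

end Truncation

/-! ### Hölder's inequality, the power nonlinearity and approximation in L² ∩ L^q. -/

theorem norm_integral_mul_le {p q : ℝ≥0∞} [ENNReal.HolderConjugate p q] {f g : E N → ℂ}
    (hf : MemLp f p volume) (hg : MemLp g q volume) :
    ‖∫ x, f x * g x‖ ≤ (eLpNorm f p volume).toReal * (eLpNorm g q volume).toReal := by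
  have h1 := eLpNorm_smul_le_mul_eLpNorm (p := p) (q := q) (r := 1) hg.1 hf.1
  rw [← ENNReal.toReal_mul]
  refine (norm_integral_le_lintegral_norm _).trans
    (ENNReal.toReal_mono (ENNReal.mul_ne_top hf.eLpNorm_ne_top hg.eLpNorm_ne_top) ?_)
  rw [eLpNorm_one_eq_lintegral_enorm] at h1
  simpa only [ofReal_norm, Pi.smul_apply', smul_eq_mul] using h1

theorem holderConjugate_power {σ : ℝ} (hσ : 0 < σ) : ENNReal.HolderConjugate
    (ENNReal.ofReal (2 * σ + 2)) (ENNReal.ofReal ((2 * σ + 2) / (2 * σ + 1))) := by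
  rw [ENNReal.holderConjugate_iff, ← ENNReal.ofReal_inv_of_pos (by positivity),
    ← ENNReal.ofReal_inv_of_pos (by positivity), ← ENNReal.ofReal_add (by positivity)
      (by positivity), ENNReal.ofReal_eq_one]
  field_simp
  ring

/-- The power nonlinearity `|f|^{2σ} f`. -/
def power (σ : ℝ) (f : E N → ℂ) (x : E N) : ℂ := (‖f x‖ ^ (2 * σ) : ℝ) • f x

theorem norm_power {σ : ℝ} (hσ : 0 < σ) (f : E N → ℂ) (x : E N) :
    ‖power σ f x‖ = ‖f x‖ ^ (2 * σ + 1) := by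
  rw [power, norm_smul, Real.norm_of_nonneg (by positivity),
    Real.rpow_add_of_nonneg (norm_nonneg _) (by positivity) zero_le_one, Real.rpow_one]

theorem eLpNorm_power {σ : ℝ} (hσ : 0 < σ) (f : E N → ℂ) :
    eLpNorm (power σ f) (ENNReal.ofReal ((2 * σ + 2) / (2 * σ + 1))) volume =
      eLpNorm f (ENNReal.ofReal (2 * σ + 2)) volume ^ (2 * σ + 1) := by
  have h := eLpNorm_norm_rpow (μ := (volume : Measure (E N))) (q := 2 * σ + 1)
    (p := ENNReal.ofReal ((2 * σ + 2) / (2 * σ + 1))) f (by positivity)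
  rw [← ENNReal.ofReal_mul (by positivity), div_mul_cancel₀ _ (by positivity)] at h
  rw [← h]
  refine eLpNorm_congr_norm_ae (Eventually.of_forall fun x => ?_)
  rw [norm_power hσ, Real.norm_of_nonneg (by positivity)]

theorem memLp_power {σ : ℝ} (hσ : 0 < σ) {f : E N → ℂ}
    (hf : MemLp f (ENNReal.ofReal (2 * σ + 2)) volume) :
    MemLp (power σ f) (ENNReal.ofReal ((2 * σ + 2) / (2 * σ + 1))) volume := by
  refine ⟨?_, ?_⟩
  · exact (((hf.1.norm.aemeasurable.pow_const _).aestronglyMeasurable).smul hf.1)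
  · rw [eLpNorm_power hσ]
    exact ENNReal.rpow_lt_top_of_nonneg (by positivity) hf.eLpNorm_ne_top

/-- Pointwise ‖f‖^q ≤ B^{q-2} ‖f‖². Hence L² convergence under a uniform bound implies L^q
convergence. -/
theorem eLpNorm_le_of_bounded {q : ℝ} (hq : 2 ≤ q) {f : E N → ℂ} {B : ℝ} (hB : ∀ x, ‖f x‖ ≤ B) :
    eLpNorm f (ENNReal.ofReal q) volume ≤
      (ENNReal.ofReal (B ^ (q - 2)) * eLpNorm f 2 volume ^ 2) ^ (1 / q) := by
  have hq0 : 0 < q := by linarith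
  rw [eLpNorm_eq_lintegral_rpow_enorm_toReal (by simpa using hq0) ENNReal.ofReal_ne_top,
    eLpNorm_eq_lintegral_rpow_enorm_toReal two_ne_zero ENNReal.ofNat_ne_top,
    ENNReal.toReal_ofReal hq0.le, ENNReal.toReal_ofNat, ← ENNReal.rpow_natCast, ← ENNReal.rpow_mul]
  refine ENNReal.rpow_le_rpow ?_ (by positivity)
  norm_num
  rw [← lintegral_const_mul' _ _ ENNReal.ofReal_ne_top]
  refine lintegral_mono fun x => ?_
  rw [← ofReal_norm, ENNReal.ofReal_rpow_of_nonneg (norm_nonneg _) hq0.le,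
    ← ENNReal.ofReal_pow (norm_nonneg _), ← ENNReal.ofReal_mul
      (Real.rpow_nonneg ((norm_nonneg _).trans (hB x)) _)]
  refine ENNReal.ofReal_le_ofReal ?_
  rw [show q = (q - 2) + 2 by ring, Real.rpow_add_of_nonneg (norm_nonneg _) (by linarith)
    zero_le_two, Real.rpow_two]
  gcongr ?_ * _
  rw [show q - 2 + 2 - 2 = q - 2 by ring]
  exact Real.rpow_le_rpow (norm_nonneg _) (hB x) (by linarith)

/-- Bounded functions in `L²` are limits, in `L²` and in `L^q`, of smooth functions with compact
support. -/
theorem exists_tendsto_eLpNorm_of_bounded {q : ℝ} (hq : 2 ≤ q) {f : E N → ℂ}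
    (hf : MemLp f 2 volume) {M : ℝ} (hM : ∀ x, ‖f x‖ ≤ M) : ∃ ψ : ℕ → E N → ℂ,
      (∀ n, ContDiff ℝ ∞ (ψ n) ∧ HasCompactSupport (ψ n)) ∧
      Tendsto (fun n => eLpNorm (fun x => ψ n x - f x) 2 volume) atTop (𝓝 0) ∧
      Tendsto (fun n => eLpNorm (fun x => ψ n x - f x) (ENNReal.ofReal q) volume) atTop (𝓝 0) := by
  -- With this parameter the truncation is the identity on |z| ≤ M, so it fixes the values of f;
  -- composing L²-approximations with it bounds them uniformly and keeps L² convergence by the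
  -- Lipschitz property.
  have hε : (0 : ℝ) < 1 / (M ^ 2 + 1) := by positivity
  set χ : ℂ → ℂ := fun z => step (1 / (M ^ 2 + 1) * ‖z‖ ^ 2) • z with hχdef
  have hχ : ContDiff ℝ ∞ χ := contDiff_step_smul _
  have hχs : HasCompactSupport χ := hasCompactSupport_step_smul hε
  have hχM : ∀ z, ‖z‖ ≤ M → χ z = z := by
    intro z hz
    rw [hχdef]
    dsimp only
    rw [step_of_le, one_smul]
    rw [div_mul_eq_mul_div, one_mul, div_le_one (by positivity)]
    nlinarith [norm_nonneg z]
  obtain ⟨L, hL⟩ := ContDiff.lipschitzWith_of_hasCompactSupport hχs hχ (by simp)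
  obtain ⟨B, hB⟩ := hχ.continuous.bounded_above_of_compact_support hχs
  choose ψ h1 h2 h3 using fun n : ℕ => hf.exist_eLpNorm_sub_le ENNReal.ofNat_ne_top one_le_two
    (ε := 1 / ((n : ℝ) + 1)) (by positivity)
  have hχ0 : χ 0 = 0 := by simp [hχdef]
  have hpt : ∀ n x, ‖χ (ψ n x) - f x‖ ≤ L * ‖(f - ψ n) x‖ := by
    intro n x
    have := hL.dist_le_mul (ψ n x) (f x)
    rwa [hχM _ (hM x), dist_eq_norm, dist_comm, dist_eq_norm] at this
  have ht2 : Tendsto (fun n => eLpNorm (fun x => χ (ψ n x) - f x) 2 volume) atTop (𝓝 0) := by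
    have hup : Tendsto (fun n : ℕ => (L : ℝ≥0∞) * ENNReal.ofReal (1 / ((n : ℝ) + 1))) atTop
        (𝓝 0) := by
      have := ENNReal.Tendsto.const_mul (a := (L : ℝ≥0∞)) (ENNReal.tendsto_ofReal
        (tendsto_one_div_add_atTop_nhds_zero_nat (𝕜 := ℝ))) (Or.inr ENNReal.coe_ne_top)
      simpa using this
    refine tendsto_of_tendsto_of_tendsto_of_le_of_le tendsto_const_nhds hup (fun _ => zero_le)
      fun n => ?_
    refine (eLpNorm_le_nnreal_smul_eLpNorm_of_ae_le_mul (Eventually.of_forall (hpt n)) 2).trans ?_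
    rw [ENNReal.smul_def, smul_eq_mul]
    gcongr
    exact h3 n
  refine ⟨fun n x => χ (ψ n x), fun n => ⟨hχ.comp (h2 n), (h1 n).comp_left hχ0⟩, ht2, ?_⟩
  have hB2 : ∀ n x, ‖χ (ψ n x) - f x‖ ≤ B + M := fun n x =>
    (norm_sub_le _ _).trans (add_le_add (hB _) (hM x))
  refine tendsto_of_tendsto_of_tendsto_of_le_of_le tendsto_const_nhds ?_ (fun _ => zero_le)
    fun n => eLpNorm_le_of_bounded hq (hB2 n)
  have h4 := ENNReal.Tendsto.const_mul (a := ENNReal.ofReal ((B + M) ^ (q - 2))) (ENNReal.Tendsto.pow ht2 (n := 2))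
    (Or.inr ENNReal.ofReal_ne_top)
  have h5 := h4.ennrpow_const (1 / q)
  have hq0 : 0 < q := by linarith
  simpa [hq0] using h5

theorem memLp_of_bounded {q : ℝ} (hq : 2 ≤ q) {f : E N → ℂ}
    (hf : MemLp f 2 volume) {M : ℝ} (hM : ∀ x, ‖f x‖ ≤ M) :
    MemLp f (ENNReal.ofReal q) volume := by
  refine ⟨hf.1, (eLpNorm_le_of_bounded hq hM).trans_lt ?_⟩
  exact ENNReal.rpow_lt_top_of_nonneg (by positivity)
    (ENNReal.mul_ne_top ENNReal.ofReal_ne_top (ENNReal.pow_ne_top hf.eLpNorm_ne_top))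

/-! ### The equation tested against bounded L² functions. -/

variable {s σ : ℝ} {T : EReal} {u : ℝ → L2 N}

theorem IsSolution.exists_op (hu : IsSolution s σ T u) (hs : 0 ≤ s) :
    ∃ v : ℝ → L2 N, ContinuousOn v (timeInterval T) ∧ ∀ t ∈ timeInterval T,
      u t = op _ (memLp_besselSymbol (by positivity : 0 ≤ 2 * s)) (v t) := by
  obtain ⟨v, hv, h⟩ := hu.sobolev
  exact ⟨v, hv, fun t ht => eq_op_of_besselPotential_eq (by positivity) (h t ht)⟩

theorem IsSolution.continuousOn (hu : IsSolution s σ T u) (hs : 0 ≤ s) :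
    ContinuousOn u (timeInterval T) := by
  obtain ⟨v, hv, h⟩ := hu.exists_op hs
  exact ((op _ _).continuous.comp_continuousOn hv).congr h

theorem IsSolution.continuousOn_fracLaplacian (hu : IsSolution s σ T u) (hs : 0 ≤ s) :
    ContinuousOn (fun t => fracLaplacian s (u t)) (timeInterval T) := by
  obtain ⟨v, hv, h⟩ := hu.exists_op hs
  refine ((op _ (memLp_fracSymbol hs)).continuous.comp_continuousOn hv).congr fun t ht => ?_
  rw [h t ht, fracLaplacian_op hs]
  rfl

theorem IsSolution.fourier_fracLaplacian (hu : IsSolution s σ T u) (hs : 0 ≤ s) {t : ℝ}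
    (ht : t ∈ timeInterval T) : (𝓕 (fracLaplacian s (u t)) : L2 N) =ᵐ[volume] fun ξ =>
      (((2 * Real.pi * ‖ξ‖) ^ (2 * s) : ℝ) : ℂ) * (𝓕 (u t) : L2 N) ξ := by
  obtain ⟨v, hv, h⟩ := hu.exists_op hs
  rw [h t ht, fracLaplacian_op hs]
  exact fourier_fracLaplacian_op hs (v t)

/-- The lower bound on s gives 2s ≥ 1, so the symbol of the gradient composed with the Bessel
potential is bounded and H^{2s} embeds in H¹. -/
theorem IsSolution.exists_grad (hu : IsSolution s σ T u) (hs : 1 / 2 ≤ s) :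
    ∃ D : ℝ → Fin N → L2 N, ContinuousOn D (timeInterval T) ∧
      ∀ t ∈ timeInterval T, IsFourierGrad (u t) (D t) := by
  obtain ⟨v, hv, h⟩ := hu.exists_op (by linarith)
  have hr : 1 ≤ 2 * s := by linarith
  refine ⟨fun t k => op _ (memLp_gradSymbol_mul_besselSymbol k hr) (v t),
    continuousOn_pi.2 fun k => (op _ _).continuous.comp_continuousOn hv, fun t ht => ?_⟩
  rw [h t ht]
  exact isFourierGrad_op _ _ _

/-- The right-hand side `-i (-Δ)^s f + i |f|^{2σ} f` of the evolution equation. -/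
def field (s σ : ℝ) (f : L2 N) (x : E N) : ℂ :=
  -Complex.I * fracLaplacian s f x + Complex.I * power σ f x

theorem locallyIntegrable_power (hσ : 0 < σ) {f : E N → ℂ}
    (hf : MemLp f (ENNReal.ofReal (2 * σ + 2)) volume) : LocallyIntegrable (power σ f) := by
  refine (memLp_power hσ hf).locallyIntegrable ?_
  rw [ENNReal.one_le_ofReal, one_le_div (by positivity)]
  linarith

theorem IsSolution.hasDerivWithinAt_test (hu : IsSolution s σ T u) (hσ : 0 < σ) {ψ : E N → ℝ}
    (hψ : IsTest ψ) {t : ℝ} (ht : t ∈ timeInterval T) :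
    HasDerivWithinAt (fun τ => ∫ x, ψ x • u τ x) (∫ x, ψ x • field s σ (u t) x)
      (timeInterval T) t := by
  obtain ⟨d, hd, h⟩ := hu.equation ψ hψ t ht
  convert hd using 1
  have h1 := hψ.integrable_smul (locallyIntegrable_L2 (fracLaplacian s (u t)))
  have h2 := hψ.integrable_smul (locallyIntegrable_power hσ (hu.lebesgue.1 t ht))
  have h3 : ∀ x, ψ x • field s σ (u t) x = -Complex.I * (ψ x • fracLaplacian s (u t) x) +
      Complex.I * (ψ x • power σ (u t) x) := by
    intro x
    simp only [field, Complex.real_smul]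
    ring
  simp only [h3]
  rw [integral_add (h1.const_mul _) (h2.const_mul _), integral_const_mul, integral_const_mul]
  have h4 : Complex.I * d = (∫ x, ψ x • fracLaplacian s (u t) x) - ∫ x, ψ x • power σ (u t) x := h
  linear_combination Complex.I * h4 - d * Complex.I_mul_I

theorem integral_complex_test_mul {ψ : E N → ℂ} (hψ : ContDiff ℝ ∞ ψ) (hs : HasCompactSupport ψ)
    {f : E N → ℂ} (hf : LocallyIntegrable f) :
    ∫ x, ψ x * f x = (∫ x, (ψ x).re • f x) + Complex.I * ∫ x, (ψ x).im • f x := by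
  have h1 : IsTest fun x => (ψ x).re := ⟨Complex.reCLM.contDiff.comp hψ, hs.comp_left rfl⟩
  have h2 : IsTest fun x => (ψ x).im := ⟨Complex.imCLM.contDiff.comp hψ, hs.comp_left rfl⟩
  rw [← integral_const_mul, ← integral_add (h1.integrable_smul hf)
    ((h2.integrable_smul hf).const_mul _)]
  refine integral_congr_ae (Eventually.of_forall fun x => ?_)
  dsimp only
  rw [Complex.real_smul, Complex.real_smul, ← mul_assoc, ← add_mul, mul_comm Complex.I,
    Complex.re_add_im]

theorem locallyIntegrable_field (hσ : 0 < σ) {f : L2 N}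
    (hf : MemLp f (ENNReal.ofReal (2 * σ + 2)) volume) : LocallyIntegrable (field s σ f) :=
  ((locallyIntegrable_L2 (fracLaplacian s f)).smul (-Complex.I)).add
    ((locallyIntegrable_power hσ hf).smul Complex.I)

theorem IsSolution.hasDerivWithinAt_complex_test (hu : IsSolution s σ T u) (hσ : 0 < σ)
    {ψ : E N → ℂ} (hψ : ContDiff ℝ ∞ ψ) (hs : HasCompactSupport ψ) {t : ℝ}
    (ht : t ∈ timeInterval T) :
    HasDerivWithinAt (fun τ => ∫ x, ψ x * u τ x) (∫ x, ψ x * field s σ (u t) x)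
      (timeInterval T) t := by
  have h1 : IsTest fun x => (ψ x).re := ⟨Complex.reCLM.contDiff.comp hψ, hs.comp_left rfl⟩
  have h2 : IsTest fun x => (ψ x).im := ⟨Complex.imCLM.contDiff.comp hψ, hs.comp_left rfl⟩
  simp only [integral_complex_test_mul hψ hs (locallyIntegrable_L2 _)]
  rw [integral_complex_test_mul hψ hs (locallyIntegrable_field hσ (hu.lebesgue.1 t ht))]
  exact (hu.hasDerivWithinAt_test hσ h1 ht).add ((hu.hasDerivWithinAt_test hσ h2 ht).const_mul _)

/-- The sum of the norms of a function in `L²` and in `L^{2σ+2}`. -/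
def pairNorm (σ : ℝ) (f : E N → ℂ) : ℝ :=
  (eLpNorm f 2 volume).toReal + (eLpNorm f (ENNReal.ofReal (2 * σ + 2)) volume).toReal

theorem pairNorm_nonneg (f : E N → ℂ) : 0 ≤ pairNorm σ f := by unfold pairNorm; positivity

theorem one_le_power_exponent (hσ : 0 < σ) : 1 ≤ ENNReal.ofReal (2 * σ + 2) := by
  rw [ENNReal.one_le_ofReal]; linarith

theorem pairNorm_add_le (hσ : 0 < σ) {f g : E N → ℂ} (hf : MemLp f 2 volume)
    (hf' : MemLp f (ENNReal.ofReal (2 * σ + 2)) volume) (hg : MemLp g 2 volume)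
    (hg' : MemLp g (ENNReal.ofReal (2 * σ + 2)) volume) :
    pairNorm σ (fun x => f x + g x) ≤ pairNorm σ f + pairNorm σ g := by
  have key : ∀ p : ℝ≥0∞, 1 ≤ p → MemLp f p volume → MemLp g p volume →
      (eLpNorm (fun x => f x + g x) p volume).toReal ≤
        (eLpNorm f p volume).toReal + (eLpNorm g p volume).toReal := by
    intro p hp hf hg
    rw [← ENNReal.toReal_add hf.eLpNorm_ne_top hg.eLpNorm_ne_top]
    exact ENNReal.toReal_mono (ENNReal.add_ne_top.2 ⟨hf.eLpNorm_ne_top, hg.eLpNorm_ne_top⟩)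
      (eLpNorm_add_le hf.1 hg.1 hp)
  have h1 := key 2 one_le_two hf hg
  have h2 := key _ (one_le_power_exponent hσ) hf' hg'
  unfold pairNorm
  linarith

theorem pairNorm_mono {f g : E N → ℂ} (hg : MemLp g 2 volume)
    (hg' : MemLp g (ENNReal.ofReal (2 * σ + 2)) volume) (h : ∀ x, ‖f x‖ ≤ ‖g x‖) :
    pairNorm σ f ≤ pairNorm σ g :=
  add_le_add (ENNReal.toReal_mono hg.eLpNorm_ne_top (eLpNorm_mono h))
    (ENNReal.toReal_mono hg'.eLpNorm_ne_top (eLpNorm_mono h))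

/-- The right-hand side of the equation lies in L² plus the dual of L^{2σ+2}; each summand is paired
with the matching norm of ψ. -/
theorem integral_mul_field (hσ : 0 < σ) {ψ : E N → ℂ} (hψ : MemLp ψ 2 volume)
    (hψ' : MemLp ψ (ENNReal.ofReal (2 * σ + 2)) volume) {f : L2 N}
    (hf : MemLp f (ENNReal.ofReal (2 * σ + 2)) volume) :
    Integrable (fun x => ψ x * field s σ f x) ∧
      ‖∫ x, ψ x * field s σ f x‖ ≤ (‖fracLaplacian s f‖ +
        (eLpNorm f (ENNReal.ofReal (2 * σ + 2)) volume).toReal ^ (2 * σ + 1)) * pairNorm σ ψ := by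
  have := holderConjugate_power hσ
  have hp := memLp_power hσ hf
  have hw := Lp.memLp (fracLaplacian s f)
  have h1 : Integrable fun x => ψ x * fracLaplacian s f x := hψ.integrable_mul hw
  have h2 : Integrable fun x => ψ x * power σ f x := hψ'.integrable_mul hp
  have h3 : ∀ x, ψ x * field s σ f x = -Complex.I * (ψ x * fracLaplacian s f x) +
      Complex.I * (ψ x * power σ f x) := by
    intro x
    simp only [field]
    ring
  simp only [h3]
  refine ⟨(h1.const_mul _).add (h2.const_mul _), ?_⟩
  rw [integral_add (h1.const_mul _) (h2.const_mul _), integral_const_mul, integral_const_mul]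
  refine (norm_add_le _ _).trans ?_
  rw [norm_mul, norm_mul, norm_neg, Complex.norm_I, one_mul, one_mul]
  have e1 := norm_integral_mul_le hψ hw
  have e2 := norm_integral_mul_le hψ' hp
  rw [eLpNorm_power hσ, ← ENNReal.toReal_rpow] at e2
  rw [← Lp.norm_def] at e1
  have p1 : 0 ≤ (eLpNorm ψ 2 volume).toReal := ENNReal.toReal_nonneg
  have p2 : 0 ≤ (eLpNorm ψ (ENNReal.ofReal (2 * σ + 2)) volume).toReal := ENNReal.toReal_nonneg
  have p3 : 0 ≤ (eLpNorm f (ENNReal.ofReal (2 * σ + 2)) volume).toReal ^ (2 * σ + 1) := by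
    positivity
  unfold pairNorm
  nlinarith [mul_nonneg (norm_nonneg (fracLaplacian s f)) p2, mul_nonneg p3 p1]

theorem IsSolution.exists_field_bound (hu : IsSolution s σ T u) (hs : 0 ≤ s) (hσ : 0 < σ) {t : ℝ}
    (ht : t ∈ timeInterval T) : ∃ ρ > 0, ∃ K, 0 ≤ K ∧ ∀ r ∈ timeInterval T, |r - t| < ρ →
      ∀ ψ : E N → ℂ, MemLp ψ 2 volume → MemLp ψ (ENNReal.ofReal (2 * σ + 2)) volume →
        ‖∫ x, ψ x * field s σ (u r) x‖ ≤ K * pairNorm σ ψ := by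
  have h1 := (hu.continuousOn_fracLaplacian hs t ht).norm.eventually_lt_const
    (lt_add_one ‖fracLaplacian s (u t)‖)
  have h2 := (hu.lebesgue.2 t ht).eventually_lt_const (zero_lt_one)
  obtain ⟨ρ, hρ, h⟩ := Metric.mem_nhdsWithin_iff.1 (h1.and h2)
  refine ⟨ρ, hρ, (‖fracLaplacian s (u t)‖ + 1) +
    (1 + (eLpNorm (u t) (ENNReal.ofReal (2 * σ + 2)) volume).toReal) ^ (2 * σ + 1), by positivity,
    fun r hr hrt ψ hψ hψ' => ?_⟩
  obtain ⟨e1, e2⟩ := h ⟨by rwa [Metric.mem_ball, Real.dist_eq], hr⟩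
  refine (integral_mul_field hσ hψ hψ' (hu.lebesgue.1 r hr)).2.trans ?_
  have h3 : (eLpNorm (u r) (ENNReal.ofReal (2 * σ + 2)) volume).toReal ≤
      1 + (eLpNorm (u t) (ENNReal.ofReal (2 * σ + 2)) volume).toReal := by
    have hd : MemLp (fun x => u r x - u t x) (ENNReal.ofReal (2 * σ + 2)) volume :=
      (hu.lebesgue.1 r hr).sub (hu.lebesgue.1 t ht)
    have := eLpNorm_add_le hd.1 (hu.lebesgue.1 t ht).1 (one_le_power_exponent hσ)
    have e3 : ((fun x => u r x - u t x) + u t) = u r := by ext x; simp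
    rw [e3] at this
    rw [← ENNReal.toReal_one, ← ENNReal.toReal_add ENNReal.one_ne_top
      (hu.lebesgue.1 t ht).eLpNorm_ne_top]
    refine ENNReal.toReal_mono (ENNReal.add_ne_top.2 ⟨ENNReal.one_ne_top,
      (hu.lebesgue.1 t ht).eLpNorm_ne_top⟩) (this.trans ?_)
    gcongr
  have hn := pairNorm_nonneg (σ := σ) ψ
  gcongr

theorem ordConnected_timeInterval (T : EReal) : (timeInterval T).OrdConnected :=
  ⟨fun _ hx _ hy _ hz => ⟨hx.1.trans hz.1, lt_of_le_of_lt (by exact_mod_cast hz.2) hy.2⟩⟩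

theorem memLp_test {ψ : E N → ℂ} (hψ : ContDiff ℝ ∞ ψ) (hs : HasCompactSupport ψ) (p : ℝ≥0∞) :
    MemLp ψ p volume := hψ.continuous.memLp_of_hasCompactSupport hs

theorem integrable_mul_L2 {ψ : E N → ℂ} (hψ : MemLp ψ 2 volume) (f : L2 N) :
    Integrable fun x => ψ x * f x := hψ.integrable_mul (Lp.memLp f)

theorem tendsto_integral_mul_L2 {ψ : ℕ → E N → ℂ} {Ψ : E N → ℂ} (hψ : ∀ n, MemLp (ψ n) 2 volume)
    (hΨ : MemLp Ψ 2 volume)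
    (h : Tendsto (fun n => eLpNorm (fun x => ψ n x - Ψ x) 2 volume) atTop (𝓝 0)) (f : L2 N) :
    Tendsto (fun n => ∫ x, ψ n x * f x) atTop (𝓝 (∫ x, Ψ x * f x)) := by
  rw [tendsto_iff_norm_sub_tendsto_zero]
  have h1 := ((ENNReal.tendsto_toReal ENNReal.zero_ne_top).comp h).mul_const
    (eLpNorm f 2 volume).toReal
  rw [ENNReal.toReal_zero, zero_mul] at h1
  refine squeeze_zero (fun _ => norm_nonneg _) (fun n => ?_) h1
  rw [← integral_sub (integrable_mul_L2 (hψ n) f) (integrable_mul_L2 hΨ f)]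
  simp only [← sub_mul]
  exact norm_integral_mul_le ((hψ n).sub hΨ) (Lp.memLp f)

theorem exists_tendsto_pairNorm (hσ : 0 < σ) {Ψ : E N → ℂ} (hΨ : MemLp Ψ 2 volume) {M : ℝ}
    (hM : ∀ x, ‖Ψ x‖ ≤ M) : ∃ ψ : ℕ → E N → ℂ,
      (∀ n, ContDiff ℝ ∞ (ψ n) ∧ HasCompactSupport (ψ n)) ∧
      Tendsto (fun n => eLpNorm (fun x => ψ n x - Ψ x) 2 volume) atTop (𝓝 0) ∧
      Tendsto (fun n => pairNorm σ (fun x => ψ n x - Ψ x)) atTop (𝓝 0) := by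
  obtain ⟨ψ, h1, h2, h3⟩ := exists_tendsto_eLpNorm_of_bounded (q := 2 * σ + 2) (by linarith) hΨ hM
  refine ⟨ψ, h1, h2, ?_⟩
  have := ((ENNReal.tendsto_toReal ENNReal.zero_ne_top).comp h2).add
    ((ENNReal.tendsto_toReal ENNReal.zero_ne_top).comp h3)
  simpa [pairNorm] using this

/-- The mean value inequality for test functions, with the locally uniform bound on the right-hand
side, passes to bounded L² functions by approximation. Since ρ and K do not depend on Ψ, the
function Ψ may later depend on r. -/
theorem IsSolution.exists_lipschitz_bound (hu : IsSolution s σ T u) (hs : 0 ≤ s) (hσ : 0 < σ)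
    {t : ℝ} (ht : t ∈ timeInterval T) : ∃ ρ > 0, ∃ K, 0 ≤ K ∧ ∀ r ∈ timeInterval T, |r - t| < ρ →
      ∀ Ψ : E N → ℂ, MemLp Ψ 2 volume → ∀ M, (∀ x, ‖Ψ x‖ ≤ M) →
        ‖(∫ x, Ψ x * u r x) - ∫ x, Ψ x * u t x‖ ≤ K * pairNorm σ Ψ * |r - t| := by
  obtain ⟨ρ, hρ, K, hK, h⟩ := hu.exists_field_bound hs hσ ht
  refine ⟨ρ, hρ, K, hK, fun r hr hrt Ψ hΨ M hM => ?_⟩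
  obtain ⟨ψ, h1, h2, h3⟩ := exists_tendsto_pairNorm hσ hΨ hM
  have hm := fun n p => memLp_test (h1 n).1 (h1 n).2 p
  have hΨ' := memLp_of_bounded (q := 2 * σ + 2) (by linarith) hΨ hM
  have hn : ∀ n, ‖(∫ x, ψ n x * u r x) - ∫ x, ψ n x * u t x‖ ≤ K * pairNorm σ (ψ n) * |r - t| := by
    intro n
    have hconv : Convex ℝ (timeInterval T ∩ Metric.ball t ρ) :=
      (ordConnected_timeInterval T).convex.inter (convex_ball t ρ)
    refine hconv.norm_image_sub_le_of_norm_hasDerivWithin_le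
      (f := fun r => ∫ x, ψ n x * u r x) (f' := fun r => ∫ x, ψ n x * field s σ (u r) x)
      (fun x hx => (hu.hasDerivWithinAt_complex_test hσ (h1 n).1 (h1 n).2 hx.1).mono
        inter_subset_left) (fun x hx => ?_) ⟨ht, Metric.mem_ball_self hρ⟩ ⟨hr, ?_⟩
    · exact h x hx.1 (by simpa [Real.dist_eq] using hx.2) _ (hm n _) (hm n _)
    · simpa [Real.dist_eq] using hrt
  have hlim := ((tendsto_integral_mul_L2 (fun n => hm n 2) hΨ h2 (u r)).sub
    (tendsto_integral_mul_L2 (fun n => hm n 2) hΨ h2 (u t))).norm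
  have hlim' := ((h3.add_const (pairNorm σ Ψ)).const_mul K).mul_const |r - t|
  rw [zero_add] at hlim'
  refine le_of_tendsto_of_tendsto' hlim hlim' fun n => (hn n).trans ?_
  have h4 := pairNorm_add_le hσ ((hm n 2).sub hΨ) ((hm n _).sub hΨ') hΨ hΨ'
  simp only [Pi.sub_apply, sub_add_cancel] at h4
  gcongr
  exact h4

/-- The equation tested against a bounded function in `L²`. -/
theorem IsSolution.hasDerivWithinAt_bounded (hu : IsSolution s σ T u) (hs : 0 ≤ s) (hσ : 0 < σ)
    {Ψ : E N → ℂ} (hΨ : MemLp Ψ 2 volume) {M : ℝ} (hM : ∀ x, ‖Ψ x‖ ≤ M)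
    {t : ℝ} (ht : t ∈ timeInterval T) :
    HasDerivWithinAt (fun τ => ∫ x, Ψ x * u τ x) (∫ x, Ψ x * field s σ (u t) x)
      (timeInterval T) t := by
  obtain ⟨ρ, hρ, K, hK, h⟩ := hu.exists_lipschitz_bound hs hσ ht
  obtain ⟨ρ', hρ', K', hK', h'⟩ := hu.exists_field_bound hs hσ ht
  obtain ⟨ψ, h1, h2, h3⟩ := exists_tendsto_pairNorm hσ hΨ hM
  have hm := fun n p => memLp_test (h1 n).1 (h1 n).2 p
  have hΨ' := memLp_of_bounded (q := 2 * σ + 2) (by linarith) hΨ hM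
  rw [hasDerivWithinAt_iff_isLittleO, Asymptotics.isLittleO_iff]
  intro c hc
  have h4 := h3.const_mul (K + K')
  rw [mul_zero] at h4
  -- One fixed approximant suffices: the Lipschitz bound K and the field bound K' control the error
  -- made on the increment and on the derivative by at most (c/2)|r - t|.
  obtain ⟨n, hn⟩ := (h4.eventually_lt_const (half_pos hc)).exists
  have h5 := (hasDerivWithinAt_iff_isLittleO.1
    (hu.hasDerivWithinAt_complex_test hσ (h1 n).1 (h1 n).2 ht))
  rw [Asymptotics.isLittleO_iff] at h5
  obtain ⟨B, hB⟩ := (h1 n).1.continuous.bounded_above_of_compact_support (h1 n).2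
  have hb : ∀ x, ‖ψ n x - Ψ x‖ ≤ B + M := fun x =>
    (norm_sub_le _ _).trans (add_le_add (hB x) (hM x))
  filter_upwards [h5 (half_pos hc), self_mem_nhdsWithin,
    mem_nhdsWithin_of_mem_nhds (Metric.ball_mem_nhds t hρ)] with r e1 hr hrt
  rw [Metric.mem_ball, Real.dist_eq] at hrt
  have e2 := h r hr hrt (fun x => ψ n x - Ψ x) ((hm n 2).sub hΨ) (B + M) hb
  have e3 := h' t ht (by simpa using hρ') (fun x => ψ n x - Ψ x) ((hm n 2).sub hΨ)
    ((hm n _).sub hΨ')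
  have i1 := (integral_mul_field (s := s) hσ (hm n 2) (hm n _) (hu.lebesgue.1 t ht)).1
  have i2 := (integral_mul_field (s := s) hσ hΨ hΨ' (hu.lebesgue.1 t ht)).1
  simp only [sub_mul] at e2 e3
  rw [integral_sub i1 i2] at e3
  rw [integral_sub (integrable_mul_L2 (hm n 2) _) (integrable_mul_L2 hΨ _),
    integral_sub (integrable_mul_L2 (hm n 2) _) (integrable_mul_L2 hΨ _)] at e2
  rw [Real.norm_eq_abs] at e1 ⊢
  set a := ∫ x, ψ n x * u r x
  set b := ∫ x, ψ n x * u t x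
  set d := ∫ x, ψ n x * field s σ (u t) x
  set a' := ∫ x, Ψ x * u r x
  set b' := ∫ x, Ψ x * u t x
  set d' := ∫ x, Ψ x * field s σ (u t) x
  have e4 : ‖(r - t) • (d - d')‖ ≤ |r - t| * (K' * pairNorm σ fun x => ψ n x - Ψ x) := by
    rw [norm_smul, Real.norm_eq_abs]
    gcongr
  calc ‖a' - b' - (r - t) • d'‖
      = ‖(a - b - (r - t) • d) - (a - a' - (b - b')) + (r - t) • (d - d')‖ := by
        congr 1; rw [smul_sub]; ring
    _ ≤ c / 2 * |r - t| + (K * pairNorm σ fun x => ψ n x - Ψ x) * |r - t| +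
        |r - t| * (K' * pairNorm σ fun x => ψ n x - Ψ x) :=
        (norm_add_le _ _).trans (add_le_add ((norm_sub_le _ _).trans (add_le_add e1 e2)) e4)
    _ = (c / 2 + (K + K') * pairNorm σ fun x => ψ n x - Ψ x) * |r - t| := by ring
    _ ≤ c * |r - t| := by
        gcongr
        linarith

theorem conj_step_smul_bound (n : ℕ) : ∃ B, ∀ z : ℂ,
    ‖(starRingEnd ℂ) (step (1 / ((n : ℝ) + 1) * ‖z‖ ^ 2) • z)‖ ≤ B := by
  obtain ⟨B, hB⟩ := (contDiff_step_smul (1 / ((n : ℝ) + 1))).continuous.bounded_above_of_compact_support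
    (hasCompactSupport_step_smul (by positivity))
  exact ⟨B, fun z => by rw [RCLike.norm_conj]; exact hB z⟩

theorem norm_conj_step_smul_le (ε : ℝ) (z : ℂ) :
    ‖(starRingEnd ℂ) (step (ε * ‖z‖ ^ 2) • z)‖ ≤ ‖z‖ := by
  rw [RCLike.norm_conj, norm_smul]
  exact mul_le_of_le_one_left (norm_nonneg _) (abs_step_le _)

theorem memLp_conj_step_smul (ε : ℝ) (f : L2 N) :
    MemLp (fun x => (starRingEnd ℂ) (step (ε * ‖f x‖ ^ 2) • f x)) 2 volume := by
  refine (Lp.memLp f).mono ?_ (Eventually.of_forall fun x => norm_conj_step_smul_le ε _)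
  exact (Complex.continuous_conj.comp (contDiff_step_smul ε).continuous).comp_aestronglyMeasurable
    (Lp.aestronglyMeasurable f)

theorem tendsto_integral_conj_step_smul (f : L2 N) :
    Tendsto (fun n : ℕ => ∫ x, (starRingEnd ℂ) (step (1 / ((n : ℝ) + 1) * ‖f x‖ ^ 2) • f x) * f x)
      atTop (𝓝 ((‖f‖ ^ 2 : ℝ) : ℂ)) := by
  have h0 : ((‖f‖ ^ 2 : ℝ) : ℂ) = ∫ x, (starRingEnd ℂ) (f x) * f x := by
    rw [← inner_eq_integral, inner_self_eq_norm_sq_to_K]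
    norm_cast
  rw [h0]
  refine tendsto_integral_of_dominated_convergence (fun x => ‖(starRingEnd ℂ) (f x) * f x‖)
    (fun n => (integrable_mul_L2 (memLp_conj_step_smul _ f) f).1)
    (integrable_conj_mul f f).norm (fun n => Eventually.of_forall fun x => ?_)
    (Eventually.of_forall fun x => ?_)
  · rw [norm_mul, norm_mul, RCLike.norm_conj (f x)]
    gcongr
    exact norm_conj_step_smul_le _ _
  · have h := (tendsto_one_div_add_atTop_nhds_zero_nat (𝕜 := ℝ)).mul_const (‖f x‖ ^ 2)
    rw [zero_mul] at h
    refine tendsto_const_nhds.congr' ?_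
    filter_upwards [h.eventually_lt_const one_pos] with n hn
    rw [step_of_le hn.le, one_smul]

/-- With δ = u(r) - u(t), bounded truncations of conj δ are admissible in the Lipschitz bound.
Removing them gives ‖δ‖² ≤ K · pairNorm(δ) · |r - t|, and pairNorm(δ) → 0 by continuity in L² and
L^{2σ+2}. -/
theorem IsSolution.norm_sub_sq_isLittleO (hu : IsSolution s σ T u) (hs : 0 ≤ s) (hσ : 0 < σ)
    {t : ℝ} (ht : t ∈ timeInterval T) :
    (fun r => ‖u r - u t‖ ^ 2) =o[𝓝[timeInterval T] t] fun r => r - t := by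
  obtain ⟨ρ, hρ, K, hK, h⟩ := hu.exists_lipschitz_bound hs hσ ht
  have hcoe : ∀ r p, eLpNorm (u r - u t : L2 N) p volume =
      eLpNorm (fun x => u r x - u t x) p volume := fun r p => eLpNorm_congr_ae (Lp.coeFn_sub _ _)
  have h0 : Tendsto (fun r => pairNorm σ (u r - u t : L2 N)) (𝓝[timeInterval T] t) (𝓝 0) := by
    have e1 : Tendsto (fun r => ‖u r - u t‖) (𝓝[timeInterval T] t) (𝓝 0) :=
      tendsto_iff_norm_sub_tendsto_zero.1 (hu.continuousOn hs t ht)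
    have e2 := (ENNReal.tendsto_toReal ENNReal.zero_ne_top).comp (hu.lebesgue.2 t ht)
    have e3 := e1.add e2
    simp only [ENNReal.toReal_zero, add_zero] at e3
    refine e3.congr fun r => ?_
    simp only [pairNorm, hcoe, Lp.norm_def, Function.comp]
  rw [Asymptotics.isLittleO_iff]
  intro c hc
  have h1 := h0.const_mul K
  rw [mul_zero] at h1
  filter_upwards [h1.eventually_lt_const hc, self_mem_nhdsWithin,
    mem_nhdsWithin_of_mem_nhds (Metric.ball_mem_nhds t hρ)] with r e1 hr hrt
  rw [Metric.mem_ball, Real.dist_eq] at hrt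
  have hp : MemLp (u r - u t : L2 N) (ENNReal.ofReal (2 * σ + 2)) volume :=
    (memLp_congr_ae (Lp.coeFn_sub _ _)).2 ((hu.lebesgue.1 r hr).sub (hu.lebesgue.1 t ht))
  set δ := u r - u t with hδ
  have h2 : ∀ n : ℕ, ‖∫ x, (starRingEnd ℂ) (step (1 / ((n : ℝ) + 1) * ‖δ x‖ ^ 2) • δ x) * δ x‖ ≤
      K * pairNorm σ δ * |r - t| := by
    intro n
    obtain ⟨B, hB⟩ := conj_step_smul_bound n
    have hm := memLp_conj_step_smul (1 / ((n : ℝ) + 1)) δ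
    have e2 := h r hr hrt _ hm B fun x => hB _
    rw [← integral_sub (integrable_mul_L2 hm _) (integrable_mul_L2 hm _)] at e2
    have e3 : ∫ x, (starRingEnd ℂ) (step (1 / ((n : ℝ) + 1) * ‖δ x‖ ^ 2) • δ x) * δ x =
        ∫ x, (starRingEnd ℂ) (step (1 / ((n : ℝ) + 1) * ‖δ x‖ ^ 2) • δ x) * u r x -
          (starRingEnd ℂ) (step (1 / ((n : ℝ) + 1) * ‖δ x‖ ^ 2) • δ x) * u t x := by
      refine integral_congr_ae ?_
      filter_upwards [Lp.coeFn_sub (u r) (u t)] with x hx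
      rw [← mul_sub]
      congr 1
    rw [e3]
    refine e2.trans ?_
    gcongr
    exact pairNorm_mono (Lp.memLp δ) hp fun x => norm_conj_step_smul_le _ _
  have h3 := le_of_tendsto' (tendsto_integral_conj_step_smul δ).norm h2
  rw [Complex.norm_real] at h3
  refine h3.trans ?_
  rw [Real.norm_eq_abs]
  gcongr

/-! ### Time differentiation of the truncated solution. -/

/-- The complex linear part of a real linear map. -/
def linPart (A : ℂ →L[ℝ] ℂ) : ℂ := (A 1 - Complex.I * A Complex.I) / 2

/-- The complex antilinear part of a real linear map. -/
def antiPart (A : ℂ →L[ℝ] ℂ) : ℂ := (A 1 + Complex.I * A Complex.I) / 2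

theorem linPart_add_antiPart (A : ℂ →L[ℝ] ℂ) (d : ℂ) :
    linPart A * d + antiPart A * (starRingEnd ℂ) d = A d := by
  have h : A d = d.re • A 1 + d.im • A Complex.I := by
    rw [← map_smul, ← map_smul, ← map_add]
    congr 1
    simp [Complex.re_add_im]
  rw [h, linPart, antiPart, ← Complex.re_add_im d]
  simp only [map_add, map_mul, Complex.conj_ofReal, Complex.conj_I, Complex.real_smul,
    Complex.add_re, Complex.add_im, Complex.ofReal_re, Complex.ofReal_im, Complex.mul_re,
    Complex.mul_im, Complex.I_re, Complex.I_im]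
  push_cast
  linear_combination -(d.im : ℂ) * A Complex.I * Complex.I_mul_I

theorem norm_linPart_le (A : ℂ →L[ℝ] ℂ) : ‖linPart A‖ ≤ ‖A‖ := by
  have h1 := A.le_opNorm 1
  have h2 := A.le_opNorm Complex.I
  rw [norm_one, mul_one] at h1
  rw [Complex.norm_I, mul_one] at h2
  rw [linPart, norm_div, Complex.norm_ofNat, div_le_iff₀ two_pos]
  refine (norm_sub_le _ _).trans ?_
  rw [norm_mul, Complex.norm_I, one_mul]
  linarith

theorem norm_antiPart_le (A : ℂ →L[ℝ] ℂ) : ‖antiPart A‖ ≤ ‖A‖ := by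
  have h1 := A.le_opNorm 1
  have h2 := A.le_opNorm Complex.I
  rw [norm_one, mul_one] at h1
  rw [Complex.norm_I, mul_one] at h2
  rw [antiPart, norm_div, Complex.norm_ofNat, div_le_iff₀ two_pos]
  refine (norm_add_le _ _).trans ?_
  rw [norm_mul, Complex.norm_I, one_mul]
  linarith

/-- The derivative of the truncation is only real linear. Its antilinear part is handled by
conjugating, so that each of the two integrals pairs f complex linearly with a function fixed in
time. -/
theorem integral_test_smul_apply {ψ : E N → ℝ} {A : E N → ℂ →L[ℝ] ℂ} {f : E N → ℂ}
    (h1 : Integrable fun x => (ψ x : ℂ) * linPart (A x) * f x)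
    (h2 : Integrable fun x => (ψ x : ℂ) * (starRingEnd ℂ) (antiPart (A x)) * f x) :
    Integrable (fun x => ψ x • A x (f x)) ∧ ∫ x, ψ x • A x (f x) =
      (∫ x, (ψ x : ℂ) * linPart (A x) * f x) +
        (starRingEnd ℂ) (∫ x, (ψ x : ℂ) * (starRingEnd ℂ) (antiPart (A x)) * f x) := by
  have h3 : ∀ x, ψ x • A x (f x) = (ψ x : ℂ) * linPart (A x) * f x +
      (starRingEnd ℂ) ((ψ x : ℂ) * (starRingEnd ℂ) (antiPart (A x)) * f x) := by
    intro x
    rw [← linPart_add_antiPart (A x), Complex.real_smul]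
    simp only [map_mul, Complex.conj_ofReal, Complex.conj_conj]
    ring
  have h4 : Integrable fun x =>
      (starRingEnd ℂ) ((ψ x : ℂ) * (starRingEnd ℂ) (antiPart (A x)) * f x) :=
    (LinearIsometryEquiv.integrable_comp_iff Complex.conjLIE).2 h2
  simp only [h3]
  exact ⟨h1.add h4, by rw [integral_add h1 h4, integral_conj]⟩

namespace Truncation

variable {C : ℝ} (τ : Truncation σ C)

/-- The velocity of the truncated solution. -/
def velocity (s : ℝ) (f : L2 N) : L2 N :=
  nem τ.der f (-Complex.I • fracLaplacian s f) + Complex.I • nem τ.pow f f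

/-- By gauge equivariance the derivative maps i|f|^{2σ}f to i times the truncated power. So the
image of the field lies in L², even if the field does not. -/
theorem velocity_ae_eq (s : ℝ) (f : L2 N) :
    τ.velocity s f =ᵐ[volume] fun x => τ.der (f x) (field s σ f x) := by
  filter_upwards [Lp.coeFn_add (nem τ.der f (-Complex.I • fracLaplacian s f))
      (Complex.I • nem τ.pow f f), Lp.coeFn_smul Complex.I (nem τ.pow f f),
    coeFn_nem τ.der f (-Complex.I • fracLaplacian s f), coeFn_nem τ.pow f f,
    Lp.coeFn_smul (-Complex.I) (fracLaplacian s f)] with x h1 h2 h3 h4 h5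
  rw [velocity, h1, Pi.add_apply, h2, Pi.smul_apply, h3, h4, h5, Pi.smul_apply, field, map_add,
    power, mul_smul_comm,
    (τ.der (f x)).map_smul, τ.der_I, τ.pow_apply, smul_eq_mul, smul_eq_mul, mul_smul_comm]

/-- The evolution of the truncated solution, in the sense of distributions. -/
theorem hasDerivWithinAt_test (hu : IsSolution s σ T u) (hs : 0 ≤ s) (hσ : 0 < σ)
    {ψ : E N → ℝ} (hψ : IsTest ψ) {t : ℝ} (ht : t ∈ timeInterval T) :
    HasDerivWithinAt (fun r => ∫ x, ψ x • τ.trunc (u r) x) (∫ x, ψ x • τ.velocity s (u t) x)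
      (timeInterval T) t := by
  obtain ⟨B, hB⟩ := hψ.continuous.bounded_above_of_compact_support hψ.2
  obtain ⟨L, hL⟩ := τ.taylor
  have hB0 : 0 ≤ B := (norm_nonneg _).trans (hB 0)
  -- The derivative of the truncation is frozen at time t, so its linear and antilinear coefficients
  -- become bounded L² functions, independent of r, once multiplied by ψ.
  set A : E N → ℂ →L[ℝ] ℂ := fun x => τ.der (u t x) with hA
  have hAm : AEStronglyMeasurable A :=
    τ.der.continuous.comp_aestronglyMeasurable (Lp.aestronglyMeasurable (u t))
  have hlin : Continuous linPart := by unfold linPart; fun_prop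
  have hanti : Continuous antiPart := by unfold antiPart; fun_prop
  set Ψ₁ : E N → ℂ := fun x => (ψ x : ℂ) * linPart (A x) with hΨ₁
  set Ψ₂ : E N → ℂ := fun x => (ψ x : ℂ) * (starRingEnd ℂ) (antiPart (A x)) with hΨ₂
  have hψ2 := hψ.memLp_ofReal 2
  have e1 : ∀ x, ‖Ψ₁ x‖ ≤ ‖τ.der‖ * ‖(ψ x : ℂ)‖ := fun x => by
    rw [norm_mul, mul_comm]
    gcongr
    exact (norm_linPart_le _).trans (τ.der.norm_coe_le_norm _)
  have e2 : ∀ x, ‖Ψ₂ x‖ ≤ ‖τ.der‖ * ‖(ψ x : ℂ)‖ := fun x => by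
    rw [norm_mul, mul_comm, RCLike.norm_conj]
    gcongr
    exact (norm_antiPart_le _).trans (τ.der.norm_coe_le_norm _)
  have m1 : MemLp Ψ₁ 2 volume := hψ2.of_le_mul (hψ2.1.mul (hlin.comp_aestronglyMeasurable hAm))
    (Eventually.of_forall e1)
  have m2 : MemLp Ψ₂ 2 volume := hψ2.of_le_mul (hψ2.1.mul
    ((Complex.continuous_conj.comp hanti).comp_aestronglyMeasurable hAm)) (Eventually.of_forall e2)
  have b1 : ∀ x, ‖Ψ₁ x‖ ≤ ‖τ.der‖ * B := fun x => (e1 x).trans (by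
    rw [Complex.norm_real]; gcongr; exact hB x)
  have b2 : ∀ x, ‖Ψ₂ x‖ ≤ ‖τ.der‖ * B := fun x => (e2 x).trans (by
    rw [Complex.norm_real]; gcongr; exact hB x)
  have hg : HasDerivWithinAt (fun r => ∫ x, ψ x • A x (u r x)) (∫ x, ψ x • τ.velocity s (u t) x)
      (timeInterval T) t := by
    have h1 := (hu.hasDerivWithinAt_bounded hs hσ m1 b1 ht).add
      (Complex.conjCLE.hasFDerivAt.comp_hasDerivWithinAt t
        (hu.hasDerivWithinAt_bounded hs hσ m2 b2 ht))
    have h2 : ∫ x, ψ x • τ.velocity s (u t) x = ∫ x, ψ x • A x (field s σ (u t) x) := by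
      refine integral_congr_ae ?_
      filter_upwards [τ.velocity_ae_eq s (u t)] with x hx
      rw [hx]
    have h3 := fun f : L2 N =>
      (integral_test_smul_apply (integrable_mul_L2 m1 f) (integrable_mul_L2 m2 f)).2
    have hp := hu.lebesgue.1 t ht
    have h4 := (integral_test_smul_apply
      (integral_mul_field (s := s) hσ m1 (memLp_of_bounded (by linarith) m1 b1) hp).1
      (integral_mul_field (s := s) hσ m2 (memLp_of_bounded (by linarith) m2 b2) hp).1).2
    rw [h2, h4]
    simp only [h3]
    exact h1
  have hint := fun r => hψ.integrable_smul (locallyIntegrable_L2 (τ.trunc (u r)))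
  have hint' := fun r =>
    (integral_test_smul_apply (integrable_mul_L2 m1 (u r)) (integrable_mul_L2 m2 (u r))).1
  -- The difference from the linearization is bounded by the quadratic Taylor remainder, hence by a
  -- multiple of ‖u(r) - u(t)‖², which is o(r - t).
  have hrem : HasDerivWithinAt (fun r => (∫ x, ψ x • τ.trunc (u r) x) - ∫ x, ψ x • A x (u r x)) 0
      (timeInterval T) t := by
    rw [hasDerivWithinAt_iff_isLittleO]
    have hbig : (fun r => (∫ x, ψ x • τ.trunc (u r) x) - (∫ x, ψ x • A x (u r x)) -
        ((∫ x, ψ x • τ.trunc (u t) x) - ∫ x, ψ x • A x (u t x)) - (r - t) • (0 : ℂ))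
        =O[𝓝[timeInterval T] t] fun r => ‖u r - u t‖ ^ 2 := by
      refine Asymptotics.IsBigO.of_bound (B * L) (Eventually.of_forall fun r => ?_)
      have hi : ∀ r, Integrable fun x => ψ x • τ.trunc (u r) x - ψ x • A x (u r x) :=
        fun r => (hint r).sub (hint' r)
      rw [smul_zero, sub_zero, ← integral_sub (hint r) (hint' r),
        ← integral_sub (hint t) (hint' t), ← integral_sub (hi r) (hi t), Real.norm_of_nonneg (by positivity), norm_sq_eq_integral,
        ← integral_const_mul]
      refine norm_integral_le_of_norm_le ((Lp.memLp _).norm.integrable_sq.const_mul _) ?_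
      filter_upwards [coeFn_nem τ.cut (u r) (u r), coeFn_nem τ.cut (u t) (u t),
        Lp.coeFn_sub (u r) (u t)] with x h1 h2 h3
      rw [trunc, trunc, h1, h2, h3, Pi.sub_apply, mul_assoc]
      have h4 := hL (u t x) (u r x - u t x)
      rw [add_sub_cancel] at h4
      calc _ = ‖ψ x • (τ.cut (u r x) (u r x) - τ.cut (u t x) (u t x) -
              τ.der (u t x) (u r x - u t x))‖ := by
            congr 1
            simp only [hA, map_sub, smul_sub]
            abel
        _ ≤ _ := by
            rw [norm_smul]
            exact mul_le_mul (hB x) h4 (norm_nonneg _) hB0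
    exact hbig.trans_isLittleO (hu.norm_sub_sq_isLittleO hs hσ ht)
  have := hrem.fun_add hg
  simpa only [sub_add_cancel, zero_add] using this

theorem continuousOn_velocity (hu : IsSolution s σ T u) (hs : 0 ≤ s) :
    ContinuousOn (fun t => τ.velocity s (u t)) (timeInterval T) := by
  have h1 := hu.continuousOn hs
  have h2 := hu.continuousOn_fracLaplacian hs
  have h5 : Continuous fun w : L2 N => -Complex.I • w := continuous_const_smul _
  have h6 : Continuous fun w : L2 N => Complex.I • w := continuous_const_smul _
  have h7 := h5.comp_continuousOn h2
  have h3 := (continuous_nem τ.der).comp_continuousOn (h1.prodMk h7)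
  have h4 := h6.comp_continuousOn ((continuous_nem τ.pow).comp_continuousOn (h1.prodMk h1))
  exact h3.add h4

theorem continuous_trunc : Continuous (τ.trunc : L2 N → L2 N) :=
  (continuous_nem τ.cut).comp (continuous_id.prodMk continuous_id)

/-- The scalar fundamental theorem of calculus holds against every test function, and the velocity
is continuous into L², so the Bochner integral has the same pairings. Test functions then determine
the identity. -/
theorem trunc_sub_trunc (hu : IsSolution s σ T u) (hs : 0 ≤ s) (hσ : 0 < σ) {a b : ℝ}
    (ha : a ∈ timeInterval T) (hb : b ∈ timeInterval T) (hab : a ≤ b) :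
    τ.trunc (u b) - τ.trunc (u a) = ∫ r in a..b, τ.velocity s (u r) := by
  have hsub : Icc a b ⊆ timeInterval T := (ordConnected_timeInterval T).out ha hb
  have hV := (τ.continuousOn_velocity hu hs).mono hsub
  have hVi : IntervalIntegrable (fun r => τ.velocity s (u r)) volume a b :=
    ContinuousOn.intervalIntegrable (by rwa [uIcc_of_le hab])
  have hU := τ.continuous_trunc.comp_continuousOn ((hu.continuousOn hs).mono hsub)
  apply Lp.ext
  refine ae_eq_of_integral_contDiff_smul_eq (locallyIntegrable_L2 _) (locallyIntegrable_L2 _)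
    fun ψ hψ hψs => ?_
  have hψt : IsTest ψ := ⟨hψ, hψs⟩
  rw [← inner_testL2 hψt, ← inner_testL2 hψt, inner_sub_right]
  have h1 := intervalIntegral.integral_eq_sub_of_hasDeriv_right_of_le hab
    (f := fun r => inner ℂ (testL2 ψ hψt) (τ.trunc (u r)))
    (f' := fun r => inner ℂ (testL2 ψ hψt) (τ.velocity s (u r)))
    (continuousOn_const.inner hU) (fun r hr => ?_)
    (ContinuousOn.intervalIntegrable (by
      rw [uIcc_of_le hab]; exact continuousOn_const.inner hV))
  · rw [← h1]
    exact ((innerSL ℂ (testL2 ψ hψt)).intervalIntegral_comp_comm hVi)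
  · have h2 := τ.hasDerivWithinAt_test hu hs hσ hψt (hsub (Ioo_subset_Icc_self hr))
    simp only [← inner_testL2 hψt] at h2
    have h3 : timeInterval T ∈ 𝓝 r := Filter.mem_of_superset (Icc_mem_nhds hr.1 hr.2) hsub
    exact (h2.hasDerivAt h3).hasDerivWithinAt

theorem hasDerivAt_trunc (hu : IsSolution s σ T u) (hs : 0 ≤ s) (hσ : 0 < σ) {a b : ℝ}
    (ha : a ∈ timeInterval T) (hb : b ∈ timeInterval T) {t : ℝ} (ht : t ∈ Ioo a b) :
    HasDerivAt (fun r => τ.trunc (u r)) (τ.velocity s (u t)) t := by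
  have hsub : Icc a b ⊆ timeInterval T := (ordConnected_timeInterval T).out ha hb
  have hV := (τ.continuousOn_velocity hu hs).mono hsub
  have hV' := hV.mono Ioo_subset_Icc_self
  have h1 : HasDerivAt (fun r => ∫ y in a..r, τ.velocity s (u y)) (τ.velocity s (u t)) t := by
    refine intervalIntegral.integral_hasDerivAt_right ?_
      (hV'.stronglyMeasurableAtFilter isOpen_Ioo t ht) (hV'.continuousAt (Ioo_mem_nhds ht.1 ht.2))
    refine ContinuousOn.intervalIntegrable (hV.mono ?_)
    rw [uIcc_of_le ht.1.le]
    exact Icc_subset_Icc_right ht.2.le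
  refine (h1.const_add (τ.trunc (u a))).congr_of_eventuallyEq ?_
  filter_upwards [Ioo_mem_nhds ht.1 ht.2] with r hr
  rw [← τ.trunc_sub_trunc hu hs hσ ha (hsub (Ioo_subset_Icc_self hr)) hr.1.le]
  abel

end Truncation

/-! ### Differentiation of Im⟨q, Aq⟩. -/

/-- Antisymmetry writes the increment as Im⟨q(r) - q(t), A q(r)⟩ + Im⟨q(r) - q(t), A q(t)⟩. Only the
L² component needs a derivative; for the gradient, continuity is enough. -/
theorem hasDerivAt_im_inner_gen {φ : E N → ℝ} (hφ : GradMemWInfty 3 φ)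
    {q : ℝ → L2 N × (Fin N → L2 N)} {V : L2 N} {t : ℝ} (hq : ∀ᶠ r in 𝓝 t, q r ∈ gradGraph N)
    (hc : ContinuousAt q t) (hd : HasDerivAt (fun r => (q r).1) V t) :
    HasDerivAt (fun r => (inner ℂ (q r).1 (gen hφ (q r))).im)
      (2 * (inner ℂ V (gen hφ (q t))).im) t := by
  rw [hasDerivAt_iff_tendsto_slope] at hd ⊢
  have hg : Tendsto (fun r => gen hφ (q r)) (𝓝[≠] t) (𝓝 (gen hφ (q t))) :=
    ((continuous_gen hφ).continuousAt.comp hc).tendsto.mono_left nhdsWithin_le_nhds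
  have h1 := (Complex.continuous_im.tendsto _).comp (hd.inner (𝕜 := ℂ) hg)
  have h2 := (Complex.continuous_im.tendsto _).comp
    (hd.inner (𝕜 := ℂ) (tendsto_const_nhds (x := gen hφ (q t))))
  rw [two_mul]
  refine (h1.add h2).congr' ?_
  filter_upwards [nhdsWithin_le_nhds hq] with r hr
  have hqt := hq.self_of_nhds
  have e1 : (inner ℂ (q t).1 (gen hφ (q r))).im - (inner ℂ (q t).1 (gen hφ (q t))).im =
      (inner ℂ ((q r).1 - (q t).1) (gen hφ (q t))).im := by
    rw [inner_gen hφ hqt hr, inner_gen hφ hqt hqt, ← inner_conj_symm _ (gen hφ (q t)),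
      inner_sub_right, map_sub]
    simp only [Complex.neg_im, Complex.sub_im, Complex.conj_im]
  have e2 : (inner ℂ (q r).1 (gen hφ (q r))).im - (inner ℂ (q t).1 (gen hφ (q t))).im =
      (inner ℂ ((q r).1 - (q t).1) (gen hφ (q r))).im +
        (inner ℂ ((q r).1 - (q t).1) (gen hφ (q t))).im := by
    rw [← e1, inner_sub_left, Complex.sub_im]
    ring
  simp only [Function.comp, slope_def_module]
  rw [e2, smul_eq_mul, mul_add]
  have e3 : ∀ x y : L2 N, (inner ℂ ((r - t)⁻¹ • x) y).im = (r - t)⁻¹ * (inner ℂ x y).im := by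
    intro x y
    rw [inner_smul_left_eq_smul, Complex.smul_im, smul_eq_mul]
  rw [e3, e3]

/-! ### Continuity in time of the weighted potential energy. -/

theorem integral_rpow_norm_eq {q : ℝ} (hq : 0 < q) {f : E N → ℂ}
    (hf : MemLp f (ENNReal.ofReal q) volume) :
    (eLpNorm f (ENNReal.ofReal q) volume).toReal ^ q = ∫ x, ‖f x‖ ^ q := by
  rw [hf.eLpNorm_eq_integral_rpow_norm (by simpa using hq) ENNReal.ofReal_ne_top,
    ENNReal.toReal_ofReal hq.le, ENNReal.toReal_ofReal (by positivity),
    Real.rpow_inv_rpow (by positivity) hq.ne']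

theorem integrable_rpow_norm (hσ : 0 < σ) {f : E N → ℂ}
    (hf : MemLp f (ENNReal.ofReal (2 * σ + 2)) volume) :
    Integrable fun x => ‖f x‖ ^ (2 * σ + 2) := by
  have h0 : 0 < 2 * σ + 2 := by linarith
  have := hf.integrable_norm_rpow (by simpa using h0) ENNReal.ofReal_ne_top
  rwa [ENNReal.toReal_ofReal h0.le] at this

theorem integrable_mul_rpow_norm (hσ : 0 < σ) {c : E N → ℝ} (hc : MemLp c ∞ volume) {f : E N → ℂ}
    (hf : MemLp f (ENNReal.ofReal (2 * σ + 2)) volume) :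
    Integrable fun x => c x * ‖f x‖ ^ (2 * σ + 2) :=
  (integrable_rpow_norm hσ hf).mul_of_top_right hc

/-- For c ≥ 0 and q = 2σ + 2 the integral is the q-th power of the L^q norm of c^{1/q} u, and
multiplication by the bounded function c^{1/q} is continuous on L^q. -/
theorem IsSolution.continuousOn_integral_nonneg_mul (hu : IsSolution s σ T u) (hσ : 0 < σ)
    {c : E N → ℝ} (hc : MemLp c ∞ volume) (h0 : ∀ x, 0 ≤ c x) :
    ContinuousOn (fun t => ∫ x, c x * ‖u t x‖ ^ (2 * σ + 2)) (timeInterval T) := by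
  have hq : 0 < 2 * σ + 2 := by linarith
  set d : E N → ℝ := fun x => ‖c x‖ ^ (2 * σ + 2)⁻¹ with hd
  have hdm : MemLp d ∞ volume := by
    refine ⟨(hc.1.norm.aemeasurable.pow_const _).aestronglyMeasurable, ?_⟩
    rw [eLpNorm_norm_rpow _ (by positivity), ENNReal.top_mul (by simpa using hq)]
    exact ENNReal.rpow_lt_top_of_nonneg (by positivity) hc.eLpNorm_ne_top
  have hm : ∀ f : E N → ℂ, MemLp f (ENNReal.ofReal (2 * σ + 2)) volume →
      MemLp (d • f) (ENNReal.ofReal (2 * σ + 2)) volume := fun f hf => hf.smul hdm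
  have h1 : ∀ f : E N → ℂ, MemLp f (ENNReal.ofReal (2 * σ + 2)) volume →
      ∫ x, c x * ‖f x‖ ^ (2 * σ + 2) =
        (eLpNorm (d • f) (ENNReal.ofReal (2 * σ + 2)) volume).toReal ^ (2 * σ + 2) := by
    intro f hf
    rw [integral_rpow_norm_eq hq (hm f hf)]
    refine integral_congr_ae (Eventually.of_forall fun x => ?_)
    simp only [Pi.smul_apply', norm_smul, hd]
    rw [Real.mul_rpow (by positivity) (norm_nonneg _), Real.norm_of_nonneg (by positivity),
      Real.rpow_inv_rpow (norm_nonneg _) hq.ne', Real.norm_of_nonneg (h0 x)]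
  have : Fact (1 ≤ ENNReal.ofReal (2 * σ + 2)) := ⟨one_le_power_exponent hσ⟩
  intro t ht
  have hlim : Tendsto (fun r => (eLpNorm (d • (u r : E N → ℂ)) (ENNReal.ofReal (2 * σ + 2))
      volume).toReal) (𝓝[timeInterval T] t)
      (𝓝 (eLpNorm (d • (u t : E N → ℂ)) (ENNReal.ofReal (2 * σ + 2)) volume).toReal) := by
    rw [tendsto_iff_norm_sub_tendsto_zero]
    have h2 := ((ENNReal.tendsto_toReal ENNReal.zero_ne_top).comp (hu.lebesgue.2 t ht)).const_mul
      (eLpNorm d ∞ volume).toReal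
    rw [ENNReal.toReal_zero, mul_zero] at h2
    refine squeeze_zero' (Eventually.of_forall fun _ => norm_nonneg _) ?_ h2
    filter_upwards [self_mem_nhdsWithin] with r hr
    have m1 := hm _ (hu.lebesgue.1 r hr)
    have m2 := hm _ (hu.lebesgue.1 t ht)
    rw [← Lp.norm_toLp _ m1, ← Lp.norm_toLp _ m2, Real.norm_eq_abs]
    refine (abs_norm_sub_norm_le _ _).trans ?_
    rw [← MemLp.toLp_sub, Lp.norm_toLp, ← smul_sub]
    have h3 := (hu.lebesgue.1 r hr).sub (hu.lebesgue.1 t ht)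
    have h4 := eLpNorm_smul_le_eLpNorm_top_mul_eLpNorm (ENNReal.ofReal (2 * σ + 2)) h3.1 d
    refine (ENNReal.toReal_mono (ENNReal.mul_ne_top hdm.eLpNorm_ne_top h3.eLpNorm_ne_top)
      h4).trans (le_of_eq ?_)
    rw [ENNReal.toReal_mul]
    rfl
  have h5 := hlim.rpow_const (p := 2 * σ + 2) (Or.inr hq.le)
  rw [ContinuousWithinAt, h1 _ (hu.lebesgue.1 t ht)]
  refine h5.congr' ?_
  filter_upwards [self_mem_nhdsWithin] with r hr
  rw [h1 _ (hu.lebesgue.1 r hr)]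

theorem IsSolution.continuousOn_integral_mul (hu : IsSolution s σ T u) (hσ : 0 < σ)
    {c : E N → ℝ} (hc : MemLp c ∞ volume) :
    ContinuousOn (fun t => ∫ x, c x * ‖u t x‖ ^ (2 * σ + 2)) (timeInterval T) := by
  -- A signed weight is the difference of the nonnegative bounded weights c + |c| and |c|.
  have hc1 : MemLp (fun x => c x + |c x|) ∞ volume := hc.add hc.abs
  have hc2 : MemLp (fun x => |c x|) ∞ volume := hc.abs
  refine ((hu.continuousOn_integral_nonneg_mul hσ hc1 fun x => by linarith [neg_abs_le (c x)]).sub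
    (hu.continuousOn_integral_nonneg_mul hσ hc2 fun x => abs_nonneg _)).congr fun t ht => ?_
  have hp := hu.lebesgue.1 t ht
  rw [Pi.sub_apply, ← integral_sub (integrable_mul_rpow_norm hσ hc1 hp)
    (integrable_mul_rpow_norm hσ hc2 hp)]
  refine integral_congr_ae (Eventually.of_forall fun x => ?_)
  dsimp only
  ring

/-! ### Removal of the truncation. -/

namespace Truncation

variable {C : ℝ}

theorem norm_nem_le_of_le {Φ : ℂ →ᵇ (ℂ →L[ℝ] ℂ)} (h : ∀ z v, ‖Φ z v‖ ≤ C * ‖v‖) (f g : L2 N) :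
    ‖nem Φ f g‖ ≤ C * ‖g‖ := by
  refine Lp.norm_le_mul_norm_of_ae_le_mul ?_
  filter_upwards [coeFn_nem Φ f g] with x hx
  rw [hx]
  exact h _ _

theorem tendsto_nem_of_eventually_id {Φ : ℕ → ℂ →ᵇ (ℂ →L[ℝ] ℂ)}
    (h : ∀ n z v, ‖Φ n z v‖ ≤ C * ‖v‖)
    (h' : ∀ z, ∀ᶠ n in atTop, Φ n z = ContinuousLinearMap.id ℝ ℂ) (f g : L2 N) :
    Tendsto (fun n => nem (Φ n) f g) atTop (𝓝 g) := by
  refine tendsto_L2_of_dominated ((Lp.memLp g).norm.const_mul C) (fun n => ?_) ?_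
  · filter_upwards [coeFn_nem (Φ n) f g] with x hx
    rw [hx]
    exact h _ _ _
  · filter_upwards [ae_all_iff.2 fun n => coeFn_nem (Φ n) f g] with x hx
    simp only [hx]
    refine tendsto_const_nhds.congr' ?_
    filter_upwards [h' (f x)] with n hn
    rw [hn, ContinuousLinearMap.id_apply]

theorem abs_pot_sub_le (τ : Truncation σ C) (hσ : 0 < σ) (z : ℂ) :
    |τ.pot z - ‖z‖ ^ (2 * σ) * ‖τ.cut z z‖ ^ 2| ≤ (C + C ^ 2) * ‖z‖ ^ (2 * σ + 2) := by
  refine (abs_sub _ _).trans ?_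
  rw [add_mul, abs_of_nonneg (by positivity : 0 ≤ ‖z‖ ^ (2 * σ) * ‖τ.cut z z‖ ^ 2)]
  refine add_le_add (τ.abs_pot_le z) ?_
  rw [Real.rpow_add_of_nonneg (norm_nonneg _) (by positivity) zero_le_two, Real.rpow_two]
  calc _ ≤ ‖z‖ ^ (2 * σ) * (C * ‖z‖) ^ 2 := by
        gcongr
        exact τ.norm_cut_le z z
    _ = _ := by ring

theorem norm_integral_pot_le (τ : Truncation σ C) (hσ : 0 < σ) {c : E N → ℝ}
    (hc : MemLp c ∞ volume) {f : E N → ℂ} (hf : MemLp f (ENNReal.ofReal (2 * σ + 2)) volume) :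
    |∫ x, c x * (τ.pot (f x) - ‖f x‖ ^ (2 * σ) * ‖τ.cut (f x) (f x)‖ ^ 2)| ≤
      (C + C ^ 2) * ∫ x, |c x| * ‖f x‖ ^ (2 * σ + 2) := by
  rw [← integral_const_mul, ← Real.norm_eq_abs]
  refine norm_integral_le_of_norm_le ((integrable_mul_rpow_norm hσ hc.abs hf).const_mul _)
    (Eventually.of_forall fun x => ?_)
  rw [norm_mul, Real.norm_eq_abs, Real.norm_eq_abs, mul_left_comm]
  exact mul_le_mul_of_nonneg_left (τ.abs_pot_sub_le hσ _) (abs_nonneg _)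

/-- At each point the integrand is eventually constant in n, and 1/(σ+1) - 1 = -σ/(σ+1). Domination
comes from the constant C shared by all truncations. -/
theorem tendsto_integral_pot {τ : ℕ → Truncation σ C} (hσ : 0 < σ)
    (hτ : ∀ z : ℂ, ∀ᶠ n in atTop, (τ n).cut z = ContinuousLinearMap.id ℝ ℂ ∧
      (τ n).der z = ContinuousLinearMap.id ℝ ℂ ∧ (τ n).pot z = ‖z‖ ^ (2 * σ + 2) / (σ + 1))
    {c : E N → ℝ} (hc : MemLp c ∞ volume) {f : L2 N}
    (hf : MemLp f (ENNReal.ofReal (2 * σ + 2)) volume) :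
    Tendsto (fun n => ∫ x, c x *
      ((τ n).pot (f x) - ‖f x‖ ^ (2 * σ) * ‖(τ n).cut (f x) (f x)‖ ^ 2)) atTop
      (𝓝 (-(σ / (σ + 1)) * ∫ x, c x * ‖f x‖ ^ (2 * σ + 2))) := by
  rw [← integral_const_mul]
  refine tendsto_integral_of_dominated_convergence
    (fun x => (C + C ^ 2) * (|c x| * ‖f x‖ ^ (2 * σ + 2))) (fun n => ?_)
    ((integrable_mul_rpow_norm hσ hc.abs hf).const_mul _)
    (fun n => Eventually.of_forall fun x => ?_) (Eventually.of_forall fun x => ?_)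
  · have h1 := ((τ n).integrable_pot f).1
    have h2 : AEStronglyMeasurable (fun x => (τ n).cut (f x) (f x)) := (nem_aux (τ n).cut f f).1
    have h3 : AEStronglyMeasurable (fun x => ‖f x‖ ^ (2 * σ)) :=
      (((Lp.aestronglyMeasurable f).norm.aemeasurable).pow_const _).aestronglyMeasurable
    exact hc.1.mul (h1.sub (h3.mul (h2.norm.pow 2)))
  · rw [norm_mul, Real.norm_eq_abs, Real.norm_eq_abs, mul_left_comm]
    exact mul_le_mul_of_nonneg_left ((τ n).abs_pot_sub_le hσ _) (abs_nonneg _)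
  · refine tendsto_const_nhds.congr' ?_
    filter_upwards [hτ (f x)] with n hn
    rw [hn.1, hn.2.2, ContinuousLinearMap.id_apply,
      Real.rpow_add_of_nonneg (norm_nonneg _) (by positivity) zero_le_two, Real.rpow_two]
    field_simp
    ring

end Truncation

/-- The right-hand side of the virial identity, with its dispersive part in commutator form. -/
def virialRate (s σ : ℝ) {φ : E N → ℝ} (hφ : GradMemWInfty 3 φ) (p : L2 N × (Fin N → L2 N)) : ℝ :=
  2 * (inner ℂ (fracLaplacian s p.1) (gen hφ p)).re -
    2 * σ / (σ + 1) * ∫ x, weakLaplacian φ x * ‖p.1 x‖ ^ (2 * σ + 2)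

theorem IsSolution.continuousOn_virialRate (hu : IsSolution s σ T u) (hs : 0 ≤ s) (hσ : 0 < σ)
    {φ : E N → ℝ} (hφ : GradMemWInfty 3 φ) {D : ℝ → Fin N → L2 N}
    (hD : ContinuousOn D (timeInterval T)) :
    ContinuousOn (fun t => virialRate s σ hφ (u t, D t)) (timeInterval T) := by
  have h1 := (continuous_gen hφ).comp_continuousOn ((hu.continuousOn hs).prodMk hD)
  have h2 := Complex.continuous_re.comp_continuousOn ((hu.continuousOn_fracLaplacian hs).inner
    (𝕜 := ℂ) h1)
  exact (continuousOn_const.mul h2).sub (continuousOn_const.mul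
    (hu.continuousOn_integral_mul hσ hφ.weakLaplacian.memLp))

theorem norm_gen_le {φ : E N → ℝ} (hφ : GradMemWInfty 3 φ) (p : L2 N × (Fin N → L2 N)) :
    ‖gen hφ p‖ ≤ 2 * ∑ k, ‖mulR (weakPartial k φ) (hφ.weakPartial k).memLp‖ * ‖p.2 k‖ +
      ‖mulR (weakLaplacian φ) hφ.weakLaplacian.memLp‖ * ‖p.1‖ := by
  refine (norm_add_le _ _).trans (add_le_add ?_ (ContinuousLinearMap.le_opNorm _ _))
  rw [norm_smul, Complex.norm_ofNat]
  gcongr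
  exact (norm_sum_le _ _).trans (Finset.sum_le_sum fun k _ => ContinuousLinearMap.le_opNorm _ _)

namespace Truncation

variable {C : ℝ} (τ : Truncation σ C)

/-- Since the inner product is conjugate linear on the left, the factor i of the nonlinear velocity
turns the imaginary part into minus the real part computed in `re_inner_pow_gen`. -/
theorem two_mul_im_inner_velocity {φ : E N → ℝ} (hφ : GradMemWInfty 3 φ)
    {p : L2 N × (Fin N → L2 N)} (hp : p ∈ gradGraph N) :
    2 * (inner ℂ (τ.velocity s p.1) (gen hφ (τ.truncH1 p))).im =
      2 * (inner ℂ (nem τ.der p.1 (-Complex.I • fracLaplacian s p.1)) (gen hφ (τ.truncH1 p))).im +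
      2 * ∫ x, weakLaplacian φ x *
        (τ.pot (p.1 x) - ‖p.1 x‖ ^ (2 * σ) * ‖τ.cut (p.1 x) (p.1 x)‖ ^ 2) := by
  have h := τ.re_inner_pow_gen hφ hp
  rw [velocity, inner_add_left, inner_smul_left, Complex.conj_I, Complex.add_im, Complex.mul_im]
  simp only [Complex.neg_re, Complex.neg_im, Complex.I_re, Complex.I_im]
  linarith

theorem virial_trunc_sub (hu : IsSolution s σ T u) (hs : 0 ≤ s) (hσ : 0 < σ)
    {φ : E N → ℝ} (hφ : GradMemWInfty 3 φ) {D : ℝ → Fin N → L2 N}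
    (hD : ContinuousOn D (timeInterval T))
    (hG : ∀ t ∈ timeInterval T, (u t, D t) ∈ gradGraph N) {a b : ℝ}
    (ha : a ∈ timeInterval T) (hb : b ∈ timeInterval T) (hab : a ≤ b) :
    ContinuousOn (fun t =>
        2 * (inner ℂ (τ.velocity s (u t)) (gen hφ (τ.truncH1 (u t, D t)))).im) (Icc a b) ∧
      ∫ t in a..b, 2 * (inner ℂ (τ.velocity s (u t)) (gen hφ (τ.truncH1 (u t, D t)))).im =
        (inner ℂ (τ.truncH1 (u b, D b)).1 (gen hφ (τ.truncH1 (u b, D b)))).im -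
        (inner ℂ (τ.truncH1 (u a, D a)).1 (gen hφ (τ.truncH1 (u a, D a)))).im := by
  have hsub : Icc a b ⊆ timeInterval T := (ordConnected_timeInterval T).out ha hb
  have hq : ContinuousOn (fun t => τ.truncH1 (u t, D t)) (Icc a b) :=
    τ.continuous_truncH1.comp_continuousOn (((hu.continuousOn hs).prodMk hD).mono hsub)
  have hg := (continuous_gen hφ).comp_continuousOn hq
  have hV := (τ.continuousOn_velocity hu hs).mono hsub
  have hc := continuousOn_const (c := (2 : ℝ)).mul
    (Complex.continuous_im.comp_continuousOn (hV.inner (𝕜 := ℂ) hg))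
  refine ⟨hc, ?_⟩
  refine intervalIntegral.integral_eq_sub_of_hasDerivAt_of_le hab
    (f := fun t => (inner ℂ (τ.truncH1 (u t, D t)).1 (gen hφ (τ.truncH1 (u t, D t)))).im)
    (Complex.continuous_im.comp_continuousOn
      ((continuous_fst.comp_continuousOn hq).inner (𝕜 := ℂ) hg)) (fun t ht => ?_)
    (ContinuousOn.intervalIntegrable (by rwa [uIcc_of_le hab]))
  have hn := Icc_mem_nhds ht.1 ht.2
  refine hasDerivAt_im_inner_gen hφ (q := fun t => τ.truncH1 (u t, D t)) ?_
    (hq.continuousAt hn) (τ.hasDerivAt_trunc hu hs hσ ha hb ht)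
  filter_upwards [hn] with r hr
  exact τ.truncH1_mem (hG r (hsub hr))

end Truncation

theorem tendsto_truncH1 {C : ℝ} {τ : ℕ → Truncation σ C}
    (hτ : ∀ z : ℂ, ∀ᶠ n in atTop, (τ n).cut z = ContinuousLinearMap.id ℝ ℂ ∧
      (τ n).der z = ContinuousLinearMap.id ℝ ℂ ∧ (τ n).pot z = ‖z‖ ^ (2 * σ + 2) / (σ + 1))
    (p : L2 N × (Fin N → L2 N)) : Tendsto (fun n => (τ n).truncH1 p) atTop (𝓝 p) := by
  refine Tendsto.prodMk_nhds (Truncation.tendsto_nem_of_eventually_id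
    (fun n => (τ n).norm_cut_le) (fun z => (hτ z).mono fun n h => h.1) _ _)
    (tendsto_pi_nhds.2 fun k => Truncation.tendsto_nem_of_eventually_id
    (fun n => (τ n).norm_der_le) (fun z => (hτ z).mono fun n h => h.2.1) _ _)

theorem tendsto_virialRate {C : ℝ} {τ : ℕ → Truncation σ C} (hσ : 0 < σ)
    (hτ : ∀ z : ℂ, ∀ᶠ n in atTop, (τ n).cut z = ContinuousLinearMap.id ℝ ℂ ∧
      (τ n).der z = ContinuousLinearMap.id ℝ ℂ ∧ (τ n).pot z = ‖z‖ ^ (2 * σ + 2) / (σ + 1))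
    {φ : E N → ℝ} (hφ : GradMemWInfty 3 φ) {p : L2 N × (Fin N → L2 N)} (hp : p ∈ gradGraph N)
    (hp' : MemLp p.1 (ENNReal.ofReal (2 * σ + 2)) volume) :
    Tendsto (fun n => 2 * (inner ℂ ((τ n).velocity s p.1) (gen hφ ((τ n).truncH1 p))).im) atTop
      (𝓝 (virialRate s σ hφ p)) := by
  simp only [fun n => (τ n).two_mul_im_inner_velocity (s := s) hφ hp]
  have h1 := Truncation.tendsto_nem_of_eventually_id (fun n => (τ n).norm_der_le)
    (fun z => (hτ z).mono fun n h => h.2.1) p.1 (-Complex.I • fracLaplacian s p.1)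
  have h2 := ((continuous_gen hφ).tendsto _).comp (tendsto_truncH1 hτ p)
  have h3 := (Complex.continuous_im.tendsto _).comp (h1.inner (𝕜 := ℂ) h2)
  have h4 := Truncation.tendsto_integral_pot hσ hτ hφ.weakLaplacian.memLp hp'
  have h5 := (h3.const_mul 2).add (h4.const_mul 2)
  have h6 : virialRate s σ hφ p =
      2 * (inner ℂ (-Complex.I • fracLaplacian s p.1) (gen hφ p)).im +
        2 * (-(σ / (σ + 1)) * ∫ x, weakLaplacian φ x * ‖p.1 x‖ ^ (2 * σ + 2)) := by
    rw [virialRate, inner_smul_left, map_neg, Complex.conj_I, neg_neg, Complex.mul_im]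
    simp only [Complex.I_re, Complex.I_im]
    ring
  rw [h6]
  exact h5

theorem continuousOn_virialRate_bound {I : Set ℝ} {u w : ℝ → L2 N} {D : ℝ → Fin N → L2 N}
    {J : ℝ → ℝ} (hu : ContinuousOn u I) (hw : ContinuousOn w I)
    (hD : ∀ k, ContinuousOn (fun t => D t k) I) (hJ : ContinuousOn J I) (a : Fin N → ℝ)
    (b C K : ℝ) : ContinuousOn (fun t => 2 * (C * ‖w t‖ * (2 * ∑ k, a k * (C * ‖D t k‖) +
      b * (C * ‖u t‖))) + 2 * (K * J t)) I := by
  fun_prop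

/-- The integrated virial identity. -/
theorem IsSolution.integral_virialRate (hu : IsSolution s σ T u) (hs : 0 ≤ s) (hσ : 0 < σ)
    {φ : E N → ℝ} (hφ : GradMemWInfty 3 φ) {D : ℝ → Fin N → L2 N}
    (hD : ContinuousOn D (timeInterval T))
    (hG : ∀ t ∈ timeInterval T, (u t, D t) ∈ gradGraph N) {a b : ℝ}
    (ha : a ∈ timeInterval T) (hb : b ∈ timeInterval T) (hab : a ≤ b) :
    ∫ t in a..b, virialRate s σ hφ (u t, D t) = virial φ (u b) - virial φ (u a) := by
  obtain ⟨C, hC, τ, hτ⟩ := exists_truncation_seq hσ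
  have hsub : Icc a b ⊆ timeInterval T := (ordConnected_timeInterval T).out ha hb
  have hlim : ∀ t, Tendsto (fun n => (inner ℂ ((τ n).truncH1 (u t, D t)).1
      (gen hφ ((τ n).truncH1 (u t, D t)))).im) atTop
      (𝓝 (inner ℂ (u t) (gen hφ (u t, D t))).im) := by
    intro t
    have h1 := tendsto_truncH1 hτ (u t, D t)
    have h2 := ((continuous_gen hφ).tendsto _).comp h1
    exact (Complex.continuous_im.tendsto _).comp
      (((continuous_fst.tendsto _).comp h1).inner (𝕜 := ℂ) h2)
  have h1 := fun n => (τ n).virial_trunc_sub hu hs hσ hφ hD hG ha hb hab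
  rw [virial_eq hφ (hG b hb), virial_eq hφ (hG a ha)]
  refine tendsto_nhds_unique ?_ ((hlim b).sub (hlim a))
  simp only [← fun n => (h1 n).2]
  have hb' := hφ.weakLaplacian.memLp
  have hcu := hu.continuousOn hs
  have hcw := hu.continuousOn_fracLaplacian hs
  -- The dominating function combines the operator bound for A with the truncation bounds; it
  -- contains only C, not the index n, and is continuous in t.
  refine intervalIntegral.tendsto_integral_filter_of_dominated_convergence
    (fun t => 2 * (C * ‖fracLaplacian s (u t)‖ *
      (2 * ∑ k, ‖mulR (weakPartial k φ) (hφ.weakPartial k).memLp‖ * (C * ‖D t k‖) +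
        ‖mulR (weakLaplacian φ) hφ.weakLaplacian.memLp‖ * (C * ‖u t‖))) +
      2 * ((C + C ^ 2) * ∫ x, |weakLaplacian φ x| * ‖u t x‖ ^ (2 * σ + 2)))
    (Eventually.of_forall fun n => ?_) (Eventually.of_forall fun n => ?_) ?_ ?_
  · rw [uIoc_of_le hab]
    exact ((h1 n).1.mono Ioc_subset_Icc_self).aestronglyMeasurable measurableSet_Ioc
  · refine Eventually.of_forall fun t ht => ?_
    rw [uIoc_of_le hab] at ht
    have ht' := hsub (Ioc_subset_Icc_self ht)
    rw [(τ n).two_mul_im_inner_velocity hφ (hG t ht')]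
    refine (norm_add_le _ _).trans (add_le_add ?_ ?_)
    · rw [norm_mul, Real.norm_two]
      gcongr
      refine (Complex.abs_im_le_norm _).trans ((norm_inner_le_norm _ _).trans ?_)
      refine mul_le_mul ?_ ((norm_gen_le hφ _).trans ?_) (norm_nonneg _) (by positivity)
      · refine (Truncation.norm_nem_le_of_le (τ n).norm_der_le _ _).trans (le_of_eq ?_)
        rw [norm_smul, norm_neg, Complex.norm_I, one_mul]
      · gcongr with k
        · exact Truncation.norm_nem_le_of_le (τ n).norm_der_le _ _
        · exact Truncation.norm_nem_le_of_le (τ n).norm_cut_le _ _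
    · rw [norm_mul, Real.norm_two, Real.norm_eq_abs]
      gcongr
      exact (τ n).norm_integral_pot_le hσ hb' (hu.lebesgue.1 t ht')
  · refine ContinuousOn.intervalIntegrable ?_
    rw [uIcc_of_le hab]
    refine ContinuousOn.mono ?_ hsub
    have hcD : ∀ k, ContinuousOn (fun t => D t k) (timeInterval T) := continuousOn_pi.1 hD
    have hcb : MemLp (fun x => |weakLaplacian φ x|) ∞ volume := hb'.abs
    exact continuousOn_virialRate_bound hcu hcw hcD (hu.continuousOn_integral_mul hσ hcb) _ _ _ _
  · refine Eventually.of_forall fun t ht => ?_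
    rw [uIoc_of_le hab] at ht
    have ht' := hsub (Ioc_subset_Icc_self ht)
    exact tendsto_virialRate (s := s) (p := (u t, D t)) hσ hτ hφ (hG t ht') (hu.lebesgue.1 t ht')

/-- The integrated identity from time 0 exhibits the virial as a primitive of a continuous rate. -/
theorem IsSolution.hasDerivWithinAt_virial (hu : IsSolution s σ T u) (hs : 0 ≤ s) (hσ : 0 < σ)
    {φ : E N → ℝ} (hφ : GradMemWInfty 3 φ) {D : ℝ → Fin N → L2 N}
    (hD : ContinuousOn D (timeInterval T))
    (hG : ∀ t ∈ timeInterval T, (u t, D t) ∈ gradGraph N) {t : ℝ} (ht : t ∈ timeInterval T) :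
    HasDerivWithinAt (fun r => virial φ (u r)) (virialRate s σ hφ (u t, D t))
      (timeInterval T) t := by
  obtain ⟨b, htb, hbT⟩ := EReal.lt_iff_exists_real_btwn.1 ht.2
  rw [EReal.coe_lt_coe_iff] at htb
  have hb0 : 0 ≤ b := ht.1.trans htb.le
  have hb : b ∈ timeInterval T := ⟨hb0, hbT⟩
  have h0 : (0 : ℝ) ∈ timeInterval T := ⟨le_rfl, lt_of_le_of_lt (by exact_mod_cast hb0) hbT⟩
  have hsub : Icc 0 b ⊆ timeInterval T := (ordConnected_timeInterval T).out h0 hb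
  have hR := (hu.continuousOn_virialRate hs hσ hφ hD).mono hsub
  -- Extending the rate by constants beyond [0, b] makes it continuous on ℝ, so the primitive has a
  -- two-sided derivative even at t = 0; it is then restricted to the time interval.
  let R : ℝ → ℝ := IccExtend hb0 ((Icc 0 b).domRestrict fun t => virialRate s σ hφ (u t, D t))
  have hRc : Continuous R := hR.domRestrict.Icc_extend'
  have hReq : ∀ r ∈ Icc 0 b, R r = virialRate s σ hφ (u r, D r) := fun r hr =>
    IccExtend_of_mem _ _ hr
  have h1 : HasDerivAt (fun r => virial φ (u 0) + ∫ y in (0 : ℝ)..r, R y) (R t) t :=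
    (hRc.integral_hasStrictDerivAt 0 t).hasDerivAt.const_add _
  have hmem : Icc 0 b ∈ 𝓝[timeInterval T] t := by
    filter_upwards [self_mem_nhdsWithin, mem_nhdsWithin_of_mem_nhds (Iio_mem_nhds htb)] with r h1 h2
    exact ⟨h1.1, h2.le⟩
  have htm : t ∈ Icc 0 b := ⟨ht.1, htb.le⟩
  have heq : ∀ r ∈ Icc 0 b, virial φ (u r) = virial φ (u 0) + ∫ y in (0 : ℝ)..r, R y := by
    intro r hr
    rw [intervalIntegral.integral_congr (g := fun y => virialRate s σ hφ (u y, D y)) fun y hy => ?_,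
      hu.integral_virialRate hs hσ hφ hD hG h0 (hsub hr) hr.1]
    · ring
    · rw [uIcc_of_le hr.1] at hy
      exact hReq y ⟨hy.1, hy.2.trans hr.2⟩
  rw [← hReq t htm]
  refine h1.hasDerivWithinAt.congr_of_eventuallyEq ?_ (heq t htm)
  filter_upwards [hmem] with r hr using heq r hr

end FracNLS

end

/-! ### The virial identity. -/

theorem mainTheorem4 (N : ℕ) (hN : 1 ≤ N) (s σ : ℝ) (hs : s ∈ Set.Ico (1 / 2 : ℝ) 1) (hσ : 0 < σ)
    (T : EReal) (hT : 0 < T) (u : ℝ → FracNLS.L2 N) (hu : FracNLS.IsSolution s σ T u)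
    (φ : FracNLS.E N → ℝ) (hφ : FracNLS.GradMemWInfty 3 φ) :
    ∀ t ∈ FracNLS.timeInterval T,
      -- every integral in the identity converges absolutely
      Integrable (FracNLS.virialDensity φ (u t)) volume ∧
      (∀ m : ℝ, 0 < m →
        Integrable (FracNLS.dispersiveDensity φ (FracNLS.aux s m (u t))) volume) ∧
      IntegrableOn (fun m : ℝ => ((m ^ s : ℝ) : ℂ) *
        ∫ x, FracNLS.dispersiveDensity φ (FracNLS.aux s m (u t)) x) (Set.Ioi 0) volume ∧
      Integrable (fun x => FracNLS.weakLaplacian φ x * ‖u t x‖ ^ (2 * σ + 2)) volume ∧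
      -- the virial identity, with a one-sided derivative at time zero
      HasDerivWithinAt (fun τ => (FracNLS.virial φ (u τ) : ℂ))
        ((∫ m in Set.Ioi (0 : ℝ), ((m ^ s : ℝ) : ℂ) *
            ∫ x, FracNLS.dispersiveDensity φ (FracNLS.aux s m (u t)) x)
          - ((2 * σ / (σ + 1) *
              ∫ x, FracNLS.weakLaplacian φ x * ‖u t x‖ ^ (2 * σ + 2) : ℝ) : ℂ))
        (FracNLS.timeInterval T) t := by
  intro t ht
  have hs0 : 0 ≤ s := by linarith [hs.1]
  have hs1 : s ∈ Ioo (0 : ℝ) 1 := ⟨by linarith [hs.1], hs.2⟩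
  obtain ⟨D, hD, hgrad⟩ := hu.exists_grad hs.1
  have hw := hu.fourier_fracLaplacian hs0 ht
  refine ⟨FracNLS.integrable_virialDensity hφ (hgrad t ht).mem_gradGraph,
    fun m hm => FracNLS.integrable_dispersiveDensity_aux_resolvent hφ s hm (u t),
    FracNLS.integrableOn_rpow_mul_integral_dispersiveDensity hφ hs1 (hgrad t ht) hw,
    FracNLS.integrable_mul_rpow_norm hσ hφ.weakLaplacian.memLp (hu.lebesgue.1 t ht), ?_⟩
  rw [FracNLS.integral_rpow_mul_integral_dispersiveDensity hφ hs1 (hgrad t ht) hw,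
    ← Complex.ofReal_sub]
  exact (hu.hasDerivWithinAt_virial hs0 hσ hφ hD (fun r hr => (hgrad r hr).mem_gradGraph)
    ht).ofReal_comp
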